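/- **Setting.** For $\epsilon,\delta>0$ and $n\in\mathbb Z$ let $D_{Rn}$ and $D_{Ln}$ be the open unit disks in $\mathbb R^2$ centered at $(1+\frac\epsilon2,\,n(2+\delta))$ and $(-1-\frac\epsilon2,\,n(2+\delta))$, let $E=\mathbb R^2\setminus\overline{\bigcup_{n\in\mathbb Z}(D_{Ln}\cup D_{Rn})}$ and $\Omega=\mathbb R\times(-1-\frac\delta2,\,1+\frac\delta2)$. For $a,b\in\mathbb R$ put $H(x,y)=ax+by$. A solution for $H$ is a function $u$, $C^1$ on $\overline E$, with $\Delta u=0$ in $E$, such that $u$ is constant on $\partial D_{L0}$ and constant on $\partial D_{R0}$ (with unprescribed constants), $\int_{\partial D_{L0}}\partial_\nu u\,ds=\int_{\partial D_{R0}}\partial_\nu u\,ds=0$ ($\nu$ the unit normal pointing into the disk), $\int_{\Omega\setminus\overline{D_{L0}\cup D_{R0}}}|\nabla(u-H)|^2\,dx\,dy<\infty$, and $\nabla u(x,y)=\nabla u(x,y+2+\delta)$ for all $(x,y)\in E$. Let $$N_v=\Big\{(x,y):\ |x|<1+\tfrac\epsilon2-\sqrt{1-y^2},\ |y|<\tfrac{\sqrt3}2\Big\},$$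 $$N_h=\Big\{(x,y):\ \big|y-1-\tfrac\delta2\big|<1+\tfrac\delta2-\sqrt{1-(x-1-\tfrac\epsilon2)^2},\ \big|x-1-\tfrac\epsilon2\big|<\tfrac{\sqrt3}2\Big\},$$ $$S(x,y)=-2\sqrt\delta\,\frac{(x-1-\frac\epsilon2)(y-1-\frac\delta2)}{\big((x-1-\frac\epsilon2)^2+\delta\big)^2}.$$ **Theorem.** There are constants $C>0$ and $r>0$ such that for all $\epsilon,\delta\in(0,r)$ there is a constant $\mu_0$ (depending only on $\epsilon$ and $\delta$) with $\frac1C<\mu_0<C$ such that, for all $a,b\in\mathbb R$ and every solution $u$ for $H(x,y)=ax+by$, $$\nabla u(x,y)=2b\left(\frac{1}{\delta+(x-1-\frac\epsilon2)^2}\,(0,1)+\frac1{\sqrt\delta}\,S(x,y)\,(1,0)\right)+R_1(x,y)\quad\text{for all }(x,y)\in N_h,$$ $$\nabla u(x,y)=a\,\mu_0\,\frac{\sqrt\epsilon}{\epsilon+y^2}\,(1,0)+R_2(x,y)\quad\text{for all }(x,y)\in N_v,$$ where $$\|R_1\|_{L^\infty(N_h)}+\|R_2\|_{L^\infty(N_v)}\le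 C(|a|+|b|).$$ Moreover, the blow-up rates are $1/\delta$ in $N_h$ and $1/\sqrt\epsilon$ in $N_v$, and they are optimal: $|\nabla u|\le C(|a|+|b|)/\delta$ in $N_h$ and $|\nabla u|\le C(|a|+|b|)/\sqrt\epsilon$ in $N_v$; if $C\delta(|a|+|b|)\le|b|$, then $|\nabla u|\ge |b|/(C\delta)$ at some point of $N_h$; and if $C\sqrt\epsilon(|a|+|b|)\le|a|$, then $|\nabla u|\ge|a|/(C\sqrt\epsilon)$ at some point of $N_v$. -/

import Mathlib

noncomputable section

namespace TwoRows

/-! The Euclidean plane `ℝ²` is `ℂ` as a real inner product space: the point `(x, y)` is `x + iy`,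
the vector `(1, 0)` is `1` and the vector `(0, 1)` is `Complex.I`. -/

/-- Center of the `n`-th disk of the right row. -/
def centerR (ε δ : ℝ) (n : ℤ) : ℂ := ⟨1 + ε / 2, n * (2 + δ)⟩

/-- Center of the `n`-th disk of the left row. -/
def centerL (ε δ : ℝ) (n : ℤ) : ℂ := ⟨-1 - ε / 2, n * (2 + δ)⟩

/-- The open unit disk `D_{Rn}`. -/
def diskR (ε δ : ℝ) (n : ℤ) : Set ℂ := Metric.ball (centerR ε δ n) 1

/-- The open unit disk `D_{Ln}`. -/
def diskL (ε δ : ℝ) (n : ℤ) : Set ℂ := Metric.ball (centerL ε δ n) 1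

/-- The open region outside all the conductors. -/
def exterior (ε δ : ℝ) : Set ℂ := (closure (⋃ n : ℤ, diskL ε δ n ∪ diskR ε δ n))ᶜ

/-- The horizontal strip `Ω = ℝ × (-1 - δ/2, 1 + δ/2)`, one period of the structure. -/
def strip (δ : ℝ) : Set ℂ := {z | -1 - δ / 2 < z.im ∧ z.im < 1 + δ / 2}

/-- The flux `∫_{∂D} ∂_ν u ds` through the boundary of the unit disk `D` with center `c`. The unit
normal at `z ∈ ∂D` pointing into `D` is `c - z`, and the gradient at a boundary point is the
one-sided gradient taken from the closed region outside the conductors. -/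
def flux (ε δ : ℝ) (u : ℂ → ℝ) (c : ℂ) : ℝ :=
  ∫ θ in (0 : ℝ)..(2 * Real.pi),
    inner ℝ (gradientWithin u (closure (exterior ε δ)) (circleMap c 1 θ)) (c - circleMap c 1 θ)

/-- `u` is a (classical) solution of the perfect conductivity problem with applied potential `H`.
Only the values of `u` on the closed region outside the conductors matter. -/
structure IsSolution (ε δ : ℝ) (H u : ℂ → ℝ) : Prop where
  harmonic : InnerProductSpace.HarmonicOnNhd u (exterior ε δ)
  /-- `u` is `C¹` up to the boundary, so that its boundary values and fluxes make sense. -/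
  contDiffOn : ContDiffOn ℝ 1 u (closure (exterior ε δ))
  const_left : ∃ cL : ℝ, ∀ z ∈ frontier (diskL ε δ 0), u z = cL
  const_right : ∃ cR : ℝ, ∀ z ∈ frontier (diskR ε δ 0), u z = cR
  flux_left : flux ε δ u (centerL ε δ 0) = 0
  flux_right : flux ε δ u (centerR ε δ 0) = 0
  energy : MeasureTheory.IntegrableOn (fun z => ‖gradient (fun w => u w - H w) z‖ ^ 2)
    (strip δ \ closure (diskL ε δ 0 ∪ diskR ε δ 0))
  periodic : ∀ z ∈ exterior ε δ, gradient u z = gradient u (z + (2 + δ : ℝ) * Complex.I)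

/-- The linear potential `H(x, y) = a x + b y`. -/
def linearPotential (a b : ℝ) (z : ℂ) : ℝ := a * z.re + b * z.im

/-- The narrow region between `D_{L0}` and `D_{R0}`. -/
def narrowV (ε : ℝ) : Set ℂ :=
  {z | |z.re| < 1 + ε / 2 - √(1 - z.im ^ 2) ∧ |z.im| < √3 / 2}

/-- The narrow region between `D_{R0}` and `D_{R1}`. -/
def narrowH (ε δ : ℝ) : Set ℂ :=
  {z | |z.im - 1 - δ / 2| < 1 + δ / 2 - √(1 - (z.re - 1 - ε / 2) ^ 2) ∧
    |z.re - 1 - ε / 2| < √3 / 2}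

/-- The function `S`. -/
def S (ε δ : ℝ) (z : ℂ) : ℝ :=
  -2 * √δ * ((z.re - 1 - ε / 2) * (z.im - 1 - δ / 2) / ((z.re - 1 - ε / 2) ^ 2 + δ) ^ 2)

/-- The vector field `(0,1) / (δ + (x - 1 - ε/2)²) + (S(x,y) / √δ) (1,0)`. -/
def asympH (ε δ : ℝ) (z : ℂ) : ℂ :=
  (1 / (δ + (z.re - 1 - ε / 2) ^ 2)) • Complex.I + (1 / √δ * S ε δ z) • (1 : ℂ)

/-- The vector field `√ε / (ε + y²) (1,0)`. -/
def asympV (ε : ℝ) (z : ℂ) : ℂ := (√ε / (ε + z.im ^ 2)) • (1 : ℂ)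

end TwoRows

end

/-!
A solution increases by `b * (2 + δ)` over one period: its gradient is periodic, so the increment is
constant, and it is read off at infinity, where `∇(u - H) → 0`. Hence the potentials of neighbouring
disks of one row differ by `b * (2 + δ)`, while those of the two rows differ by an unknown
`V = cR - cL`.

Near a gap with potential difference `V`, the solution is compared with `V` times the logarithm of
the ratio of the distances to two points, which is harmonic and has the right constant values on
both circles. The difference is bounded and vanishes on the two circles, so a logarithmic barrier
bounds its gradient up to the boundary; what remains is the explicit gradient of the logarithm.

The vanishing fluxes make the flux of `u` through a period of every vertical line equal to
`a * (2 + δ)`. On the imaginary axis the gap between the rows carries a flux of order `V / √ε` and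
the rest a bounded one, so `V` is of order `a * √ε`. For the lower bound on `V / (a * √ε)` the rest
has to be small: when `b = 0`, the barriers `cosh (κ x) * cos (κ y)` in the channels between the
disks of a row show that between the rows `u` hardly leaves the interval between their potentials.
The reflection in the real axis and linearity show that `V / a` is the same for all solutions.
-/

noncomputable section

namespace TwoRows

open Complex Metric Set Topology Filter InnerProductSpace ComplexConjugate MeasureTheory
open scoped ENNReal

/-! ### Harmonic functions of one complex variable -/

theorem hasGradientAt_re {F : ℂ → ℂ} {F' z : ℂ} (h : HasDerivAt F F' z) :
    HasGradientAt (fun w => (F w).re) (conj F') z := by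
  rw [hasGradientAt_iff_hasFDerivAt]
  have h1 := reCLM.hasFDerivAt.comp z (h.hasFDerivAt.restrictScalars ℝ)
  refine HasFDerivAt.congr_fderiv h1 ?_
  ext
  simp [toDual_apply_apply, Complex.inner]

theorem gradient_eq_fderiv {u : ℂ → ℝ} (z : ℂ) :
    gradient u z = (fderiv ℝ u z 1 : ℂ) + I * fderiv ℝ u z I := by
  have h1 : inner ℝ (gradient u z) 1 = fderiv ℝ u z 1 := inner_gradient_left ..
  have h2 : inner ℝ (gradient u z) I = fderiv ℝ u z I := inner_gradient_left ..
  rw [Complex.inner] at h1 h2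
  apply Complex.ext
  · simpa using h1
  · simpa using h2

theorem exists_harmonicOnNhd_ball {u : ℂ → ℝ} {z : ℂ} (h : HarmonicAt u z) :
    ∃ d > 0, HarmonicOnNhd u (ball z d) := by
  obtain ⟨d, hd, hb⟩ := Metric.eventually_nhds_iff_ball.1 h.eventually
  exact ⟨d, hd, hb⟩

theorem norm_deriv_le_of_re_le {F : ℂ → ℂ} {z : ℂ} {d M : ℝ} (hd : 0 < d) (hM : 0 < M)
    (hF : DifferentiableOn ℂ F (ball z d)) (hre : ∀ w ∈ ball z d, (F w).re ≤ (F z).re + M) :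
    ‖deriv F z‖ ≤ 4 * M / d := by
  have hshift : MapsTo (fun w => z + w) (ball 0 d) (ball z d) := fun w hw => by
    simpa [mem_ball, dist_eq] using hw
  set G : ℂ → ℂ := fun w => F (z + w) - F z with hG
  have hGd : DifferentiableOn ℂ G (ball 0 d) :=
    (hF.comp (by fun_prop) hshift).sub_const _
  have hGre : MapsTo G (ball 0 d) {w | w.re ≤ M} := fun w hw => by
    have := hre _ (hshift hw)
    simp only [hG, mem_ofPred_eq, sub_re]
    linarith
  have hsub : closedBall (0 : ℂ) (d / 2) ⊆ ball 0 d := closedBall_subset_ball (by linarith)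
  have hbound : ∀ w ∈ sphere (0 : ℂ) (d / 2), ‖G w‖ ≤ 2 * M := fun w hw => by
    have h := borelCaratheodory_zero hM hGd hGre hd (hsub (sphere_subset_closedBall hw))
      (by simp [hG])
    rw [mem_sphere_zero_iff_norm.1 hw] at h
    refine h.trans_eq ?_
    field_simp
    ring
  have hcauchy := norm_deriv_le_of_forall_mem_sphere_norm_le (by positivity)
    (hGd.diffContOnCl_ball hsub) hbound
  have hderiv : deriv G 0 = deriv F z := by
    simp [hG, deriv_comp_const_add]
  rw [hderiv] at hcauchy
  exact hcauchy.trans_eq (by field_simp; ring)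

theorem norm_gradient_le_of_abs_le {u : ℂ → ℝ} {z : ℂ} {d M : ℝ} (hd : 0 < d)
    (hu : HarmonicOnNhd u (ball z d)) (hM : ∀ w ∈ ball z d, |u w| ≤ M) :
    ‖gradient u z‖ ≤ 8 * M / d := by
  obtain ⟨F, hF, hFu⟩ := hu.exists_analyticOnNhd_ball_re_eq
  have hz : z ∈ ball z d := mem_ball_self hd
  have hFu' : ∀ w ∈ ball z d, (F w).re = u w := fun w hw => hFu hw
  have hgrad : gradient u z = conj (deriv F z) :=
    ((hasGradientAt_re (hF z hz).differentiableAt.hasDerivAt).congr_of_eventuallyEq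
      (hFu.symm.eventuallyEq_of_mem (isOpen_ball.mem_nhds hz))).gradient
  rw [hgrad, RCLike.norm_conj, le_div_iff₀ hd]
  refine le_of_forall_pos_le_add fun η hη => ?_
  have hMη : 0 < 2 * M + η / 4 := by
    linarith [(abs_nonneg _).trans (hM z hz)]
  have h := norm_deriv_le_of_re_le hd hMη hF.differentiableOn fun w hw => by
    rw [hFu' w hw, hFu' z hz]
    linarith [(abs_le.1 (hM w hw)).2, (abs_le.1 (hM z hz)).1]
  rw [le_div_iff₀ hd] at h
  linarith

theorem eventually_eq_of_isLocalMax {w : ℂ → ℝ} {z : ℂ} (hw : HarmonicAt w z)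
    (hmax : IsLocalMax w z) : ∀ᶠ y in 𝓝 z, w y = w z := by
  obtain ⟨d, hd, hb⟩ := exists_harmonicOnNhd_ball hw
  obtain ⟨F, hF, hFu⟩ := hb.exists_analyticOnNhd_ball_re_eq
  have hz : z ∈ ball z d := mem_ball_self hd
  have hev : ∀ᶠ y in 𝓝 z, y ∈ ball z d := isOpen_ball.mem_nhds hz
  have h1 : ∀ᶠ y in 𝓝 z, DifferentiableAt ℂ (fun y => exp (F y)) y := by
    filter_upwards [hev] with y hy using (hF y hy).differentiableAt.cexp
  have hn : ∀ y ∈ ball z d, ‖exp (F y)‖ = Real.exp (w y) := fun y hy => by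
    rw [norm_exp, show (F y).re = w y from hFu hy]
  have h2 : IsLocalMax (norm ∘ fun y => exp (F y)) z := by
    filter_upwards [hev, hmax] with y hy hy2
    simp only [Function.comp, hn y hy, hn z hz]
    gcongr
  filter_upwards [hev, Complex.eventually_eq_of_isLocalMax_norm h1 h2] with y hy hy2
  have := congrArg norm hy2
  rw [hn y hy, hn z hz] at this
  exact Real.exp_injective this

theorem eqOn_of_isPreconnected_of_isMaxOn {U : Set ℂ} {w : ℂ → ℝ} (hU : IsOpen U)
    (hc : IsPreconnected U) (hw : HarmonicOnNhd w U) {z : ℂ} (hz : z ∈ U)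
    (hmax : IsMaxOn w U z) : EqOn w (fun _ => w z) U :=
  AnalyticOnNhd.eqOn_of_preconnected_of_eventuallyEq (fun y hy => HarmonicAt.analyticAt (hw y hy))
    analyticOnNhd_const hc hz
    (eventually_eq_of_isLocalMax (hw z hz) (hmax.isLocalMax (hU.mem_nhds hz)))

theorem le_of_harmonicOnNhd_of_compact_representatives {P U C₀ : Set ℂ} {w : ℂ → ℝ} {m : ℝ}
    (hU : IsOpen U) (hUP : U ⊆ P) (hC₀ : IsCompact C₀) (hC₀P : C₀ ⊆ P)
    (hcont : ContinuousOn w C₀) (hw : HarmonicOnNhd w U)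
    (hrep : ∀ z ∈ P, ∃ z' ∈ C₀, z'.re = z.re ∧ w z' = w z)
    (hbd : ∀ z ∈ P, z ∉ U → w z ≤ m) : ∀ z ∈ P, w z ≤ m := by
  intro z hz
  by_contra! hlt
  obtain ⟨z', hz', -, -⟩ := hrep z hz
  obtain ⟨s, hs, hmax⟩ := hC₀.exists_isMaxOn ⟨z', hz'⟩ hcont
  have hmaxP : ∀ y ∈ P, w y ≤ w s := fun y hy => by
    obtain ⟨y', hy', -, h⟩ := hrep y hy
    exact h ▸ hmax hy'
  have hsm : m < w s := hlt.trans_le (hmaxP z hz)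
  have hZ : IsCompact (C₀ ∩ w ⁻¹' {w s}) :=
    hC₀.of_isClosed_subset (hcont.preimage_isClosed_of_isClosed hC₀.isClosed isClosed_singleton)
      inter_subset_left
  obtain ⟨t, ht, hre⟩ := hZ.exists_isMaxOn ⟨s, hs, rfl⟩ continuous_re.continuousOn
  -- among the maximum points in `C₀`, one with the largest real part cannot be interior
  have htw : w t = w s := ht.2
  have htU : t ∈ U := by
    by_contra h
    exact (hbd t (hC₀P ht.1) h).not_gt (htw ▸ hsm)
  have hloc : IsLocalMax w t := by
    filter_upwards [hU.mem_nhds htU] with y hy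
    exact htw ▸ hmaxP y (hUP hy)
  have hev := (eventually_eq_of_isLocalMax (hw t htU) hloc).and (hU.mem_nhds htU)
  obtain ⟨e, he, hball⟩ := Metric.eventually_nhds_iff_ball.1 hev
  have hmem : t + (e / 2 : ℝ) ∈ ball t e := by
    simp [abs_of_pos he, he]
  obtain ⟨h1, h2⟩ := hball _ hmem
  obtain ⟨y, hy, hyre, hyw⟩ := hrep _ (hUP h2)
  have := hre (a := y) ⟨hy, hyw.trans (h1.trans htw)⟩
  simp only [mem_ofPred_eq, hyre, add_re, ofReal_re] at this
  linarith


theorem abs_sub_le_of_harmonicOnNhd_of_compact_representatives {P U C₀ : Set ℂ} {w : ℂ → ℝ}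
    {k m : ℝ} (hU : IsOpen U) (hUP : U ⊆ P) (hC₀ : IsCompact C₀) (hC₀P : C₀ ⊆ P)
    (hcont : ContinuousOn w C₀) (hw : HarmonicOnNhd w U)
    (hrep : ∀ z ∈ P, ∃ z' ∈ C₀, z'.re = z.re ∧ w z' = w z)
    (hbd : ∀ z ∈ P, z ∉ U → |w z - k| ≤ m) : ∀ z ∈ P, |w z - k| ≤ m := by
  intro z hz
  have hle := le_of_harmonicOnNhd_of_compact_representatives (m := k + m) hU hUP hC₀ hC₀P hcont hw
    hrep (fun y hy hyU => by linarith [(abs_le.1 (hbd y hy hyU)).2]) z hz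
  have hge := le_of_harmonicOnNhd_of_compact_representatives (w := -w) (m := m - k) hU hUP hC₀ hC₀P
    hcont.neg hw.neg
    (fun y hy => by
      obtain ⟨y', hy', hr, he⟩ := hrep y hy
      exact ⟨y', hy', hr, by rw [Pi.neg_apply, Pi.neg_apply, he]⟩)
    (fun y hy hyU => by
      rw [Pi.neg_apply]
      linarith [(abs_le.1 (hbd y hy hyU)).1]) z hz
  rw [Pi.neg_apply] at hge
  exact abs_le.2 ⟨by linarith, by linarith⟩

/-! ### Geometry of the two rows of disks -/

section Geometry

variable {ε δ : ℝ}

/-- The centers of the disks of both rows. -/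
def centers (ε δ : ℝ) : Set ℂ := range (centerL ε δ) ∪ range (centerR ε δ)

/-- The closed region outside the open disks. -/
def closedExterior (ε δ : ℝ) : Set ℂ := {z | ∀ c ∈ centers ε δ, 1 ≤ dist z c}

theorem abs_re_of_mem_centers (hε : 0 < ε) {c : ℂ} (hc : c ∈ centers ε δ) :
    |c.re| = 1 + ε / 2 := by
  rcases hc with ⟨n, rfl⟩ | ⟨n, rfl⟩
  · rw [show (centerL ε δ n).re = -(1 + ε / 2) by simp only [centerL]; ring, abs_neg,
      abs_of_pos (by linarith)]
  · exact abs_of_pos (by simp only [centerR]; linarith)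

theorem lt_dist_iff {r : ℝ} (hr : 0 ≤ r) {z c : ℂ} :
    r < dist z c ↔ r ^ 2 < (z.re - c.re) ^ 2 + (z.im - c.im) ^ 2 := by
  rw [dist_eq_re_im, Real.lt_sqrt hr]

theorem one_lt_dist_iff {z c : ℂ} :
    1 < dist z c ↔ 1 < (z.re - c.re) ^ 2 + (z.im - c.im) ^ 2 := by
  rw [lt_dist_iff zero_le_one, one_pow]

theorem one_le_dist_iff {z c : ℂ} :
    1 ≤ dist z c ↔ 1 ≤ (z.re - c.re) ^ 2 + (z.im - c.im) ^ 2 := by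
  rw [dist_eq_re_im, Real.le_sqrt' one_pos, one_pow]

theorem le_abs_intCast_mul {T : ℝ} (hT : 0 ≤ T) {n : ℤ} (hn : n ≠ 0) : T ≤ |(n : ℝ) * T| := by
  have h : (1 : ℝ) ≤ |(n : ℝ)| := by
    rw [← Int.cast_abs]; exact_mod_cast Int.one_le_abs hn
  rw [abs_mul, abs_of_nonneg hT]
  nlinarith

theorem locallyFinite_ball_row (hδ : 0 < δ) {c : ℤ → ℂ} (hc : ∀ n, (c n).im = n * (2 + δ)) :
    LocallyFinite fun n => ball (c n) 1 := by
  refine fun z => ⟨ball z 1, ball_mem_nhds z one_pos, ?_⟩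
  refine (Set.finite_Icc (-⌈|z.im| + 2⌉) ⌈|z.im| + 2⌉).subset ?_
  rintro n ⟨w, hw, hwz⟩
  have hwc : |w.im - (c n).im| ≤ 1 := by
    rw [← sub_im]; exact (abs_im_le_norm _).trans (mem_ball_iff_norm.1 hw).le
  have hwz : |w.im - z.im| ≤ 1 := by
    rw [← sub_im]; exact (abs_im_le_norm _).trans (mem_ball_iff_norm.1 hwz).le
  have hn : |(n : ℝ)| ≤ |z.im| + 2 := by
    have h : |(n : ℝ)| ≤ |(c n).im| := by
      rw [hc, abs_mul, abs_of_pos (by linarith : 0 < 2 + δ)]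
      nlinarith [abs_nonneg (n : ℝ)]
    have h1 := abs_sub_abs_le_abs_sub (c n).im w.im
    have h2 := abs_sub_abs_le_abs_sub w.im z.im
    rw [abs_sub_comm] at h1
    linarith
  have hceil := hn.trans (Int.le_ceil _)
  rwa [← Int.cast_abs, Int.cast_le, abs_le] at hceil

theorem closure_iUnion_ball_row (hδ : 0 < δ) {c : ℤ → ℂ} (hc : ∀ n, (c n).im = n * (2 + δ)) :
    closure (⋃ n, ball (c n) 1) = ⋃ n, closedBall (c n) 1 := by
  rw [(locallyFinite_ball_row hδ hc).closure_iUnion]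
  exact iUnion_congr fun n => closure_ball _ one_ne_zero

theorem mem_exterior (hδ : 0 < δ) {z : ℂ} :
    z ∈ exterior ε δ ↔ ∀ c ∈ centers ε δ, 1 < dist z c := by
  simp only [exterior, iUnion_union_distrib, closure_union, diskL, diskR,
    closure_iUnion_ball_row hδ fun n => (rfl : (centerL ε δ n).im = n * (2 + δ)),
    closure_iUnion_ball_row hδ fun n => (rfl : (centerR ε δ n).im = n * (2 + δ))]
  simp [centers, or_imp, forall_and]

theorem isOpen_exterior (ε δ : ℝ) : IsOpen (exterior ε δ) := isClosed_closure.isOpen_compl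

theorem isClosed_closedExterior (ε δ : ℝ) : IsClosed (closedExterior ε δ) := by
  have : closedExterior ε δ = ⋂ c ∈ centers ε δ, {z | 1 ≤ dist z c} := by
    ext; simp [closedExterior]
  rw [this]
  exact isClosed_biInter fun c _ => isClosed_le continuous_const (by fun_prop)

theorem exterior_subset_closedExterior (hδ : 0 < δ) : exterior ε δ ⊆ closedExterior ε δ :=
  fun _ hz c hc => ((mem_exterior hδ).1 hz c hc).le

theorem mem_exterior_iff (hδ : 0 < δ) {z : ℂ} :
    z ∈ exterior ε δ ↔ ∀ n : ℤ, 1 < (z.re - (-1 - ε / 2)) ^ 2 + (z.im - n * (2 + δ)) ^ 2 ∧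
      1 < (z.re - (1 + ε / 2)) ^ 2 + (z.im - n * (2 + δ)) ^ 2 := by
  rw [mem_exterior hδ]
  simp [centers, or_imp, forall_and, one_lt_dist_iff, centerL, centerR]

theorem le_abs_sub_intCast_mul (hδ : 0 < δ) {y : ℝ} (hy : |y| ≤ 1 + δ / 2) {n : ℤ} (hn : n ≠ 0) :
    1 + δ / 2 ≤ |y - n * (2 + δ)| := by
  have h1 := le_abs_intCast_mul (by linarith : 0 ≤ 2 + δ) hn
  have h2 := abs_sub_abs_le_abs_sub ((n : ℝ) * (2 + δ)) y
  rw [abs_sub_comm] at h2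
  linarith

theorem mem_exterior_of_abs_im_le (hδ : 0 < δ) {z : ℂ} (hy : |z.im| ≤ 1 + δ / 2)
    (hL : 1 < (z.re - (-1 - ε / 2)) ^ 2 + z.im ^ 2) (hR : 1 < (z.re - (1 + ε / 2)) ^ 2 + z.im ^ 2) :
    z ∈ exterior ε δ := by
  rw [mem_exterior_iff hδ]
  intro n
  rcases eq_or_ne n 0 with rfl | hn
  · simpa using ⟨hL, hR⟩
  · have h : 1 < (z.im - n * (2 + δ)) ^ 2 := by
      have := le_abs_sub_intCast_mul hδ hy hn
      rw [← sq_abs (z.im - n * (2 + δ))]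
      nlinarith
    constructor
    · linarith [sq_nonneg (z.re - (-1 - ε / 2))]
    · linarith [sq_nonneg (z.re - (1 + ε / 2))]

theorem add_period_mem_centers (n : ℤ) {c : ℂ} (hc : c ∈ centers ε δ) :
    c + n * (2 + δ : ℝ) * I ∈ centers ε δ := by
  rcases hc with ⟨m, rfl⟩ | ⟨m, rfl⟩
  · exact Or.inl ⟨m + n, by apply Complex.ext <;> simp [centerL]; ring⟩
  · exact Or.inr ⟨m + n, by apply Complex.ext <;> simp [centerR]; ring⟩

theorem forall_centers_period (n : ℤ) {p : ℝ → Prop} {z : ℂ} :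
    (∀ c ∈ centers ε δ, p (dist (z + n * (2 + δ : ℝ) * I) c)) ↔
      ∀ c ∈ centers ε δ, p (dist z c) := by
  refine ⟨fun h c hc => ?_, fun h c hc => ?_⟩
  · have := h _ (add_period_mem_centers n hc)
    rwa [dist_add_right] at this
  · have := h _ (add_period_mem_centers (-n) hc)
    convert this using 1
    rw [dist_eq, dist_eq]
    congr 1; push_cast; ring

theorem add_period_mem_exterior (hδ : 0 < δ) (n : ℤ) {z : ℂ} :
    z + n * (2 + δ : ℝ) * I ∈ exterior ε δ ↔ z ∈ exterior ε δ := by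
  rw [mem_exterior hδ, mem_exterior hδ]
  exact forall_centers_period n

theorem add_period_mem_closedExterior (n : ℤ) {z : ℂ} :
    z + n * (2 + δ : ℝ) * I ∈ closedExterior ε δ ↔ z ∈ closedExterior ε δ :=
  forall_centers_period n

theorem exists_period_abs_im_le {δ : ℝ} (hδ : 0 < δ) (z : ℂ) :
    ∃ n : ℤ, |(z + n * (2 + δ : ℝ) * I).im| ≤ 1 + δ / 2 := by
  refine ⟨-round (z.im / (2 + δ)), ?_⟩
  have h := abs_sub_round (z.im / (2 + δ))
  have hT : 0 < 2 + δ := by linarith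
  have h2 : (z + ((-round (z.im / (2 + δ)) : ℤ) : ℂ) * (2 + δ : ℝ) * I).im =
      (z.im / (2 + δ) - round (z.im / (2 + δ))) * (2 + δ) := by
    simp; field_simp; ring
  rw [h2, abs_mul, abs_of_pos hT]
  nlinarith

theorem conj_mem_centers {c : ℂ} (hc : c ∈ centers ε δ) : conj c ∈ centers ε δ := by
  rcases hc with ⟨n, rfl⟩ | ⟨n, rfl⟩
  · exact Or.inl ⟨-n, by apply Complex.ext <;> simp [centerL]⟩
  · exact Or.inr ⟨-n, by apply Complex.ext <;> simp [centerR]⟩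

theorem conj_mem_exterior (hδ : 0 < δ) {z : ℂ} (hz : z ∈ exterior ε δ) :
    conj z ∈ exterior ε δ := by
  rw [mem_exterior hδ] at hz ⊢
  intro c hc
  rw [← conj_conj c, dist_conj_conj]
  exact hz _ (conj_mem_centers hc)

theorem conj_mem_closedExterior {z : ℂ} (hz : z ∈ closedExterior ε δ) :
    conj z ∈ closedExterior ε δ := by
  intro c hc
  rw [← conj_conj c, dist_conj_conj]
  exact hz _ (conj_mem_centers hc)

theorem two_add_le_dist_of_mem_centers (hδ : 0 < δ) {c c' : ℂ}
    (hc : c ∈ centers ε δ) (hc' : c' ∈ centers ε δ) (hne : c ≠ c') :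
    2 + min ε δ ≤ dist c c' := by
  have hv : ∀ m n : ℤ, m ≠ n → 2 + δ ≤ |(m : ℝ) * (2 + δ) - n * (2 + δ)| := fun m n h => by
    rw [← sub_mul, ← Int.cast_sub]
    exact le_abs_intCast_mul (by linarith) (sub_ne_zero.2 h)
  have him : |c.im - c'.im| ≤ dist c c' := by rw [dist_eq, ← sub_im]; exact abs_im_le_norm _
  have hre : |c.re - c'.re| ≤ dist c c' := by rw [dist_eq, ← sub_re]; exact abs_re_le_norm _
  have h1 := min_le_left ε δ
  have h2 := min_le_right ε δ
  rcases hc with ⟨m, rfl⟩ | ⟨m, rfl⟩ <;> rcases hc' with ⟨n, rfl⟩ | ⟨n, rfl⟩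
  · have := hv m n (fun h => hne (by rw [h]))
    simp only [centerL] at him ⊢; linarith
  · have := neg_abs_le ((centerL ε δ m).re - (centerR ε δ n).re)
    simp only [centerL, centerR] at hre this ⊢; linarith
  · have := le_abs_self ((centerR ε δ m).re - (centerL ε δ n).re)
    simp only [centerL, centerR] at hre this ⊢; linarith
  · have := hv m n (fun h => hne (by rw [h]))
    simp only [centerR] at him ⊢; linarith

theorem one_lt_dist_of_dist_eq_one (hδ : 0 < δ) {c c' z w : ℂ}
    (hc : c ∈ centers ε δ) (hc' : c' ∈ centers ε δ) (hne : c' ≠ c) (hz : dist z c = 1)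
    (hw : dist w z < min ε δ) : 1 < dist w c' := by
  have h1 := two_add_le_dist_of_mem_centers hδ hc hc' hne.symm
  have h2 := dist_triangle c z c'
  have h3 := dist_triangle z w c'
  rw [dist_comm c z] at h2
  rw [dist_comm z w] at h3
  linarith

theorem mem_exterior_of_dist_lt {ε δ : ℝ} (hδ : 0 < δ) {c z w : ℂ}
    (hc : c ∈ centers ε δ) (hz : dist z c = 1) (hw : dist w z < min ε δ) (hwc : 1 < dist w c) :
    w ∈ exterior ε δ := by
  rw [mem_exterior hδ]
  intro c' hc'
  rcases eq_or_ne c' c with rfl | hne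
  · exact hwc
  · exact one_lt_dist_of_dist_eq_one hδ hc hc' hne hz hw

theorem exists_center_of_mem_diff (hδ : 0 < δ) {z : ℂ} (hz : z ∈ closedExterior ε δ)
    (hzE : z ∉ exterior ε δ) : ∃ c ∈ centers ε δ, dist z c = 1 := by
  rw [mem_exterior hδ] at hzE
  push Not at hzE
  obtain ⟨c, hc, h⟩ := hzE
  exact ⟨c, hc, le_antisymm h (hz c hc)⟩

theorem dist_center_add_mul {c z : ℂ} (hz : dist z c = 1) {t : ℝ} (ht : 0 ≤ 1 + t) :
    dist (z + t * (z - c)) c = 1 + t := by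
  rw [dist_eq, show z + t * (z - c) - c = ((1 + t : ℝ) : ℂ) * (z - c) by push_cast; ring,
    norm_mul, ← dist_eq, hz, norm_real, Real.norm_of_nonneg ht, mul_one]

theorem dist_add_mul {c z : ℂ} (hz : dist z c = 1) {t : ℝ} (ht : 0 ≤ t) :
    dist (z + t * (z - c)) z = t := by
  rw [dist_eq, add_sub_cancel_left, norm_mul, ← dist_eq, hz, norm_real, Real.norm_of_nonneg ht,
    mul_one]

theorem closure_exterior (hε : 0 < ε) (hδ : 0 < δ) :
    closure (exterior ε δ) = closedExterior ε δ := by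
  refine subset_antisymm
    (closure_minimal (exterior_subset_closedExterior hδ) (isClosed_closedExterior ε δ)) ?_
  intro z hz
  by_cases hzE : z ∈ exterior ε δ
  · exact subset_closure hzE
  obtain ⟨c, hc, hzc⟩ := exists_center_of_mem_diff hδ hz hzE
  rw [Metric.mem_closure_iff]
  intro r hr
  have hmin : 0 < min (min ε δ) r := by positivity
  have ht : 0 ≤ min (min ε δ) r / 2 := by positivity
  have h1 := min_le_left (min ε δ) r
  have h2 := min_le_right (min ε δ) r
  refine ⟨z + (min (min ε δ) r / 2 : ℝ) * (z - c),
    mem_exterior_of_dist_lt hδ hc hzc ?_ ?_, ?_⟩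
  · rw [dist_add_mul hzc ht]; linarith
  · rw [dist_center_add_mul hzc (by linarith)]; linarith
  · rw [dist_comm, dist_add_mul hzc ht]; linarith

theorem uniqueDiffOn_closedExterior (hε : 0 < ε) (hδ : 0 < δ) :
    UniqueDiffOn ℝ (closedExterior ε δ) := by
  intro z hz
  by_cases hzE : z ∈ exterior ε δ
  · exact ((isOpen_exterior ε δ).uniqueDiffWithinAt hzE).mono (exterior_subset_closedExterior hδ)
  obtain ⟨c, hc, hzc⟩ := exists_center_of_mem_diff hδ hz hzE
  have : 0 < min ε δ := lt_min hε hδ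
  set t : ℝ := min ε δ / 4 with ht
  have ht0 : 0 < t := by positivity
  have hu : UniqueDiffWithinAt ℝ (closedBall (z + t * (z - c)) t) z := by
    refine uniqueDiffWithinAt_convex (convex_closedBall _ _) ?_ ?_
    · rw [interior_closedBall _ ht0.ne']; exact ⟨_, mem_ball_self ht0⟩
    · refine subset_closure ?_
      rw [mem_closedBall, dist_comm, dist_add_mul hzc ht0.le]
  refine hu.mono fun w hw c' hc' => ?_
  rw [mem_closedBall] at hw
  rcases eq_or_ne c' c with rfl | hne
  · have h1 := dist_center_add_mul hzc (by linarith : 0 ≤ 1 + t)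
    have h2 := dist_triangle (z + t * (z - c')) w c'
    rw [dist_comm _ w] at h2
    linarith
  · refine (one_lt_dist_of_dist_eq_one hδ hc hc' hne hzc ?_).le
    have := dist_triangle w (z + t * (z - c)) z
    rw [dist_add_mul hzc ht0.le] at this
    linarith

theorem mem_exterior_of_forall_one_lt_abs_re_sub (hδ : 0 < δ) {z : ℂ}
    (h : ∀ c ∈ centers ε δ, 1 < |z.re - c.re|) : z ∈ exterior ε δ := by
  refine (mem_exterior hδ).2 fun c hc => (h c hc).trans_le ?_
  rw [dist_eq, ← sub_re]
  exact abs_re_le_norm _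

theorem mem_exterior_of_lt_abs_re (hε : 0 < ε) (hδ : 0 < δ) {z : ℂ} (hz : 2 + ε / 2 < |z.re|) :
    z ∈ exterior ε δ :=
  mem_exterior_of_forall_one_lt_abs_re_sub hδ fun c hc => by
    have h1 := abs_re_of_mem_centers hε hc
    have h2 := abs_sub_abs_le_abs_sub z.re c.re
    linarith

theorem mem_exterior_of_re_eq_zero (hε : 0 < ε) (hδ : 0 < δ) {z : ℂ} (hz : z.re = 0) :
    z ∈ exterior ε δ :=
  mem_exterior_of_forall_one_lt_abs_re_sub hδ fun c hc => by
    rw [hz, zero_sub, abs_neg, abs_re_of_mem_centers hε hc]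
    linarith

theorem ofReal_mul_I_mem_exterior (hε : 0 < ε) (hδ : 0 < δ) (y : ℝ) : (y * I : ℂ) ∈ exterior ε δ :=
  mem_exterior_of_re_eq_zero hε hδ (by simp)

theorem mem_exterior_of_im_eq (hδ : 0 < δ) {z w : ℂ} (hz : z ∈ exterior ε δ) (him : w.im = z.im)
    (h : ∀ c ∈ centers ε δ, |z.re - c.re| ≤ |w.re - c.re| ∨ 1 < |w.re - c.re|) :
    w ∈ exterior ε δ := by
  rw [mem_exterior hδ] at hz ⊢
  intro c hc
  rcases h c hc with hle | hlt
  · refine (hz c hc).trans_le ?_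
    rw [dist_eq_re_im, dist_eq_re_im, him]
    exact Real.sqrt_le_sqrt (by gcongr ?_ + _; exact sq_le_sq.2 hle)
  · refine hlt.trans_le ?_
    rw [dist_eq, ← sub_re]
    exact abs_re_le_norm _

theorem re_mem_uIcc_of_mem_segment {z z' w : ℂ} (hw : w ∈ segment ℝ z z') :
    w.re ∈ uIcc z.re z'.re := by
  obtain ⟨a, b, ha, hb, hab, rfl⟩ := hw
  rw [← segment_eq_uIcc]
  exact ⟨a, b, ha, hb, hab, by simp⟩

theorem im_eq_of_mem_segment {z z' w : ℂ} (hw : w ∈ segment ℝ z z') (h : z'.im = z.im) :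
    w.im = z.im := by
  obtain ⟨a, b, -, -, hab, rfl⟩ := hw
  simp [h, ← add_mul, hab]

theorem joinedIn_exterior_of_re_eq (hε : 0 < ε) (hδ : 0 < δ) {z w : ℂ}
    (hz : z.re = 0 ∨ 2 + ε / 2 < |z.re|) (h : w.re = z.re) : JoinedIn (exterior ε δ) z w := by
  refine JoinedIn.of_segment_subset fun y hy => ?_
  have hre := re_mem_uIcc_of_mem_segment hy
  rw [h, uIcc_self, mem_singleton_iff] at hre
  rcases hz with hz | hz
  · exact mem_exterior_of_re_eq_zero hε hδ (hre.trans hz)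
  · exact mem_exterior_of_lt_abs_re hε hδ (hre ▸ hz)

theorem mem_exterior_of_abs_im_eq_waist (hδ : 0 < δ) {z : ℂ} (hz : |z.im| = 1 + δ / 2) :
    z ∈ exterior ε δ := by
  have him : 1 < z.im ^ 2 := by
    rw [← sq_abs, hz]
    nlinarith
  refine mem_exterior_of_abs_im_le hδ hz.le ?_ ?_
  · linarith [sq_nonneg (z.re - (-1 - ε / 2))]
  · linarith [sq_nonneg (z.re - (1 + ε / 2))]

theorem joinedIn_exterior_of_im_eq_waist (hδ : 0 < δ) {z w : ℂ} (hz : z.im = 1 + δ / 2)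
    (hw : w.im = 1 + δ / 2) : JoinedIn (exterior ε δ) z w := by
  refine JoinedIn.of_segment_subset fun y hy => mem_exterior_of_abs_im_eq_waist hδ ?_
  rw [im_eq_of_mem_segment hy (hw.trans hz.symm), hz, abs_of_pos (by linarith)]

theorem joinedIn_exterior_zero (hε : 0 < ε) (hδ : 0 < δ) {z : ℂ}
    (hz : z.re = 0 ∨ 2 + ε / 2 < |z.re|) : JoinedIn (exterior ε δ) z 0 :=
  (joinedIn_exterior_of_re_eq (w := ⟨z.re, 1 + δ / 2⟩) hε hδ hz rfl).trans <|
    (joinedIn_exterior_of_im_eq_waist (w := ⟨0, 1 + δ / 2⟩) hδ rfl rfl).trans <|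
      joinedIn_exterior_of_re_eq hε hδ (Or.inl rfl) rfl

/-- Move horizontally towards the imaginary axis if `z` lies between the two columns of centers, and
away from it otherwise: the distance to a center then only decreases when it exceeds `1` anyway. -/
theorem exists_joinedIn_exterior (hε : 0 < ε) (hδ : 0 < δ) {z : ℂ} (hz : z ∈ exterior ε δ) :
    ∃ w : ℂ, (w.re = 0 ∨ 2 + ε / 2 < |w.re|) ∧ JoinedIn (exterior ε δ) z w := by
  have hjoin : ∀ x : ℝ, (∀ t ∈ uIcc z.re x, ∀ c : ℝ, |c| = 1 + ε / 2 →
      |z.re - c| ≤ |t - c| ∨ 1 < |t - c|) → JoinedIn (exterior ε δ) z ⟨x, z.im⟩ := fun x h =>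
    JoinedIn.of_segment_subset fun y hy =>
      mem_exterior_of_im_eq hδ hz (im_eq_of_mem_segment hy rfl) fun c hc =>
        h _ (re_mem_uIcc_of_mem_segment hy) _ (abs_re_of_mem_centers hε hc)
  rcases le_total |z.re| (1 + ε / 2) with hx | hx
  · refine ⟨⟨0, z.im⟩, Or.inl rfl, hjoin 0 fun t ht c hc => ?_⟩
    rw [mem_uIcc] at ht
    grind
  rcases le_abs.1 hx with hx | hx
  · refine ⟨⟨z.re + 2 + ε, z.im⟩, Or.inr (lt_abs.2 (Or.inl ?_)),
      hjoin _ fun t ht c hc => Or.inl ?_⟩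
    · simp only; linarith
    · rw [uIcc_of_le (by linarith), mem_Icc] at ht
      grind
  · refine ⟨⟨z.re - 2 - ε, z.im⟩, Or.inr (lt_abs.2 (Or.inr ?_)),
      hjoin _ fun t ht c hc => Or.inl ?_⟩
    · simp only; linarith
    · rw [uIcc_of_ge (by linarith), mem_Icc] at ht
      grind

theorem isPreconnected_exterior (hε : 0 < ε) (hδ : 0 < δ) : IsPreconnected (exterior ε δ) := by
  have h0 : (0 : ℂ) ∈ exterior ε δ := mem_exterior_of_re_eq_zero hε hδ rfl
  refine IsConnected.isPreconnected (IsPathConnected.isConnected ⟨0, h0, fun {z} hz => ?_⟩)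
  obtain ⟨w, hw, hzw⟩ := exists_joinedIn_exterior hε hδ hz
  exact (hzw.trans (joinedIn_exterior_zero hε hδ hw)).symm

theorem mem_closedExterior_of_dist_eq_one (hε : 0 < ε) (hδ : 0 < δ) {c z : ℂ}
    (hc : c ∈ centers ε δ) (hz : dist z c = 1) : z ∈ closedExterior ε δ := by
  intro c' hc'
  rcases eq_or_ne c' c with rfl | hne
  · exact hz.ge
  · exact (one_lt_dist_of_dist_eq_one hδ hc hc' hne hz (by rw [dist_self]; positivity)).le

end Geometry

/-! ### Gradient bounds up to the boundary -/

theorem normSq_sub_midpoint_ge {c z₀ ζ : ℂ} {r : ℝ} (hz₀ : dist z₀ c = 1) (hζ : 1 ≤ dist ζ c)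
    (hr : 0 ≤ r) (h : r ≤ dist ζ z₀) : 1 + 2 * r ^ 2 ≤ (2 * ‖ζ - (c + z₀) / 2‖) ^ 2 := by
  have h1 : dist z₀ c ^ 2 = (z₀.re - c.re) ^ 2 + (z₀.im - c.im) ^ 2 := by
    rw [dist_eq_re_im, Real.sq_sqrt (by positivity)]
  have h2 : dist ζ z₀ ^ 2 = (ζ.re - z₀.re) ^ 2 + (ζ.im - z₀.im) ^ 2 := by
    rw [dist_eq_re_im, Real.sq_sqrt (by positivity)]
  have h3 := one_le_dist_iff.1 hζ
  have h4 : ‖ζ - (c + z₀) / 2‖ ^ 2 =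
      (ζ.re - (c.re + z₀.re) / 2) ^ 2 + (ζ.im - (c.im + z₀.im) / 2) ^ 2 := by
    rw [← dist_eq, dist_eq_re_im, Real.sq_sqrt (by positivity)]
    simp
  have h5 : r ^ 2 ≤ dist ζ z₀ ^ 2 := by gcongr
  rw [hz₀] at h1
  rw [mul_pow, h4]
  nlinarith

/-- The barrier at the point `z₀` of the circle around `c`: a logarithm which vanishes on the circle
of radius `1 / 2` touching the circle around `c` from inside at `z₀`. -/
def barrier (c z₀ y : ℂ) : ℝ := Real.log ‖(2 : ℂ) * (y - (c + z₀) / 2)‖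

theorem harmonicAt_log_norm_mul_sub {c z A : ℂ} (hA : A ≠ 0) (hz : z ≠ c) :
    HarmonicAt (fun y => Real.log ‖A * (y - c)‖) z :=
  AnalyticAt.harmonicAt_log_norm (by fun_prop) (mul_ne_zero hA (sub_ne_zero.2 hz))

theorem log_le_two_mul_barrier {c z₀ y : ℂ} {r : ℝ} (hz₀ : dist z₀ c = 1) (hy : 1 ≤ dist y c)
    (hr : 0 ≤ r) (h : r ≤ dist y z₀) : Real.log (1 + 2 * r ^ 2) ≤ 2 * barrier c z₀ y :=
  calc _ ≤ Real.log ((2 * ‖y - (c + z₀) / 2‖) ^ 2) :=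
        Real.log_le_log (by positivity) (normSq_sub_midpoint_ge hz₀ hy hr h)
    _ = _ := by simp [barrier, Real.log_pow]

theorem barrier_nonneg {c z₀ y : ℂ} (hz₀ : dist z₀ c = 1) (hy : 1 ≤ dist y c) :
    0 ≤ barrier c z₀ y := by
  have := log_le_two_mul_barrier hz₀ hy le_rfl dist_nonneg
  simp at this
  linarith

theorem harmonicAt_barrier {c z₀ y : ℂ} (hz₀ : dist z₀ c = 1) (hy : 1 ≤ dist y c) :
    HarmonicAt (barrier c z₀) y := by
  refine harmonicAt_log_norm_mul_sub two_ne_zero ?_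
  rintro rfl
  have := normSq_sub_midpoint_ge hz₀ hy le_rfl dist_nonneg
  norm_num at this

theorem barrier_add_mul_sub_le {c z₀ : ℂ} (hz₀ : dist z₀ c = 1) {t : ℝ} (ht : 0 ≤ t) :
    barrier c z₀ (z₀ + t * (z₀ - c)) ≤ 2 * t := by
  have h : (2 : ℂ) * (z₀ + t * (z₀ - c) - (c + z₀) / 2) = ((1 + 2 * t : ℝ) : ℂ) * (z₀ - c) := by
    push_cast; ring
  rw [barrier, h, norm_mul, ← dist_eq, hz₀, mul_one, norm_real, Real.norm_of_nonneg (by positivity)]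
  linarith [Real.log_le_sub_one_of_pos (by positivity : 0 < 1 + 2 * t)]

theorem exists_eq_add_mul_sub {c y : ℂ} (hy : y ≠ c) :
    ∃ z₀, dist z₀ c = 1 ∧ y = z₀ + ((dist y c - 1 : ℝ) : ℂ) * (z₀ - c) := by
  have hpos : 0 < dist y c := dist_pos.2 hy
  refine ⟨c + ((dist y c)⁻¹ : ℝ) * (y - c), ?_, ?_⟩
  · rw [dist_eq, add_sub_cancel_left, norm_mul, norm_real, ← dist_eq,
      Real.norm_of_nonneg (by positivity), inv_mul_cancel₀ hpos.ne']
  · have : (dist y c : ℂ) ≠ 0 := ofReal_ne_zero.2 hpos.ne'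
    push_cast
    field_simp
    ring

/-- A function which is harmonic outside the disks in the ball of radius `ρ` around `z`, vanishes on
the circles and is bounded by `M` there. -/
structure VanishesNear (ε δ : ℝ) (w : ℂ → ℝ) (z : ℂ) (ρ M : ℝ) : Prop where
  cont : ContinuousOn w (closedExterior ε δ ∩ closedBall z ρ)
  harmonic : HarmonicOnNhd w (exterior ε δ ∩ ball z ρ)
  bound : ∀ y ∈ closedExterior ε δ ∩ closedBall z ρ, |w y| ≤ M
  zero : ∀ y ∈ closedExterior ε δ ∩ closedBall z ρ, y ∉ exterior ε δ → w y = 0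

/-- The constant in the gradient bound `VanishesNear.norm_gradient_le`. -/
def gradConst (ρ : ℝ) : ℝ := 64 * (1 / ρ + 1 / Real.log (1 + 2 * (ρ / 4) ^ 2))

theorem log_one_add_two_mul_sq_pos {r : ℝ} (hr : 0 < r) : 0 < Real.log (1 + 2 * r ^ 2) :=
  Real.log_pos (by linarith [pow_pos hr 2])

theorem gradConst_pos {ρ : ℝ} (hρ : 0 < ρ) : 0 < gradConst ρ := by
  have := log_one_add_two_mul_sq_pos (by positivity : 0 < ρ / 4)
  unfold gradConst
  positivity

theorem exists_center_of_not_ball_subset {ε δ : ℝ} (hδ : 0 < δ) {z : ℂ} (hz : z ∈ exterior ε δ)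
    {r : ℝ} (h : ¬ ball z r ⊆ exterior ε δ) :
    ∃ d, 0 < d ∧ d < r ∧ ball z d ⊆ exterior ε δ ∧ ∃ c ∈ centers ε δ, dist z c ≤ d + 1 := by
  obtain ⟨y, hy, hyE⟩ := not_subset.1 h
  have hclosed := (isOpen_exterior ε δ).isClosed_compl
  obtain ⟨x, hx, hdx⟩ := hclosed.exists_infDist_eq_dist ⟨y, hyE⟩ z
  refine ⟨infDist z (exterior ε δ)ᶜ, (hclosed.notMem_iff_infDist_pos ⟨y, hyE⟩).1 (not_not.2 hz),
    (infDist_le_dist_of_mem hyE).trans_lt (by rwa [dist_comm]),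
    disjoint_compl_right_iff_subset.1 disjoint_ball_infDist, ?_⟩
  rw [mem_compl_iff, mem_exterior hδ] at hx
  push Not at hx
  obtain ⟨c, hc, hxc⟩ := hx
  exact ⟨c, hc, (dist_triangle z x c).trans (add_le_add hdx.ge hxc)⟩

namespace VanishesNear

variable {ε δ : ℝ} {w : ℂ → ℝ} {z : ℂ} {ρ M : ℝ}

theorem neg (h : VanishesNear ε δ w z ρ M) : VanishesNear ε δ (-w) z ρ M where
  cont := h.cont.neg
  harmonic := h.harmonic.neg
  bound y hy := by simpa using h.bound y hy
  zero y hy hy' := by simp [h.zero y hy hy']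

theorem mono {z' : ℂ} {ρ' : ℝ} (h : VanishesNear ε δ w z ρ M) (hz : dist z' z + ρ' ≤ ρ) :
    VanishesNear ε δ w z' ρ' M := by
  have h1 : closedBall z' ρ' ⊆ closedBall z ρ := closedBall_subset_closedBall' (by linarith)
  have h2 : ball z' ρ' ⊆ ball z ρ := ball_subset_ball' (by linarith)
  exact ⟨h.cont.mono (inter_subset_inter_right _ h1),
    h.harmonic.mono (inter_subset_inter_right _ h2),
    fun y hy => h.bound y ⟨hy.1, h1 hy.2⟩, fun y hy => h.zero y ⟨hy.1, h1 hy.2⟩⟩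

theorem nonneg (h : VanishesNear ε δ w z ρ M) (hρ : 0 ≤ ρ) (hz : z ∈ closedExterior ε δ) : 0 ≤ M :=
  (abs_nonneg _).trans (h.bound z ⟨hz, mem_closedBall_self hρ⟩)

theorem le_barrier (hδ : 0 < δ) {z₀ c : ℂ} {r : ℝ} (hr : 0 < r) (h : VanishesNear ε δ w z₀ r M)
    (hM : 0 ≤ M) (hc : c ∈ centers ε δ) (hz₀ : dist z₀ c = 1) {y : ℂ}
    (hy : y ∈ closedExterior ε δ ∩ closedBall z₀ r) :
    w y ≤ 2 * M / Real.log (1 + 2 * r ^ 2) * barrier c z₀ y := by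
  set L := Real.log (1 + 2 * r ^ 2)
  have hL : 0 < L := log_one_add_two_mul_sq_pos hr
  have hharm : ∀ y ∈ closedExterior ε δ, HarmonicAt (barrier c z₀) y := fun y hy =>
    harmonicAt_barrier hz₀ (hy c hc)
  have key := le_of_harmonicOnNhd_of_compact_representatives
    (P := closedExterior ε δ ∩ closedBall z₀ r) (U := exterior ε δ ∩ ball z₀ r)
    (C₀ := closedExterior ε δ ∩ closedBall z₀ r) (w := w - (2 * M / L) • barrier c z₀) (m := 0)
    ((isOpen_exterior ε δ).inter isOpen_ball)
    (inter_subset_inter (exterior_subset_closedExterior hδ) ball_subset_closedBall)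
    ((isCompact_closedBall z₀ r).inter_left (isClosed_closedExterior ε δ)) subset_rfl
    (h.cont.sub (ContinuousOn.const_smul (fun y hy =>
      (hharm y hy.1).1.continuousAt.continuousWithinAt) _))
    (h.harmonic.sub (HarmonicOnNhd.const_smul fun y hy =>
      hharm y (exterior_subset_closedExterior hδ hy.1)))
    (fun y hy => ⟨y, hy, rfl, rfl⟩) ?_ y hy
  · simpa using key
  · intro y hy hyU
    simp only [Pi.sub_apply, Pi.smul_apply, smul_eq_mul, sub_nonpos]
    by_cases hyE : y ∈ exterior ε δ
    · have hd : r ≤ dist y z₀ := not_lt.1 fun hlt => hyU ⟨hyE, hlt⟩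
      calc w y ≤ M := (le_abs_self _).trans (h.bound y hy)
        _ = M / L * L := by field_simp
        _ ≤ M / L * (2 * barrier c z₀ y) := by
          gcongr; exact log_le_two_mul_barrier hz₀ (hy.1 c hc) hr.le hd
        _ = _ := by ring
    · have := barrier_nonneg hz₀ (hy.1 c hc)
      rw [h.zero y hy hyE]
      positivity

theorem abs_le_mul_dist (hδ : 0 < δ) {c y : ℂ} (hρ : 0 < ρ) (h : VanishesNear ε δ w z ρ M)
    (hM : 0 ≤ M) (hc : c ∈ centers ε δ) (hy : y ∈ closedExterior ε δ) (hyz : dist y z ≤ ρ / 2)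
    (hyc : dist y c ≤ 1 + ρ / 4) :
    |w y| ≤ 4 * M / Real.log (1 + 2 * (ρ / 4) ^ 2) * (dist y c - 1) := by
  have hyc1 := hy c hc
  obtain ⟨z₀, hz₀, hyz₀⟩ := exists_eq_add_mul_sub (dist_pos.1 (by linarith : 0 < dist y c))
  set t := dist y c - 1
  have ht : 0 ≤ t := by simp only [t]; linarith
  have hdist : dist y z₀ = t := by rw [hyz₀, dist_add_mul hz₀ ht]
  have hV : VanishesNear ε δ w z₀ (ρ / 4) M := h.mono (by
    have := dist_triangle_left z₀ z y
    linarith)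
  have hymem : y ∈ closedExterior ε δ ∩ closedBall z₀ (ρ / 4) :=
    ⟨hy, by rw [mem_closedBall]; linarith⟩
  have hL := log_one_add_two_mul_sq_pos (by positivity : 0 < ρ / 4)
  have hbarrier : 2 * M / Real.log (1 + 2 * (ρ / 4) ^ 2) * barrier c z₀ y ≤
      4 * M / Real.log (1 + 2 * (ρ / 4) ^ 2) * t :=
    calc _ ≤ 2 * M / Real.log (1 + 2 * (ρ / 4) ^ 2) * (2 * t) := by
          gcongr; rw [hyz₀]; exact barrier_add_mul_sub_le hz₀ ht
      _ = _ := by ring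
  exact abs_le'.2 ⟨(hV.le_barrier hδ (by positivity) hM hc hz₀ hymem).trans hbarrier,
    (hV.neg.le_barrier hδ (by positivity) hM hc hz₀ hymem).trans hbarrier⟩

theorem norm_gradient_le_of_ball_subset (hδ : 0 < δ) (h : VanishesNear ε δ w z ρ M) {d : ℝ}
    (hd : 0 < d) (hdρ : d ≤ ρ) (hball : ball z d ⊆ exterior ε δ) {m : ℝ}
    (hm : ∀ y ∈ ball z d, y ∈ closedExterior ε δ → |w y| ≤ m) : ‖gradient w z‖ ≤ 8 * m / d :=
  norm_gradient_le_of_abs_le hd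
    (h.harmonic.mono fun _ hy => ⟨hball hy, ball_subset_ball hdρ hy⟩)
    fun y hy => hm y hy (exterior_subset_closedExterior hδ (hball hy))

theorem norm_gradient_le (hδ : 0 < δ) (hρ : 0 < ρ) (h : VanishesNear ε δ w z ρ M)
    (hz : z ∈ exterior ε δ) : ‖gradient w z‖ ≤ gradConst ρ * M := by
  have hM := h.nonneg hρ.le (exterior_subset_closedExterior hδ hz)
  have hL := log_one_add_two_mul_sq_pos (by positivity : 0 < ρ / 4)
  set L := Real.log (1 + 2 * (ρ / 4) ^ 2)
  by_cases hfar : ball z (ρ / 8) ⊆ exterior ε δ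
  · calc ‖gradient w z‖ ≤ 8 * M / (ρ / 8) :=
          h.norm_gradient_le_of_ball_subset hδ (by positivity) (by linarith) hfar
            fun y hy hyE => h.bound y ⟨hyE, ball_subset_closedBall.trans
              (closedBall_subset_closedBall (by linarith)) hy⟩
      _ = 64 * (1 / ρ + 0) * M := by field_simp; ring
      _ ≤ 64 * (1 / ρ + 1 / L) * M := by gcongr; positivity
  · obtain ⟨d, hd, hdρ, hball, c, hc, hzc⟩ := exists_center_of_not_ball_subset hδ hz hfar
    have hbound : ∀ y ∈ ball z d, y ∈ closedExterior ε δ → |w y| ≤ 4 * M / L * (2 * d) := by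
      intro y hy hyE
      rw [mem_ball] at hy
      have hyc : dist y c ≤ 1 + 2 * d := by linarith [dist_triangle y z c]
      refine (h.abs_le_mul_dist hδ hρ hM hc hyE (by linarith) (by linarith)).trans ?_
      gcongr
      linarith
    calc ‖gradient w z‖ ≤ 8 * (4 * M / L * (2 * d)) / d :=
          h.norm_gradient_le_of_ball_subset hδ hd (by linarith) hball hbound
      _ = 64 * (0 + 1 / L) * M := by field_simp; ring
      _ ≤ 64 * (1 / ρ + 1 / L) * M := by gcongr; positivity

end VanishesNear

/-! ### Decay of square integrable periodic holomorphic functions -/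

theorem enorm_sq_le_lintegral_circle {g : ℂ → ℂ} {z : ℂ} (hg : DifferentiableOn ℂ g (ball z 1))
    {r : ℝ} (hr : r ∈ Ioo (0 : ℝ) 1) :
    ‖g z‖ₑ ^ 2 ≤
      ∫⁻ θ in Ioo (-Real.pi) Real.pi, ‖g (z + Complex.polarCoord.symm (r, θ))‖ₑ ^ 2 := by
  have hmean : g z ^ 2 =
      (2 * Real.pi)⁻¹ • ∫ θ in Ioo (-Real.pi) Real.pi, g (circleMap z r θ) ^ 2 := by
    have hsub : closedBall z |r| ⊆ ball z 1 :=
      closedBall_subset_ball (by rw [abs_of_pos hr.1]; exact hr.2)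
    have h := ((hg.pow 2).diffContOnCl_ball hsub).circleAverage
    simp only [Real.circleAverage_eq_integral_add (-Real.pi), Pi.pow_apply] at h
    rw [intervalIntegral.integral_comp_add_right
      (fun θ => g (circleMap z r θ) ^ 2) (-Real.pi), zero_add,
      show 2 * Real.pi + -Real.pi = Real.pi by ring,
      intervalIntegral.integral_of_le (by linarith [Real.pi_pos]),
      integral_Ioc_eq_integral_Ioo] at h
    exact h.symm
  have hpi : ‖(2 * Real.pi)⁻¹‖ₑ ≤ 1 := by
    rw [Real.enorm_of_nonneg (by positivity), ENNReal.ofReal_le_one]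
    exact inv_le_one_of_one_le₀ (by linarith [Real.pi_gt_three])
  calc ‖g z‖ₑ ^ 2
      = ‖(2 * Real.pi)⁻¹ • ∫ θ in Ioo (-Real.pi) Real.pi, g (circleMap z r θ) ^ 2‖ₑ := by
        rw [← enorm_pow, hmean]
    _ ≤ 1 * ∫⁻ θ in Ioo (-Real.pi) Real.pi, ‖g (circleMap z r θ) ^ 2‖ₑ := by
        rw [enorm_smul]
        gcongr
        exact enorm_integral_le_lintegral_enorm _
    _ = _ := by
        rw [one_mul]
        refine lintegral_congr fun θ => ?_
        rw [enorm_pow, circleMap, Complex.polarCoord_symm_apply, exp_mul_I, ofReal_cos, ofReal_sin]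

theorem lintegral_eq_lintegral_polarCoord {f : ℂ → ℝ≥0∞} (hf : Measurable f) (z : ℂ) :
    ∫⁻ w, f w = ∫⁻ r in Ioi (0 : ℝ), ∫⁻ θ in Ioo (-Real.pi) Real.pi,
      ENNReal.ofReal r * f (z + Complex.polarCoord.symm (r, θ)) := by
  have hmeas : Measurable fun p : ℝ × ℝ =>
      ENNReal.ofReal p.1 * f (z + Complex.polarCoord.symm p) := by
    simp only [Complex.polarCoord_symm_apply]
    fun_prop
  rw [← lintegral_add_left_eq_self f z, ← Complex.lintegral_comp_polarCoord_symm,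
    polarCoord_target, Measure.volume_eq_prod, ← Measure.prod_restrict]
  exact lintegral_prod _ hmeas.aemeasurable

theorem enorm_sq_le_lintegral_ball {g : ℂ → ℂ} {z : ℂ} (hg : DifferentiableOn ℂ g (ball z 1)) :
    ‖g z‖ₑ ^ 2 ≤ 4 * ∫⁻ w in ball z 1, ‖g w‖ₑ ^ 2 := by
  set G : ℂ → ℝ≥0∞ := (ball z 1).indicator fun w => ‖g w‖ₑ ^ 2 with hG
  have hGm : Measurable G := by
    classical
    rw [hG, ← piecewise_eq_indicator]
    exact ContinuousOn.measurable_piecewise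
      ((ENNReal.continuous_pow 2).comp_continuousOn hg.continuousOn.enorm) continuousOn_const
      measurableSet_ball
  have hcircle : ∀ r ∈ Ioo (1 / 2 : ℝ) 1, ENNReal.ofReal (1 / 2) * ‖g z‖ₑ ^ 2 ≤
      ∫⁻ θ in Ioo (-Real.pi) Real.pi,
        ENNReal.ofReal r * G (z + Complex.polarCoord.symm (r, θ)) := by
    intro r hr
    have hr0 : 0 < r := one_half_pos.trans hr.1
    have hmem : ∀ θ, z + Complex.polarCoord.symm (r, θ) ∈ ball z 1 := fun θ => by
      rw [mem_ball, dist_eq, add_sub_cancel_left, norm_polarCoord_symm, abs_of_pos hr0]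
      exact hr.2
    simp only [hG, indicator_of_mem (hmem _)]
    rw [lintegral_const_mul' _ _ ENNReal.ofReal_ne_top]
    gcongr
    · exact hr.1.le
    · exact enorm_sq_le_lintegral_circle hg ⟨hr0, hr.2⟩
  calc ‖g z‖ₑ ^ 2 = 4 * (ENNReal.ofReal (1 / 2) * ‖g z‖ₑ ^ 2 * ENNReal.ofReal (1 - 1 / 2)) := by
        rw [mul_comm (ENNReal.ofReal _), mul_assoc, ← ENNReal.ofReal_mul (by norm_num),
          mul_left_comm, show (4 : ℝ≥0∞) = ENNReal.ofReal 4 by norm_num,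
          ← ENNReal.ofReal_mul (by norm_num)]
        norm_num
    _ = 4 * ∫⁻ _ in Ioo (1 / 2 : ℝ) 1, ENNReal.ofReal (1 / 2) * ‖g z‖ₑ ^ 2 := by
        rw [setLIntegral_const, Real.volume_Ioo]
    _ ≤ 4 * ∫⁻ w, G w := by
        rw [lintegral_eq_lintegral_polarCoord hGm z]
        gcongr 4 * ?_
        exact (setLIntegral_mono' measurableSet_Ioo hcircle).trans
          (lintegral_mono_set fun r hr => one_half_pos.trans hr.1)
    _ = _ := by rw [lintegral_indicator measurableSet_ball]

theorem tendsto_setLIntegral_of_antitone {α : Type*} [MeasurableSpace α] {μ : Measure α}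
    {f : α → ℝ≥0∞} {s : ℕ → Set α} (hs : ∀ n, MeasurableSet (s n)) (hanti : Antitone s)
    (hempty : ⋂ n, s n = ∅) (hfin : ∫⁻ x in s 0, f x ∂μ ≠ ⊤) :
    Tendsto (fun n => ∫⁻ x in s n, f x ∂μ) atTop (𝓝 0) := by
  have h := tendsto_measure_iInter_atTop (μ := μ.withDensity f)
    (fun n => (hs n).nullMeasurableSet) hanti ⟨0, by rwa [withDensity_apply _ (hs 0)]⟩
  rw [hempty, measure_empty] at h
  simpa only [Function.comp_def, withDensity_apply _ (hs _)] using h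

theorem volume_im_eq (c : ℝ) : volume {z : ℂ | z.im = c} = 0 := by
  rw [← frontier_setOfPred_im_lt]
  exact (convex_halfSpace_im_lt c).addHaar_frontier _

theorem setLIntegral_ball_le_three_mul_strip {δ : ℝ} (hδ : 0 < δ) {F : ℂ → ℝ≥0∞}
    (hF : ∀ w (n : ℤ), F (w + n * (2 + δ : ℝ) * I) = F w) {z : ℂ} (hz : |z.im| ≤ 1 + δ / 2) :
    ∫⁻ w in ball z 1, F w ≤ 3 * ∫⁻ w in strip δ, F w := by
  set A : ℤ → Set ℂ := fun n => (fun w => w + n * (2 + δ : ℝ) * I) ⁻¹' strip δ with hA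
  have htranslate : ∀ n, ∫⁻ w in A n, F w = ∫⁻ w in strip δ, F w := fun n => by
    have h := (measurePreserving_add_right (volume : Measure ℂ)
      (n * (2 + δ : ℝ) * I)).setLIntegral_comp_preimage_emb (measurableEmbedding_addRight _) F
        (strip δ)
    simpa only [hF] using h
  have hcover : ball z 1 ≤ᵐ[volume] (A (-1) ∪ A 0 ∪ A 1 : Set ℂ) := by
    have hnull : ∀ c : ℝ, ∀ᵐ w : ℂ, w.im ≠ c := fun c => by
      rw [ae_iff]; simpa using volume_im_eq c
    filter_upwards [hnull (1 + δ / 2), hnull (-1 - δ / 2)] with w htop hbot hw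
    have him := abs_lt.1 ((abs_im_le_norm _).trans_lt (mem_ball_iff_norm.1 hw))
    rw [sub_im] at him
    rw [abs_le] at hz
    have hmem : ∀ n : ℤ, w ∈ A n ↔
        -1 - δ / 2 < w.im + n * (2 + δ) ∧ w.im + n * (2 + δ) < 1 + δ / 2 := fun n => by
      simp [hA, strip]
    change w ∈ (A (-1) ∪ A 0 ∪ A 1)
    simp only [mem_union, hmem]
    push_cast
    rcases lt_or_gt_of_ne htop with h1 | h1
    · rcases lt_or_gt_of_ne hbot with h2 | h2
      · exact Or.inr ⟨by linarith, by linarith⟩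
      · exact Or.inl (Or.inr ⟨by linarith, by linarith⟩)
    · exact Or.inl (Or.inl ⟨by linarith, by linarith⟩)
  calc ∫⁻ w in ball z 1, F w ≤ ∫⁻ w in A (-1) ∪ A 0 ∪ A 1, F w := lintegral_mono_set' hcover
    _ ≤ (∫⁻ w in A (-1), F w) + (∫⁻ w in A 0, F w) + ∫⁻ w in A 1, F w :=
        (lintegral_union_le _ _ _).trans (by gcongr; exact lintegral_union_le _ _ _)
    _ = _ := by simp only [htranslate]; ring

theorem isOpen_strip (δ : ℝ) : IsOpen (strip δ) :=
  (isOpen_lt continuous_const continuous_im).inter (isOpen_lt continuous_im continuous_const)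

theorem tendsto_setLIntegral_strip_tail {δ R : ℝ} {f : ℂ → ℝ≥0∞}
    (hint : ∫⁻ z in strip δ ∩ {z | R < |z.re|}, f z ≠ ⊤) :
    Tendsto (fun n : ℕ => ∫⁻ z in strip δ ∩ {z | R + n < |z.re|}, f z) atTop (𝓝 0) := by
  refine tendsto_setLIntegral_of_antitone (fun n =>
    ((isOpen_strip δ).inter (isOpen_lt continuous_const (by fun_prop))).measurableSet)
    (fun m n hmn => inter_subset_inter_right _ fun z hz => ?_) ?_ (by simpa using hint)
  · have hmn : (m : ℝ) ≤ n := Nat.cast_le.2 hmn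
    exact (by gcongr : R + m ≤ R + n).trans_lt hz
  · refine eq_empty_of_forall_notMem fun z hz => ?_
    obtain ⟨n, hn⟩ := exists_nat_gt (|z.re| - R)
    have h : R + n < |z.re| := (mem_iInter.1 hz n).2
    linarith

theorem enorm_sq_le_lintegral_strip {δ R : ℝ} (hδ : 0 < δ) {g : ℂ → ℂ}
    (hg : ∀ z : ℂ, R < |z.re| → DifferentiableAt ℂ g z)
    (hper : ∀ z : ℂ, R < |z.re| → ∀ n : ℤ, g (z + n * (2 + δ : ℝ) * I) = g z) {z : ℂ}
    (hz : R + 1 < |z.re|) :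
    ‖g z‖ₑ ^ 2 ≤ 12 * ∫⁻ w in strip δ ∩ {w | R < |w.re|}, ‖g w‖ₑ ^ 2 := by
  obtain ⟨m, hm⟩ := exists_period_abs_im_le hδ z
  set z' := z + m * (2 + δ : ℝ) * I with hz'
  have hre : ∀ (w : ℂ) (n : ℤ), (w + n * (2 + δ : ℝ) * I).re = w.re := by simp
  have hball : ball z' 1 ⊆ {w | R < |w.re|} := fun w hw => by
    have h1 := (abs_re_le_norm (w - z')).trans_lt (mem_ball_iff_norm.1 hw)
    rw [sub_re, hz', hre, abs_sub_comm] at h1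
    have h2 := abs_sub_abs_le_abs_sub z.re w.re
    exact show R < |w.re| by linarith
  set F : ℂ → ℝ≥0∞ := {w | R < |w.re|}.indicator fun w => ‖g w‖ₑ ^ 2 with hF
  have hFper : ∀ w (n : ℤ), F (w + n * (2 + δ : ℝ) * I) = F w := fun w n => by
    have hiff : w + n * (2 + δ : ℝ) * I ∈ {w : ℂ | R < |w.re|} ↔ w ∈ {w : ℂ | R < |w.re|} := by
      simp only [mem_ofPred_eq, hre]
    by_cases hw : w ∈ {w : ℂ | R < |w.re|}
    · rw [hF, indicator_of_mem (hiff.2 hw), indicator_of_mem hw, hper w hw n]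
    · rw [hF, indicator_of_notMem (mt hiff.1 hw), indicator_of_notMem hw]
  calc ‖g z‖ₑ ^ 2 = ‖g z'‖ₑ ^ 2 := by rw [hz', hper z (by linarith) m]
    _ ≤ 4 * ∫⁻ w in ball z' 1, ‖g w‖ₑ ^ 2 :=
        enorm_sq_le_lintegral_ball fun w hw => (hg w (hball hw)).differentiableWithinAt
    _ = 4 * ∫⁻ w in ball z' 1, F w := by
        congr 1
        refine setLIntegral_congr_fun measurableSet_ball fun w hw => ?_
        rw [hF, indicator_of_mem (hball hw)]
    _ ≤ 4 * (3 * ∫⁻ w in strip δ, F w) := by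
        gcongr; exact setLIntegral_ball_le_three_mul_strip hδ hFper hm
    _ = _ := by
        rw [hF, setLIntegral_indicator
          (isOpen_lt continuous_const (by fun_prop : Continuous fun w : ℂ => |w.re|)).measurableSet,
          inter_comm, ← mul_assoc]
        norm_num

theorem exists_norm_le_of_periodic {δ R : ℝ} (hδ : 0 < δ) {g : ℂ → ℂ}
    (hg : ∀ z : ℂ, R < |z.re| → DifferentiableAt ℂ g z)
    (hper : ∀ z : ℂ, R < |z.re| → ∀ n : ℤ, g (z + n * (2 + δ : ℝ) * I) = g z)
    (hint : ∫⁻ z in strip δ ∩ {z | R < |z.re|}, ‖g z‖ₑ ^ 2 ≠ ⊤) {η : ℝ} (hη : 0 < η) :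
    ∃ X > R, ∀ z : ℂ, X < |z.re| → ‖g z‖ ≤ η := by
  have hpos : (0 : ℝ≥0∞) < ENNReal.ofReal (η ^ 2) / 12 :=
    ENNReal.div_pos (by simpa using hη.ne') (by norm_num)
  obtain ⟨n, hn⟩ := ((tendsto_setLIntegral_strip_tail hint).eventually (gt_mem_nhds hpos)).exists
  have hRn : R ≤ R + n := le_add_of_nonneg_right n.cast_nonneg
  refine ⟨R + n + 1, by linarith, fun z hz => ?_⟩
  have hsq : ‖g z‖ₑ ^ 2 ≤ ENNReal.ofReal (η ^ 2) :=
    calc ‖g z‖ₑ ^ 2 ≤ 12 * ∫⁻ w in strip δ ∩ {w | R + n < |w.re|}, ‖g w‖ₑ ^ 2 :=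
          enorm_sq_le_lintegral_strip hδ (fun w hw => hg w (hRn.trans_lt hw))
            (fun w hw => hper w (hRn.trans_lt hw)) hz
      _ ≤ 12 * (ENNReal.ofReal (η ^ 2) / 12) := by gcongr
      _ = ENNReal.ofReal (η ^ 2) := ENNReal.mul_div_cancel (by norm_num) (by norm_num)
  rw [← ofReal_norm, ← ENNReal.ofReal_pow (norm_nonneg _),
    ENNReal.ofReal_le_ofReal_iff (by positivity)] at hsq
  exact (sq_le_sq₀ (norm_nonneg _) hη.le).1 hsq

/-! ### Flux through vertical lines -/

section Flux

variable {κ : ℝ} {c : ℂ} {f : ℂ → ℂ}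

theorem integral_complex_eq {h : ℂ → ℂ} (hc : Continuous h) (hs : HasCompactSupport h) :
    ∫ z, h z = ∫ x : ℝ, ∫ y : ℝ, h (x + y * I) := by
  rw [← (volume_preserving_equiv_real_prod.symm).integral_comp
    measurableEquivRealProd.symm.measurableEmbedding]
  have he : ∀ p : ℝ × ℝ, measurableEquivRealProd.symm p = p.1 + p.2 * I := fun p => by
    rw [← mk_eq_add_mul_I]; rfl
  simp only [he]
  rw [Measure.volume_eq_prod, integral_prod]
  refine Continuous.integrable_of_hasCompactSupport (by fun_prop) ?_
  have hcomp := hs.comp_homeomorph equivRealProdCLM.symm.toHomeomorph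
  rwa [show h ∘ equivRealProdCLM.symm.toHomeomorph = fun p : ℝ × ℝ => h (p.1 + p.2 * I) from
    funext fun p => congrArg h (he p)] at hcomp

/-- A smooth step from `0` on `(-∞, 1 + κ]` to `1` on `[1 + 2κ, ∞)`, applied below to the squared
distance from the center of a disk. -/
def cutoff (κ s : ℝ) : ℝ := Real.smoothTransition ((s - 1 - κ) / κ)

theorem contDiff_cutoff (κ : ℝ) : ContDiff ℝ 1 (cutoff κ) :=
  Real.smoothTransition.contDiff.comp (by fun_prop)

theorem cutoff_eq_zero {s : ℝ} (hκ : 0 < κ) (hs : s ≤ 1 + κ) : cutoff κ s = 0 :=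
  Real.smoothTransition.zero_of_nonpos (div_nonpos_of_nonpos_of_nonneg (by linarith) hκ.le)

theorem cutoff_eq_one {s : ℝ} (hκ : 0 < κ) (hs : 1 + 2 * κ ≤ s) : cutoff κ s = 1 :=
  Real.smoothTransition.one_of_one_le (by rw [le_div_iff₀ hκ]; linarith)

theorem deriv_cutoff_eq_zero {s : ℝ} (hκ : 0 < κ) (hs : s < 1 + κ ∨ 1 + 2 * κ < s) :
    deriv (cutoff κ) s = 0 := by
  rcases hs with hs | hs
  · have : cutoff κ =ᶠ[𝓝 s] fun _ => 0 := by
      filter_upwards [gt_mem_nhds hs] with t ht using cutoff_eq_zero hκ ht.le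
    rw [this.deriv_eq, deriv_const]
  · have : cutoff κ =ᶠ[𝓝 s] fun _ => 1 := by
      filter_upwards [lt_mem_nhds hs] with t ht using cutoff_eq_one hκ ht.le
    rw [this.deriv_eq, deriv_const]

/-- The function `f` cut off near the closed unit disk around `c`. -/
def truncation (κ : ℝ) (c : ℂ) (f : ℂ → ℂ) (z : ℂ) : ℂ := cutoff κ (‖z - c‖ ^ 2) • f z

/-- The defect `i ∂ₓF - ∂ᵧF = 2i ∂̄F` in the Cauchy-Riemann equations of the truncation `F` of a
holomorphic function `f`. -/
def truncationDefect (κ : ℝ) (c : ℂ) (f : ℂ → ℂ) (z : ℂ) : ℂ :=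
  2 * I * ((deriv (cutoff κ) (‖z - c‖ ^ 2) : ℝ) : ℂ) * (f z * (z - c))

theorem mem_closedBall_of_norm_sub_sq_le (hκ : 0 ≤ κ) {z : ℂ} (hz : ‖z - c‖ ^ 2 ≤ 1 + 2 * κ) :
    z ∈ closedBall c (1 + κ) := by
  rw [mem_closedBall, dist_eq]
  exact (abs_le_of_sq_le_sq' (by nlinarith) (by linarith)).2

theorem one_lt_dist_of_one_lt_norm_sub_sq {z : ℂ} (hz : 1 < ‖z - c‖ ^ 2) : 1 < dist z c := by
  rw [dist_eq]
  exact (one_lt_sq_iff₀ (norm_nonneg _)).1 hz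

theorem truncation_eq_self (hκ : 0 < κ) {z : ℂ} (hz : z ∉ closedBall c (1 + κ)) :
    truncation κ c f z = f z := by
  have : 1 + 2 * κ ≤ ‖z - c‖ ^ 2 := by
    by_contra! hlt
    exact hz (mem_closedBall_of_norm_sub_sq_le hκ.le hlt.le)
  rw [truncation, cutoff_eq_one hκ this, one_smul]

theorem truncationDefect_eq_zero (hκ : 0 < κ) {z : ℂ}
    (hz : ‖z - c‖ ^ 2 < 1 + κ ∨ 1 + 2 * κ < ‖z - c‖ ^ 2) : truncationDefect κ c f z = 0 := by
  simp [truncationDefect, deriv_cutoff_eq_zero hκ hz]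

theorem mem_closedBall_of_truncationDefect_ne_zero (hκ : 0 < κ) {z : ℂ}
    (hz : truncationDefect κ c f z ≠ 0) : z ∈ closedBall c (1 + κ) := by
  refine mem_closedBall_of_norm_sub_sq_le hκ.le ?_
  by_contra! hlt
  exact hz (truncationDefect_eq_zero hκ (Or.inr hlt))

theorem continuous_truncationDefect (hκ : 0 < κ)
    (hf : ∀ z ∈ closedBall c (1 + κ), 1 < dist z c → ContinuousAt f z) :
    Continuous (truncationDefect κ c f) := by
  have hderiv : Continuous (deriv (cutoff κ)) := (contDiff_cutoff κ).continuous_deriv le_rfl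
  have hnorm : Continuous fun z : ℂ => ‖z - c‖ ^ 2 := by fun_prop
  rw [continuous_iff_continuousAt]
  intro z
  by_cases hz : ‖z - c‖ ^ 2 < 1 + κ ∨ 1 + 2 * κ < ‖z - c‖ ^ 2
  · have hopen : IsOpen {w : ℂ | ‖w - c‖ ^ 2 < 1 + κ ∨ 1 + 2 * κ < ‖w - c‖ ^ 2} :=
      (isOpen_lt hnorm continuous_const).union (isOpen_lt continuous_const hnorm)
    refine continuousAt_const.congr (f := fun _ => (0 : ℂ)) ?_
    filter_upwards [hopen.mem_nhds hz] with w hw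
    exact (truncationDefect_eq_zero hκ hw).symm
  · push Not at hz
    have hfz : ContinuousAt f z := hf z (mem_closedBall_of_norm_sub_sq_le hκ.le hz.2)
      (one_lt_dist_of_one_lt_norm_sub_sq (by linarith))
    have hcut : ContinuousAt (fun z => ((deriv (cutoff κ) (‖z - c‖ ^ 2) : ℝ) : ℂ)) z := by fun_prop
    unfold truncationDefect
    fun_prop

theorem exists_hasFDerivAt_truncation (hκ : 0 < κ) {z : ℂ}
    (hf : 1 < dist z c → DifferentiableAt ℂ f z) :
    ∃ F' : ℂ →L[ℝ] ℂ, HasFDerivAt (truncation κ c f) F' z ∧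
      I • F' 1 - F' I = truncationDefect κ c f z := by
  by_cases hz : ‖z - c‖ ^ 2 < 1 + κ
  · refine ⟨0, (hasFDerivAt_const (0 : ℂ) z).congr_of_eventuallyEq ?_,
      by simp [truncationDefect_eq_zero hκ (Or.inl hz)]⟩
    have hopen : IsOpen {w : ℂ | ‖w - c‖ ^ 2 < 1 + κ} := isOpen_lt (by fun_prop) continuous_const
    filter_upwards [hopen.mem_nhds hz] with w hw
    simp [truncation, cutoff_eq_zero hκ (le_of_lt hw)]
  · have hfz := (hf (one_lt_dist_of_one_lt_norm_sub_sq
      (by linarith))).hasDerivAt.hasFDerivAt.restrictScalars ℝ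
    have hcut : HasDerivAt (cutoff κ) (deriv (cutoff κ) (‖z - c‖ ^ 2)) (‖z - c‖ ^ 2) :=
      ((contDiff_cutoff κ).differentiable one_ne_zero _).hasDerivAt
    have hnorm : HasFDerivAt (fun z : ℂ => ‖z - c‖ ^ 2) (2 • innerSL ℝ (z - c)) z := by
      simpa using ((hasFDerivAt_id z).sub_const c).norm_sq
    have hcomp := hcut.comp_hasFDerivAt z hnorm
    refine ⟨_, hcomp.smul hfz, ?_⟩
    have hinner_one : inner ℝ (z - c) 1 = (z - c).re := by simp [Complex.inner]
    have hinner_I : inner ℝ (z - c) I = (z - c).im := by simp [Complex.inner]; ring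
    simp only [truncationDefect, Function.comp_apply, add_apply, smul_apply,
      ContinuousLinearMap.smulRight_apply, innerSL_apply_apply, hinner_one, hinner_I, real_smul,
      smul_eq_mul, nsmul_eq_mul, ContinuousLinearMap.coe_restrictScalars',
      ContinuousLinearMap.toSpanSingleton_apply, one_mul]
    push_cast
    linear_combination
      (-2 * ((deriv (cutoff κ) (‖z - c‖ ^ 2) : ℝ) : ℂ) * f z * ((z - c).im : ℂ)) * I_sq +
      (2 * I * ((deriv (cutoff κ) (‖z - c‖ ^ 2) : ℝ) : ℂ) * f z) * re_add_im (z - c)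

theorem integral_polarCoord_symm_eq_integral_circleMap (g : ℂ → ℂ) (r : ℝ) :
    ∫ θ in Ioo (-Real.pi) Real.pi, g (Complex.polarCoord.symm (r, θ)) =
      ∫ θ in 0..(2 * Real.pi), g (circleMap 0 r θ) := by
  have hpolar : ∀ θ, Complex.polarCoord.symm (r, θ) = circleMap 0 r θ := fun θ => by
    rw [circleMap, Complex.polarCoord_symm_apply, exp_mul_I, ofReal_cos, ofReal_sin, zero_add]
  have hper : Function.Periodic (fun θ => g (circleMap 0 r θ)) (2 * Real.pi) :=
    (periodic_circleMap 0 r).comp g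
  have hshift := hper.intervalIntegral_add_eq 0 (-Real.pi)
  rw [zero_add, show -Real.pi + 2 * Real.pi = Real.pi by ring,
    intervalIntegral.integral_of_le (a := -Real.pi) (by linarith [Real.pi_pos]),
    integral_Ioc_eq_integral_Ioo] at hshift
  simp only [hshift, hpolar]

theorem integrableOn_polarCoord_truncationDefect (hκ : 0 < κ)
    (hc : Continuous (truncationDefect κ c f)) :
    IntegrableOn (fun p : ℝ × ℝ => p.1 • truncationDefect κ c f (c + Complex.polarCoord.symm p))
      (Ioi 0 ×ˢ Ioo (-Real.pi) Real.pi) := by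
  have hcont : Continuous fun p : ℝ × ℝ =>
      p.1 • truncationDefect κ c f (c + Complex.polarCoord.symm p) := by
    simp only [Complex.polarCoord_symm_apply]
    fun_prop
  have hint := hcont.continuousOn.integrableOn_compact (μ := volume)
    (isCompact_Icc.prod isCompact_Icc : IsCompact (Icc 0 (1 + κ) ×ˢ Icc (-Real.pi) Real.pi))
  refine hint.of_forall_sdiff_eq_zero (measurableSet_Ioi.prod measurableSet_Ioo) ?_
  rintro ⟨r, θ⟩ ⟨⟨hr, hθ⟩, hn⟩
  have hr1 : 1 + κ < r := by
    by_contra! hle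
    exact hn ⟨⟨le_of_lt hr, hle⟩, Ioo_subset_Icc_self hθ⟩
  dsimp only
  rw [truncationDefect_eq_zero hκ, smul_zero]
  right
  rw [add_sub_cancel_left, norm_polarCoord_symm, sq_abs]
  nlinarith

theorem integral_angle_truncationDefect (r : ℝ) :
    ∫ θ in Ioo (-Real.pi) Real.pi, r • truncationDefect κ c f (c + Complex.polarCoord.symm (r, θ)) =
      ((2 * r * deriv (cutoff κ) (r ^ 2) : ℝ) : ℂ) *
        (I * ∫ θ in 0..(2 * Real.pi), f (circleMap c r θ) * circleMap 0 r θ) := by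
  have hcircle : ∀ θ, c + circleMap 0 r θ = circleMap c r θ := fun θ => by simp [circleMap]
  have hpt : ∀ θ, r • truncationDefect κ c f (c + Complex.polarCoord.symm (r, θ)) =
      ((2 * r * deriv (cutoff κ) (r ^ 2) : ℝ) : ℂ) * (I *
        (f (c + Complex.polarCoord.symm (r, θ)) * Complex.polarCoord.symm (r, θ))) := fun θ => by
    rw [truncationDefect, add_sub_cancel_left, norm_polarCoord_symm, sq_abs, real_smul]
    push_cast
    ring
  simp only [hpt]
  rw [integral_const_mul, integral_const_mul,
    integral_polarCoord_symm_eq_integral_circleMap fun w => f (c + w) * w]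
  simp only [hcircle]

theorem im_integral_truncationDefect_eq_zero (hκ : 0 < κ)
    (hc : Continuous (truncationDefect κ c f))
    (hflux : ∀ r ∈ Ioo 1 (1 + κ),
      (∫ θ in 0..(2 * Real.pi), f (circleMap c r θ) * circleMap 0 r θ).re = 0) :
    (∫ z, truncationDefect κ c f z).im = 0 := by
  rw [← integral_add_left_eq_self _ c, ← Complex.integral_comp_polarCoord_symm, polarCoord_target,
    Measure.volume_eq_prod, setIntegral_prod _ (integrableOn_polarCoord_truncationDefect hκ hc)]
  have hreal : ∀ r ∈ Ioi (0 : ℝ), (∫ θ in Ioo (-Real.pi) Real.pi,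
      r • truncationDefect κ c f (c + Complex.polarCoord.symm (r, θ))) =
      (((∫ θ in Ioo (-Real.pi) Real.pi,
        r • truncationDefect κ c f (c + Complex.polarCoord.symm (r, θ))).re : ℝ) : ℂ) := by
    intro r hr
    refine Complex.ext rfl ?_
    rw [integral_angle_truncationDefect, im_ofReal_mul, I_mul_im, ofReal_im]
    by_cases hr2 : r ^ 2 < 1 + κ ∨ 1 + 2 * κ < r ^ 2
    · simp [deriv_cutoff_eq_zero hκ hr2]
    · push Not at hr2
      rw [hflux r ⟨by nlinarith [mem_Ioi.1 hr], by nlinarith [mem_Ioi.1 hr]⟩, mul_zero]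
  rw [setIntegral_congr_fun measurableSet_Ioi hreal, integral_complex_ofReal, ofReal_im]

theorem integral_rect_eq_integral {x₀ x₁ y₀ y₁ : ℝ} {h : ℂ → ℂ} (hc : Continuous h)
    (hs : HasCompactSupport h) (hrect : ∀ z, h z ≠ 0 → z ∈ Ioo x₀ x₁ ×ℂ Ioo y₀ y₁) :
    (∫ x in x₀..x₁, ∫ y in y₀..y₁, h (x + y * I)) = ∫ z, h z := by
  rw [integral_complex_eq hc hs, ← intervalIntegral.integral_eq_integral_of_support_subset]
  · refine intervalIntegral.integral_congr fun x _ => ?_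
    refine intervalIntegral.integral_eq_integral_of_support_subset fun y hy => ?_
    exact Ioo_subset_Ioc_self (by simpa using (hrect _ hy).2)
  · intro x hx
    by_contra hxn
    refine hx (integral_eq_zero_of_ae (Eventually.of_forall fun y => ?_))
    by_contra hne
    exact hxn (Ioo_subset_Ioc_self (by simpa using (hrect _ hne).1))

theorem integral_boundary_rect_truncation {x₀ x₁ y₀ y₁ : ℝ} (hκ : 0 < κ) (hx : x₀ ≤ x₁)
    (hy : y₀ ≤ y₁) (hball : closedBall c (1 + κ) ⊆ Ioo x₀ x₁ ×ℂ Ioo y₀ y₁)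
    (hd : ∀ z ∈ Icc x₀ x₁ ×ℂ Icc y₀ y₁, 1 < dist z c → DifferentiableAt ℂ f z) :
    (∫ x in x₀..x₁, truncation κ c f (x + y₀ * I)) - (∫ x in x₀..x₁, truncation κ c f (x + y₁ * I))
      + I • (∫ y in y₀..y₁, truncation κ c f (x₁ + y * I)) -
      I • (∫ y in y₀..y₁, truncation κ c f (x₀ + y * I)) = ∫ z, truncationDefect κ c f z := by
  have hrect : Ioo x₀ x₁ ×ℂ Ioo y₀ y₁ ⊆ Icc x₀ x₁ ×ℂ Icc y₀ y₁ := fun z hz =>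
    ⟨Ioo_subset_Icc_self hz.1, Ioo_subset_Icc_self hz.2⟩
  have hderiv : ∀ z ∈ Icc x₀ x₁ ×ℂ Icc y₀ y₁,
      HasFDerivAt (truncation κ c f) (fderiv ℝ (truncation κ c f) z) z ∧
      I • fderiv ℝ (truncation κ c f) z 1 - fderiv ℝ (truncation κ c f) z I =
        truncationDefect κ c f z := fun z hz => by
    obtain ⟨F', hF, hI⟩ := exists_hasFDerivAt_truncation hκ (hd z hz)
    rw [hF.fderiv]
    exact ⟨hF, hI⟩
  have hc : Continuous (truncationDefect κ c f) := continuous_truncationDefect hκ fun z hz hzc =>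
    (hd z (hrect (hball hz)) hzc).continuousAt
  have hs : HasCompactSupport (truncationDefect κ c f) :=
    HasCompactSupport.intro (isCompact_closedBall c (1 + κ)) fun z hz =>
      by_contra fun hne => hz (mem_closedBall_of_truncationDefect_ne_zero hκ hne)
  have hclosed : IsClosed (Icc x₀ x₁ ×ℂ Icc y₀ y₁) := isClosed_Icc.reProdIm isClosed_Icc
  have hgreen := integral_boundary_rect_of_continuousOn_of_hasFDerivAt_real (truncation κ c f)
    (fderiv ℝ (truncation κ c f)) (x₀ + y₀ * I) (x₁ + y₁ * I)
  simp only [add_re, add_im, mul_re, mul_im, ofReal_re, ofReal_im, I_re, I_im, mul_zero, sub_zero,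
    mul_one, add_zero, zero_add, uIcc_of_le hx, uIcc_of_le hy, min_eq_left hx, max_eq_right hx,
    min_eq_left hy, max_eq_right hy] at hgreen
  rw [hgreen (fun z hz => (hderiv z hz).1.continuousAt.continuousWithinAt)
    (fun z hz => (hderiv z (hrect hz)).1)
    ((hc.continuousOn.integrableOn_compact (isCompact_Icc.reProdIm isCompact_Icc)).congr_fun
      (fun z hz => (hderiv z hz).2.symm) hclosed.measurableSet),
    ← integral_rect_eq_integral hc hs fun z hz =>
      hball (mem_closedBall_of_truncationDefect_ne_zero hκ hz)]
  refine intervalIntegral.integral_congr fun x hx' =>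
    intervalIntegral.integral_congr fun y hy' => ?_
  rw [uIcc_of_le hx] at hx'
  rw [uIcc_of_le hy] at hy'
  exact (hderiv _ ⟨by simpa using hx', by simpa using hy'⟩).2

theorem re_integral_vertical_eq {x₀ x₁ y₀ y₁ : ℝ} (hκ : 0 < κ)
    (hball : closedBall c (1 + κ) ⊆ Ioo x₀ x₁ ×ℂ Ioo y₀ y₁)
    (hd : ∀ z ∈ Icc x₀ x₁ ×ℂ Icc y₀ y₁, 1 < dist z c → DifferentiableAt ℂ f z)
    (hper : ∀ x ∈ Icc x₀ x₁, f (x + y₁ * I) = f (x + y₀ * I))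
    (hflux : ∀ r ∈ Ioo 1 (1 + κ),
      (∫ θ in 0..(2 * Real.pi), f (circleMap c r θ) * circleMap 0 r θ).re = 0) :
    (∫ y in y₀..y₁, f (x₁ + y * I)).re = (∫ y in y₀..y₁, f (x₀ + y * I)).re := by
  have hcball := hball (mem_closedBall_self (by linarith : 0 ≤ 1 + κ))
  have hx : x₀ < x₁ := hcball.1.1.trans hcball.1.2
  have hy : y₀ < y₁ := hcball.2.1.trans hcball.2.2
  have hvert : ∀ x : ℝ, x ∉ Ioo x₀ x₁ → ∀ y : ℝ, truncation κ c f (x + y * I) = f (x + y * I) :=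
    fun x hx y => truncation_eq_self hκ fun hm => hx (by simpa using (hball hm).1)
  have hhorz : ∀ y : ℝ, y ∉ Ioo y₀ y₁ → ∀ x : ℝ, truncation κ c f (x + y * I) = f (x + y * I) :=
    fun y hy x => truncation_eq_self hκ fun hm => hy (by simpa using (hball hm).2)
  have hopposite : ∫ x in x₀..x₁, f (x + y₁ * I) = ∫ x in x₀..x₁, f (x + y₀ * I) :=
    intervalIntegral.integral_congr fun x hm => hper x (by rwa [uIcc_of_le hx.le] at hm)
  have hcont := continuous_truncationDefect hκ fun z hz hzc =>
    (hd z ⟨Ioo_subset_Icc_self (hball hz).1, Ioo_subset_Icc_self (hball hz).2⟩ hzc).continuousAt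
  have him := im_integral_truncationDefect_eq_zero hκ hcont hflux
  rw [← integral_boundary_rect_truncation hκ hx.le hy.le hball hd] at him
  simp only [hvert x₁ (by simp), hvert x₀ (by simp), hhorz y₀ (by simp), hhorz y₁ (by simp),
    hopposite, sub_self, zero_add, smul_eq_mul, sub_im, I_mul_im] at him
  linarith

end Flux

/-! ### From solutions to quasiperiodic potentials -/

/-- The properties of a solution that the estimates rest on: the gradient condition at the boundary
is replaced by the flux through one period of the line `x = 0`, the energy condition by sublinear
growth of `u - H`. -/
structure PeriodicSolution (ε δ a b cL cR : ℝ) (u : ℂ → ℝ) : Prop where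
  cont : ContinuousOn u (closedExterior ε δ)
  harmonic : HarmonicOnNhd u (exterior ε δ)
  periodic : ∀ z ∈ closedExterior ε δ, u (z + (2 + δ : ℝ) * I) = u z + b * (2 + δ)
  left : ∀ z, dist z (centerL ε δ 0) = 1 → u z = cL
  right : ∀ z, dist z (centerR ε δ 0) = 1 → u z = cR
  growth : ∀ η > 0, ∃ C : ℝ, ∀ z ∈ closedExterior ε δ,
    |u z - linearPotential a b z| ≤ C + η * |z.re|
  flux : ∫ y in (-(1 + δ / 2))..(1 + δ / 2), fderiv ℝ u (y * I) 1 = a * (2 + δ)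

theorem map_add_zsmul_of_forall_map_add {V M : Type*} [AddCommGroup V] [AddCommGroup M] {A : Set V}
    {T : V} {β : M} {φ : V → M} (hA : ∀ z ∈ A, ∀ n : ℤ, z + n • T ∈ A)
    (h : ∀ z ∈ A, φ (z + T) = φ z + β) {z : V} (hz : z ∈ A) (n : ℤ) :
    φ (z + n • T) = φ z + n • β := by
  induction n using Int.induction_on with
  | zero => simp
  | succ k ih => rw [add_one_zsmul, add_one_zsmul, ← add_assoc, h _ (hA z hz k), ih, add_assoc]
  | pred k ih =>
    have hstep := h _ (hA z hz (-k - 1))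
    rw [add_assoc, ← add_one_zsmul, sub_add_cancel, ih] at hstep
    rw [eq_sub_of_add_eq hstep.symm, sub_one_zsmul β, add_sub_assoc, sub_eq_add_neg]

theorem hasFDerivAt_linearPotential (a b : ℝ) (z : ℂ) :
    HasFDerivAt (linearPotential a b) (a • reCLM + b • imCLM) z :=
  (a • reCLM + b • imCLM).hasFDerivAt

theorem harmonicAt_linearPotential (a b : ℝ) (z : ℂ) : HarmonicAt (linearPotential a b) z := by
  have h : AnalyticAt ℂ (fun w : ℂ => (a - b * I) * w) z := by fun_prop
  convert h.harmonicAt_re using 1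
  ext w
  simp [linearPotential]

theorem linearPotential_add_period (a b δ : ℝ) (z : ℂ) :
    linearPotential a b (z + (2 + δ : ℝ) * I) = linearPotential a b z + b * (2 + δ) := by
  simp [linearPotential]; ring

/-- The complex derivative `u_x - i u_y`. -/
def cgrad (u : ℂ → ℝ) (z : ℂ) : ℂ := fderiv ℝ u z 1 - I * fderiv ℝ u z I

theorem cgrad_eq_conj (u : ℂ → ℝ) (z : ℂ) : cgrad u z = conj (gradient u z) := by
  rw [gradient_eq_fderiv, cgrad]; simp [sub_eq_add_neg]

theorem differentiableAt_cgrad {u : ℂ → ℝ} {U : Set ℂ} (h : HarmonicOnNhd u U)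
    {z : ℂ} (hz : z ∈ U) : DifferentiableAt ℂ (cgrad u) z :=
  HarmonicAt.differentiableAt_complex_partial (h z hz)

theorem norm_fderiv_eq_norm_gradient (u : ℂ → ℝ) (z : ℂ) : ‖fderiv ℝ u z‖ = ‖gradient u z‖ := by
  rw [← toDual_gradient, LinearIsometryEquiv.norm_map]

theorem cgrad_sub_linearPotential {u : ℂ → ℝ} {z : ℂ} (hu : DifferentiableAt ℝ u z) (a b : ℝ) :
    cgrad (fun w => u w - linearPotential a b w) z = cgrad u z - (a - b * I) := by
  have h := (hu.hasFDerivAt.sub (hasFDerivAt_linearPotential a b z)).fderiv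
  have h' : fderiv ℝ (fun w => u w - linearPotential a b w) z =
    fderiv ℝ u z - (a • reCLM + b • imCLM) := h
  rw [cgrad, cgrad, h']
  simp
  ring

theorem eq_of_forall_abs_sub_le_mul {x y c : ℝ} (h : ∀ η > 0, |x - y| ≤ η * c) : x = y := by
  have hlim : Tendsto (fun η : ℝ => η * c) (𝓝[>] 0) (𝓝 0) :=
    ((continuous_id.mul continuous_const).tendsto' 0 0 (zero_mul c)).mono_left nhdsWithin_le_nhds
  have hle : |x - y| ≤ 0 := ge_of_tendsto hlim (eventually_nhdsWithin_of_forall h)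
  exact sub_eq_zero.1 (abs_eq_zero.1 (hle.antisymm (abs_nonneg _)))

section

variable {ε δ : ℝ}

theorem add_two_add_mem_exterior (hδ : 0 < δ) {z : ℂ} (hz : z ∈ exterior ε δ) :
    z + (2 + δ : ℝ) * I ∈ exterior ε δ := by
  simpa using (add_period_mem_exterior hδ 1).2 hz

theorem add_two_add_mem_closedExterior {z : ℂ} (hz : z ∈ closedExterior ε δ) :
    z + (2 + δ : ℝ) * I ∈ closedExterior ε δ := by
  simpa using (add_period_mem_closedExterior 1).2 hz

theorem mem_exterior_of_dist_center_lt (hδ : 0 < δ) {c z : ℂ} (hc : c ∈ centers ε δ)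
    (h1 : 1 < dist z c) (h2 : dist z c < 1 + min ε δ) : z ∈ exterior ε δ := by
  obtain ⟨z₀, hz₀, hz⟩ := exists_eq_add_mul_sub (dist_pos.1 (zero_lt_one.trans h1))
  refine mem_exterior_of_dist_lt hδ hc hz₀ ?_ h1
  rw [hz, dist_add_mul hz₀ (by linarith)]
  linarith

theorem mem_closedExterior_of_dist_center_lt (hε : 0 < ε) (hδ : 0 < δ) {c z : ℂ}
    (hc : c ∈ centers ε δ) (h1 : 1 ≤ dist z c) (h2 : dist z c < 1 + min ε δ) :
    z ∈ closedExterior ε δ := by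
  rcases h1.eq_or_lt with h | h
  · exact mem_closedExterior_of_dist_eq_one hε hδ hc h.symm
  · exact exterior_subset_closedExterior hδ (mem_exterior_of_dist_center_lt hδ hc h h2)

/-- The continuous extension of `cgrad u` to the closed exterior, for a function `u` which is `C¹`
there. -/
def closedCgrad (ε δ : ℝ) (u : ℂ → ℝ) (z : ℂ) : ℂ :=
  conj (gradientWithin u (closedExterior ε δ) z)

theorem closedCgrad_eq_cgrad (hδ : 0 < δ) (u : ℂ → ℝ) {z : ℂ} (hz : z ∈ exterior ε δ) :
    closedCgrad ε δ u z = cgrad u z := by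
  have : fderivWithin ℝ u (closedExterior ε δ) z = fderiv ℝ u z :=
    fderivWithin_of_mem_nhds (mem_of_superset ((isOpen_exterior ε δ).mem_nhds hz)
      (exterior_subset_closedExterior hδ))
  rw [cgrad_eq_conj, closedCgrad, gradientWithin, gradient, this]

theorem circleIntegral_eq_I_mul (g : ℂ → ℂ) (c : ℂ) (s : ℝ) :
    (∮ z in C(c, s), g z) = I * ∫ θ in 0..(2 * Real.pi), g (circleMap c s θ) * circleMap 0 s θ := by
  rw [circleIntegral, ← intervalIntegral.integral_const_mul]
  refine intervalIntegral.integral_congr fun θ _ => ?_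
  simp only [deriv_circleMap, smul_eq_mul]
  ring

end

namespace IsSolution

variable {ε δ a b : ℝ} {u : ℂ → ℝ}

section

variable {H : ℂ → ℝ}

theorem differentiableAt (h : IsSolution ε δ H u) {z : ℂ} (hz : z ∈ exterior ε δ) :
    DifferentiableAt ℝ u z := (h.harmonic z hz).1.differentiableAt two_ne_zero

theorem continuousOn (h : IsSolution ε δ H u) (hε : 0 < ε) (hδ : 0 < δ) :
    ContinuousOn u (closedExterior ε δ) := by
  rw [← closure_exterior hε hδ]
  exact h.contDiffOn.continuousOn

theorem cgrad_add_period (h : IsSolution ε δ H u) {z : ℂ} (hz : z ∈ exterior ε δ) :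
    cgrad u (z + (2 + δ : ℝ) * I) = cgrad u z := by
  rw [cgrad_eq_conj, cgrad_eq_conj, h.periodic z hz]

theorem cgrad_add_int_mul_period (h : IsSolution ε δ H u) (hδ : 0 < δ) {z : ℂ}
    (hz : z ∈ exterior ε δ) (n : ℤ) : cgrad u (z + n * (2 + δ : ℝ) * I) = cgrad u z := by
  have := map_add_zsmul_of_forall_map_add (φ := cgrad u) (β := 0) (A := exterior ε δ)
    (fun z hz n => by simpa [mul_assoc] using (add_period_mem_exterior hδ n).2 hz)
    (fun z hz => (h.cgrad_add_period hz).trans (add_zero _).symm) hz n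
  simpa [mul_assoc] using this

theorem continuousOn_closedCgrad (h : IsSolution ε δ H u) (hε : 0 < ε) (hδ : 0 < δ) :
    ContinuousOn (closedCgrad ε δ u) (closedExterior ε δ) := by
  have hC1 := h.contDiffOn
  rw [closure_exterior hε hδ] at hC1
  exact continuous_conj.comp_continuousOn ((toDual ℝ ℂ).symm.continuous.comp_continuousOn
    (hC1.continuousOn_fderivWithin (uniqueDiffOn_closedExterior hε hδ) le_rfl))

theorem re_integral_closedCgrad_eq_zero (h : IsSolution ε δ H u) (hε : 0 < ε) (hδ : 0 < δ) :
    (∫ θ in 0..(2 * Real.pi),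
      closedCgrad ε δ u (circleMap (centerR ε δ 0) 1 θ) * circleMap 0 1 θ).re = 0 := by
  set c := centerR ε δ 0 with hc
  have hcircle : ∀ θ, circleMap c 1 θ ∈ closedExterior ε δ := fun θ =>
    mem_closedExterior_of_dist_eq_one hε hδ (Or.inr ⟨0, rfl⟩) (circleMap_mem_sphere c zero_le_one θ)
  have hcont : Continuous fun θ => closedCgrad ε δ u (circleMap c 1 θ) * circleMap 0 1 θ :=
    ((h.continuousOn_closedCgrad hε hδ).comp_continuous (continuous_circleMap c 1) hcircle).mul
      (continuous_circleMap 0 1)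
  have hre := reCLM.intervalIntegral_comp_comm (μ := volume)
    (hcont.intervalIntegrable 0 (2 * Real.pi))
  simp only [reCLM_apply] at hre
  have hflux := h.flux_right
  rw [flux, closure_exterior hε hδ, ← neg_eq_zero, ← intervalIntegral.integral_neg] at hflux
  refine hre.symm.trans (Eq.trans ?_ hflux)
  refine intervalIntegral.integral_congr fun θ _ => ?_
  simp only [closedCgrad, Complex.inner, ← circleMap_sub_center c 1 θ, ← hc]
  rw [← neg_sub c, mul_neg, neg_re, mul_comm]

theorem re_integral_circleMap_eq_zero (h : IsSolution ε δ H u) (hε : 0 < ε) (hδ : 0 < δ) {r : ℝ}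
    (hr : r ∈ Ioo 1 (1 + min ε δ)) :
    (∫ θ in 0..(2 * Real.pi),
      cgrad u (circleMap (centerR ε δ 0) r θ) * circleMap 0 r θ).re = 0 := by
  have hc : centerR ε δ 0 ∈ centers ε δ := Or.inr ⟨0, rfl⟩
  have hannulus := circleIntegral_eq_of_differentiable_on_annulus_off_countable
    (c := centerR ε δ 0) one_pos hr.1.le countable_empty (f := closedCgrad ε δ u)
    ((h.continuousOn_closedCgrad hε hδ).mono fun z hz =>
      mem_closedExterior_of_dist_center_lt hε hδ hc (not_lt.1 hz.2) (lt_of_le_of_lt hz.1 hr.2))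
    (by
      rintro z ⟨⟨hzr, hz1⟩, -⟩
      have hz : z ∈ exterior ε δ :=
        mem_exterior_of_dist_center_lt hδ hc (not_le.1 hz1) (lt_trans hzr hr.2)
      refine (differentiableAt_cgrad h.harmonic hz).congr_of_eventuallyEq ?_
      filter_upwards [(isOpen_exterior ε δ).mem_nhds hz] with w hw
      exact closedCgrad_eq_cgrad hδ u hw)
  rw [circleIntegral_eq_I_mul, circleIntegral_eq_I_mul] at hannulus
  refine Eq.trans ?_ (h.re_integral_closedCgrad_eq_zero hε hδ)
  rw [← mul_left_cancel₀ I_ne_zero hannulus]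
  congr 1
  refine intervalIntegral.integral_congr fun θ _ => ?_
  have hdist : dist (circleMap (centerR ε δ 0) r θ) (centerR ε δ 0) = r :=
    circleMap_mem_sphere _ (by linarith [hr.1]) θ
  rw [closedCgrad_eq_cgrad hδ u (mem_exterior_of_dist_center_lt hδ hc (by linarith [hr.1])
    (by linarith [hr.2]))]

theorem continuous_cgrad_vertical (h : IsSolution ε δ H u) {x : ℝ}
    (hx : ∀ y : ℝ, (x + y * I : ℂ) ∈ exterior ε δ) : Continuous fun y : ℝ => cgrad u (x + y * I) :=
  continuous_iff_continuousAt.2 fun y => ContinuousAt.comp (f := fun y : ℝ => (x + y * I : ℂ))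
    (differentiableAt_cgrad h.harmonic (hx y)).continuousAt (by fun_prop)

theorem re_integral_cgrad_vertical_eq (h : IsSolution ε δ H u) (hε : 0 < ε) (hδ : 0 < δ) {x : ℝ}
    (hx : 2 + ε < x) :
    (∫ y in (-(1 + δ / 2))..(1 + δ / 2), cgrad u (x + y * I)).re =
      (∫ y in (-(1 + δ / 2))..(1 + δ / 2), cgrad u (y * I)).re := by
  have hmin : 0 < min ε δ := lt_min hε hδ
  have hminε := min_le_left ε δ
  have hminδ := min_le_right ε δ
  have hvert := re_integral_vertical_eq (κ := min ε δ / 4) (x₀ := 0) (x₁ := x)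
    (y₀ := -(1 + δ / 2)) (y₁ := 1 + δ / 2) (c := centerR ε δ 0) (f := cgrad u) (by positivity)
    (fun z hz => by
      rw [mem_closedBall, dist_eq] at hz
      have hre := abs_le.1 ((abs_re_le_norm _).trans hz)
      have him := abs_le.1 ((abs_im_le_norm _).trans hz)
      simp only [sub_re, sub_im, centerR, Int.cast_zero, zero_mul] at hre him
      exact ⟨⟨by linarith, by linarith⟩, ⟨by linarith, by linarith⟩⟩)
    (fun z hz hzc => by
      have hre : 0 ≤ z.re := hz.1.1
      refine differentiableAt_cgrad h.harmonic (mem_exterior_of_abs_im_le hδ (abs_le.2 hz.2) ?_ ?_)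
      · nlinarith [sq_nonneg z.im]
      · simpa [centerR] using one_lt_dist_iff.1 hzc)
    (fun t _ => by
      have hmem : (t + (-(1 + δ / 2) : ℝ) * I : ℂ) ∈ exterior ε δ :=
        mem_exterior_of_abs_im_eq_waist hδ (by
          rw [show (t + (-(1 + δ / 2) : ℝ) * I : ℂ).im = -(1 + δ / 2) by simp, abs_neg,
            abs_of_pos (by linarith)])
      rw [← h.cgrad_add_period hmem]
      congr 1
      push_cast
      ring)
    (fun r hr => h.re_integral_circleMap_eq_zero hε hδ ⟨hr.1, by linarith [hr.2]⟩)
  simpa only [ofReal_zero, zero_add] using hvert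

theorem re_integral_cgrad_imaginary_axis (h : IsSolution ε δ H u) (hε : 0 < ε) (hδ : 0 < δ) :
    (∫ y in (-(1 + δ / 2))..(1 + δ / 2), cgrad u (y * I)).re =
      ∫ y in (-(1 + δ / 2))..(1 + δ / 2), fderiv ℝ u (y * I) 1 := by
  have hcont : Continuous fun y : ℝ => cgrad u (y * I) := by
    simpa only [ofReal_zero, zero_add] using h.continuous_cgrad_vertical (x := 0) fun y =>
      mem_exterior_of_re_eq_zero hε hδ (by simp)
  have hre := reCLM.intervalIntegral_comp_comm (μ := volume)
    (hcont.intervalIntegrable (-(1 + δ / 2)) (1 + δ / 2))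
  rw [← reCLM_apply, ← hre]
  simp [cgrad]

end

theorem exists_norm_cgrad_sub_le (h : IsSolution ε δ (linearPotential a b) u) (hε : 0 < ε)
    (hε1 : ε < 1) (hδ : 0 < δ) {η : ℝ} (hη : 0 < η) :
    ∃ X > 3, ∀ z : ℂ, X < |z.re| → ‖cgrad u z - (a - b * I)‖ ≤ η := by
  have hE : ∀ z : ℂ, 3 < |z.re| → z ∈ exterior ε δ := fun z hz =>
    mem_exterior_of_lt_abs_re hε hδ (by linarith)
  refine exists_norm_le_of_periodic hδ (g := fun z => cgrad u z - (a - b * I)) (R := 3)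
    (fun z hz => (differentiableAt_cgrad h.harmonic (hE z hz)).sub_const _)
    (fun z hz n => by rw [h.cgrad_add_int_mul_period hδ (hE z hz)]) ?_ hη
  have hfin := h.energy.2
  rw [hasFiniteIntegral_iff_enorm] at hfin
  refine ne_top_of_le_ne_top hfin.ne ?_
  have hsub : strip δ ∩ {z | 3 < |z.re|} ⊆ strip δ \ closure (diskL ε δ 0 ∪ diskR ε δ 0) := by
    rintro z ⟨hz, hre⟩
    refine ⟨hz, fun hcl => hE z hre (closure_mono ?_ hcl)⟩
    exact subset_iUnion (fun n : ℤ => diskL ε δ n ∪ diskR ε δ n) 0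
  have hmeas : MeasurableSet (strip δ ∩ {z | 3 < |z.re|}) := (isOpen_strip δ).measurableSet.inter
    (isOpen_lt continuous_const continuous_re.abs).measurableSet
  refine le_trans (le_of_eq (setLIntegral_congr_fun hmeas fun z hz => ?_)) (lintegral_mono_set hsub)
  rw [← cgrad_sub_linearPotential (h.differentiableAt (hE z hz.2)), cgrad_eq_conj, enorm_pow,
    enorm_norm]
  simp [← ofReal_norm]

theorem exists_abs_sub_le_mul_norm_sub (h : IsSolution ε δ (linearPotential a b) u) (hε : 0 < ε)
    (hε1 : ε < 1) (hδ : 0 < δ) {η : ℝ} (hη : 0 < η) : ∃ X > 3, ∀ z w : ℂ,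
      (X < z.re ∧ X < w.re ∨ z.re < -X ∧ w.re < -X) →
      |(u z - linearPotential a b z) - (u w - linearPotential a b w)| ≤ η * ‖z - w‖ := by
  obtain ⟨X, hX, hdec⟩ := h.exists_norm_cgrad_sub_le hε hε1 hδ hη
  refine ⟨X, hX, fun z w hzw => ?_⟩
  have hmvt : ∀ A : Set ℂ, Convex ℝ A → (∀ y ∈ A, X < |y.re|) → z ∈ A → w ∈ A →
      |(u z - linearPotential a b z) - (u w - linearPotential a b w)| ≤ η * ‖z - w‖ := by
    intro A hA hAX hz hw
    have hd : ∀ y ∈ A, DifferentiableAt ℝ u y := fun y hy =>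
      h.differentiableAt (mem_exterior_of_lt_abs_re hε hδ (by linarith [hAX y hy]))
    refine hA.norm_image_sub_le_of_norm_fderiv_le (𝕜 := ℝ)
      (f := fun y => u y - linearPotential a b y) (fun y hy => ?_) (fun y hy => ?_) hw hz
    · exact (hd y hy).sub (hasFDerivAt_linearPotential a b y).differentiableAt
    · rw [norm_fderiv_eq_norm_gradient, ← RCLike.norm_conj, ← cgrad_eq_conj,
        cgrad_sub_linearPotential (hd y hy)]
      exact hdec y (hAX y hy)
  rcases hzw with ⟨hz, hw⟩ | ⟨hz, hw⟩
  · exact hmvt {y | X < y.re} (convex_halfSpace_re_gt X)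
      (fun y hy => lt_of_lt_of_le hy (le_abs_self _)) hz hw
  · exact hmvt {y | y.re < -X} (convex_halfSpace_re_lt (-X))
      (fun y hy => (lt_neg.1 hy).trans_le (neg_le_abs _)) hz hw

theorem exists_forall_add_period_sub_eq {H : ℂ → ℝ} (h : IsSolution ε δ H u) (hε : 0 < ε)
    (hδ : 0 < δ) : ∃ κ : ℝ, ∀ z ∈ exterior ε δ, u (z + (2 + δ : ℝ) * I) - u z = κ := by
  have hd : ∀ z ∈ exterior ε δ, HasFDerivAt (fun z => u (z + (2 + δ : ℝ) * I) - u z)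
      (0 : ℂ →L[ℝ] ℝ) z := by
    intro z hz
    have hshift : HasFDerivAt (fun z => u (z + (2 + δ : ℝ) * I))
        (fderiv ℝ u (z + (2 + δ : ℝ) * I)) z := (hasFDerivAt_comp_add_right _).2
      (h.differentiableAt (add_two_add_mem_exterior hδ hz)).hasFDerivAt
    have hsame : fderiv ℝ u (z + (2 + δ : ℝ) * I) = fderiv ℝ u z := by
      rw [← toDual_gradient, ← toDual_gradient, h.periodic z hz]
    have hsub := hshift.sub (h.differentiableAt hz).hasFDerivAt
    rwa [hsame, sub_self] at hsub
  exact (isOpen_exterior ε δ).exists_is_const_of_fderiv_eq_zero (𝕜 := ℝ)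
    (isPreconnected_exterior hε hδ)
    (fun z hz => (hd z hz).differentiableAt.differentiableWithinAt) (fun z hz => (hd z hz).fderiv)

/-- The constant increment over one period is read off at infinity, where `∇(u - H) → 0`. -/
theorem add_period_of_mem_exterior (h : IsSolution ε δ (linearPotential a b) u) (hε : 0 < ε)
    (hε1 : ε < 1) (hδ : 0 < δ) {z : ℂ} (hz : z ∈ exterior ε δ) :
    u (z + (2 + δ : ℝ) * I) - u z = b * (2 + δ) := by
  obtain ⟨κ, hκ⟩ := h.exists_forall_add_period_sub_eq hε hδ
  rw [hκ z hz]
  refine eq_of_forall_abs_sub_le_mul (c := 2 + δ) fun η hη => ?_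
  obtain ⟨X, hX, hlip⟩ := h.exists_abs_sub_le_mul_norm_sub hε hε1 hδ hη
  set x : ℂ := ((X + 1 : ℝ) : ℂ) with hx
  have hxE : x ∈ exterior ε δ := mem_exterior_of_lt_abs_re hε hδ (by
    rw [hx, ofReal_re, abs_of_pos (by linarith)]; linarith)
  have hdiff := hlip (x + (2 + δ : ℝ) * I) x (Or.inl (by simp [hx]))
  rw [linearPotential_add_period, add_sub_cancel_left, norm_mul, norm_I, mul_one, norm_real,
    Real.norm_of_nonneg (by linarith)] at hdiff
  rwa [← hκ x hxE, show u (x + (2 + δ : ℝ) * I) - u x - b * (2 + δ) = u (x + (2 + δ : ℝ) * I) -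
    (linearPotential a b x + b * (2 + δ)) - (u x - linearPotential a b x) by ring]

theorem add_period (h : IsSolution ε δ (linearPotential a b) u) (hε : 0 < ε) (hε1 : ε < 1)
    (hδ : 0 < δ) {z : ℂ} (hz : z ∈ closedExterior ε δ) :
    u (z + (2 + δ : ℝ) * I) = u z + b * (2 + δ) := by
  have hcont := h.continuousOn hε hδ
  have heq : EqOn (fun z => u (z + (2 + δ : ℝ) * I)) (fun z => u z + b * (2 + δ))
      (closedExterior ε δ) :=
    EqOn.of_subset_closure
      (fun z hz => eq_add_of_sub_eq' (h.add_period_of_mem_exterior hε hε1 hδ hz))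
      (ContinuousOn.comp hcont (by fun_prop) fun z hz => add_two_add_mem_closedExterior hz)
      (hcont.add continuousOn_const) (exterior_subset_closedExterior hδ)
      (closure_exterior hε hδ).ge
  exact heq hz

theorem sub_linearPotential_add_int_mul_period (h : IsSolution ε δ (linearPotential a b) u)
    (hε : 0 < ε) (hε1 : ε < 1) (hδ : 0 < δ) {z : ℂ} (hz : z ∈ closedExterior ε δ) (n : ℤ) :
    u (z + n * (2 + δ : ℝ) * I) - linearPotential a b (z + n * (2 + δ : ℝ) * I) =
      u z - linearPotential a b z := by
  have := map_add_zsmul_of_forall_map_add (φ := fun z => u z - linearPotential a b z) (β := 0)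
    (T := (2 + δ : ℝ) * I)
    (fun z hz n => by simpa [mul_assoc] using (add_period_mem_closedExterior n).2 hz)
    (fun z hz => by rw [linearPotential_add_period, h.add_period hε hε1 hδ hz]; ring) hz n
  simpa [mul_assoc] using this

theorem exists_abs_sub_linearPotential_le (h : IsSolution ε δ (linearPotential a b) u) (hε : 0 < ε)
    (hε1 : ε < 1) (hδ : 0 < δ) (X : ℝ) : ∃ C : ℝ, ∀ z ∈ closedExterior ε δ, |z.re| ≤ X →
      |u z - linearPotential a b z| ≤ C := by
  have hcont : ContinuousOn (fun z => u z - linearPotential a b z) (closedExterior ε δ) :=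
    (h.continuousOn hε hδ).sub fun z _ =>
      (hasFDerivAt_linearPotential a b z).continuousAt.continuousWithinAt
  have hcomp : IsCompact (closedExterior ε δ ∩ (Icc (-X) X ×ℂ Icc (-(1 + δ / 2)) (1 + δ / 2))) :=
    (isCompact_Icc.reProdIm isCompact_Icc).inter_left (isClosed_closedExterior ε δ)
  obtain ⟨C, hC⟩ := hcomp.exists_bound_of_continuousOn (hcont.mono inter_subset_left)
  refine ⟨C, fun z hz hre => ?_⟩
  obtain ⟨n, hn⟩ := exists_period_abs_im_le hδ z
  rw [← h.sub_linearPotential_add_int_mul_period hε hε1 hδ hz n]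
  exact hC _ ⟨(add_period_mem_closedExterior n).2 hz, by simpa using abs_le.1 hre, abs_le.1 hn⟩

theorem growth (h : IsSolution ε δ (linearPotential a b) u) (hε : 0 < ε) (hε1 : ε < 1)
    (hδ : 0 < δ) {η : ℝ} (hη : 0 < η) : ∃ C : ℝ, ∀ z ∈ closedExterior ε δ,
    |u z - linearPotential a b z| ≤ C + η * |z.re| := by
  obtain ⟨X, hX, hlip⟩ := h.exists_abs_sub_le_mul_norm_sub hε hε1 hδ hη
  obtain ⟨C, hC⟩ := h.exists_abs_sub_linearPotential_le hε hε1 hδ (X + 1)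
  refine ⟨C, fun z hz => ?_⟩
  by_cases hre : |z.re| ≤ X + 1
  · exact (hC z hz hre).trans (le_add_of_nonneg_right (by positivity))
  push Not at hre
  have hfar : ∀ x : ℝ, |x| = X + 1 → |z.re - x| ≤ |z.re| →
      (X < z.re ∧ X < x ∨ z.re < -X ∧ x < -X) →
      |u z - linearPotential a b z| ≤ C + η * |z.re| := by
    intro x hx hd hside
    have hw : (⟨x, z.im⟩ : ℂ) ∈ closedExterior ε δ := exterior_subset_closedExterior hδ
      (mem_exterior_of_lt_abs_re hε hδ (by simp only [hx]; linarith))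
    have hnorm : ‖z - ⟨x, z.im⟩‖ = |z.re - x| := by
      rw [show z - ⟨x, z.im⟩ = ((z.re - x : ℝ) : ℂ) by apply Complex.ext <;> simp, norm_real,
        Real.norm_eq_abs]
    calc |u z - linearPotential a b z|
        ≤ |u ⟨x, z.im⟩ - linearPotential a b ⟨x, z.im⟩| + η * ‖z - ⟨x, z.im⟩‖ := by
          linarith [hlip z ⟨x, z.im⟩ hside, abs_sub_abs_le_abs_sub
            (u z - linearPotential a b z) (u ⟨x, z.im⟩ - linearPotential a b ⟨x, z.im⟩)]
      _ ≤ C + η * |z.re| := by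
          rw [hnorm]
          gcongr
          exact hC ⟨x, z.im⟩ hw hx.le
  rcases lt_abs.1 hre with h' | h'
  · exact hfar (X + 1) (abs_of_pos (by linarith))
      (by rw [abs_of_pos (by linarith : 0 < z.re), abs_of_pos (by linarith)]; linarith)
      (Or.inl ⟨by linarith, by linarith⟩)
  · exact hfar (-(X + 1)) (by rw [abs_neg, abs_of_pos (by linarith)])
      (by rw [abs_of_neg (by linarith : z.re < 0), abs_of_neg (by linarith)]; linarith)
      (Or.inr ⟨by linarith, by linarith⟩)

theorem abs_re_integral_cgrad_sub_le (h : IsSolution ε δ (linearPotential a b) u) (hδ : 0 < δ)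
    {x η : ℝ} (hx : ∀ y : ℝ, (x + y * I : ℂ) ∈ exterior ε δ)
    (hη : ∀ y : ℝ, ‖cgrad u (x + y * I) - (a - b * I)‖ ≤ η) :
    |(∫ y in (-(1 + δ / 2))..(1 + δ / 2), cgrad u (x + y * I)).re - a * (2 + δ)| ≤
      η * (2 + δ) := by
  have hsub : (∫ y in (-(1 + δ / 2))..(1 + δ / 2), cgrad u (x + y * I)) -
      ((2 + δ : ℝ) : ℂ) * (a - b * I) =
      ∫ y in (-(1 + δ / 2))..(1 + δ / 2), (cgrad u (x + y * I) - (a - b * I)) := by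
    rw [intervalIntegral.integral_sub ((h.continuous_cgrad_vertical hx).intervalIntegrable _ _)
      (by simp), intervalIntegral.integral_const, real_smul]
    congr 2
    push_cast
    ring
  have hnorm := intervalIntegral.norm_integral_le_of_norm_le_const (C := η)
    (a := -(1 + δ / 2)) (b := 1 + δ / 2)
    (f := fun y : ℝ => cgrad u (x + y * I) - (a - b * I)) (fun y _ => hη y)
  rw [← hsub, show 1 + δ / 2 - -(1 + δ / 2) = 2 + δ by ring,
    abs_of_pos (by linarith : 0 < 2 + δ)] at hnorm
  refine le_trans (le_of_eq ?_) ((abs_re_le_norm _).trans hnorm)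
  rw [sub_re, re_ofReal_mul, show (a - b * I : ℂ).re = a by simp, mul_comm a]

theorem flux_vertical (h : IsSolution ε δ (linearPotential a b) u) (hε : 0 < ε) (hε1 : ε < 1)
    (hδ : 0 < δ) :
    ∫ y in (-(1 + δ / 2))..(1 + δ / 2), fderiv ℝ u (y * I) 1 = a * (2 + δ) := by
  rw [← h.re_integral_cgrad_imaginary_axis hε hδ]
  refine eq_of_forall_abs_sub_le_mul (c := 2 + δ) fun η hη => ?_
  obtain ⟨X, hX, hdec⟩ := h.exists_norm_cgrad_sub_le hε hε1 hδ hη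
  have hre : ∀ y : ℝ, X < |((X + 1 : ℝ) + y * I : ℂ).re| := fun y => by
    rw [show ((X + 1 : ℝ) + y * I : ℂ).re = X + 1 by simp, abs_of_pos (by linarith)]
    linarith
  rw [← h.re_integral_cgrad_vertical_eq hε hδ (by linarith : 2 + ε < X + 1)]
  exact h.abs_re_integral_cgrad_sub_le hδ
    (fun y => mem_exterior_of_lt_abs_re hε hδ (by linarith [hre y])) (fun y => hdec _ (hre y))

theorem exists_periodicSolution (h : IsSolution ε δ (linearPotential a b) u) (hε : 0 < ε)
    (hε1 : ε < 1) (hδ : 0 < δ) : ∃ cL cR : ℝ, PeriodicSolution ε δ a b cL cR u := by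
  obtain ⟨cL, hL⟩ := h.const_left
  obtain ⟨cR, hR⟩ := h.const_right
  rw [diskL, frontier_ball _ one_ne_zero] at hL
  rw [diskR, frontier_ball _ one_ne_zero] at hR
  exact ⟨cL, cR, h.continuousOn hε hδ, h.harmonic, fun z hz => h.add_period hε hε1 hδ hz, hL, hR,
    fun η hη => h.growth hε hε1 hδ hη, h.flux_vertical hε hε1 hδ⟩

end IsSolution

/-! ### Symmetries and the maximum principle -/

theorem exists_analyticAt_re_eventuallyEq {u : ℂ → ℝ} {z : ℂ} (h : HarmonicAt u z) :
    ∃ F : ℂ → ℂ, AnalyticAt ℂ F z ∧ ∀ᶠ w in 𝓝 z, u w = (F w).re := by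
  obtain ⟨d, hd, hb⟩ := exists_harmonicOnNhd_ball h
  obtain ⟨F, hF, hFu⟩ := hb.exists_analyticOnNhd_ball_re_eq
  refine ⟨F, hF z (mem_ball_self hd), ?_⟩
  filter_upwards [ball_mem_nhds z hd] with w hw
  exact (hFu hw).symm

theorem harmonicAt_comp_analyticAt {u : ℂ → ℝ} {g : ℂ → ℂ} {z : ℂ} (h : HarmonicAt u (g z))
    (hg : AnalyticAt ℂ g z) : HarmonicAt (fun w => u (g w)) z := by
  obtain ⟨F, hF, hFu⟩ := exists_analyticAt_re_eventuallyEq h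
  have han : AnalyticAt ℂ (fun w => F (g w)) z := hF.comp hg
  have hev : ∀ᶠ w in 𝓝 z, u (g w) = (F (g w)).re := hg.continuousAt.eventually hFu
  exact (harmonicAt_congr_nhds hev).2 han.harmonicAt_re

theorem harmonicAt_comp_conj {u : ℂ → ℝ} {z : ℂ} (h : HarmonicAt u (conj z)) :
    HarmonicAt (fun w => u (conj w)) z := by
  obtain ⟨F, hF, hFu⟩ := exists_analyticAt_re_eventuallyEq h
  have hconj : Tendsto conj (𝓝 z) (𝓝 (conj z)) := continuous_conj.tendsto z
  have han : AnalyticAt ℂ (fun w => conj (F (conj w))) z := by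
    rw [analyticAt_iff_eventually_differentiableAt] at hF ⊢
    filter_upwards [hconj.eventually hF] with w hw
    have hdiff := hw.conj_conj
    rwa [conj_conj] at hdiff
  refine (harmonicAt_congr_nhds ?_).2 han.harmonicAt_re
  filter_upwards [hconj.eventually hFu] with w hw
  rw [hw, conj_re]

namespace PeriodicSolution

variable {ε δ a b cL cR a' b' cL' cR' : ℝ} {u u' : ℂ → ℝ}

theorem differentiableAt (h : PeriodicSolution ε δ a b cL cR u) {z : ℂ} (hz : z ∈ exterior ε δ) :
    DifferentiableAt ℝ u z := (h.harmonic z hz).1.differentiableAt two_ne_zero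

theorem continuous_fderiv_one (h : PeriodicSolution ε δ a b cL cR u) (hε : 0 < ε) (hδ : 0 < δ) :
    Continuous fun y : ℝ => fderiv ℝ u (y * I) 1 := by
  have hcgrad : Continuous fun y : ℝ => (cgrad u (y * I)).re :=
    continuous_re.comp (continuous_iff_continuousAt.2 fun y => ContinuousAt.comp
      (f := fun y : ℝ => (y : ℂ) * I)
      (differentiableAt_cgrad h.harmonic (ofReal_mul_I_mem_exterior hε hδ y)).continuousAt
      (by fun_prop))
  convert hcgrad using 2 with y
  simp [cgrad]

theorem add (h : PeriodicSolution ε δ a b cL cR u) (h' : PeriodicSolution ε δ a' b' cL' cR' u')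
    (hε : 0 < ε) (hδ : 0 < δ) :
    PeriodicSolution ε δ (a + a') (b + b') (cL + cL') (cR + cR') (u + u') where
  cont := h.cont.add h'.cont
  harmonic := h.harmonic.add h'.harmonic
  periodic z hz := by
    simp only [Pi.add_apply, h.periodic z hz, h'.periodic z hz]
    ring
  left z hz := by rw [Pi.add_apply, h.left z hz, h'.left z hz]
  right z hz := by rw [Pi.add_apply, h.right z hz, h'.right z hz]
  growth η hη := by
    obtain ⟨C, hC⟩ := h.growth (η / 2) (half_pos hη)
    obtain ⟨C', hC'⟩ := h'.growth (η / 2) (half_pos hη)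
    refine ⟨C + C', fun z hz => ?_⟩
    have hsplit : (u + u') z - linearPotential (a + a') (b + b') z =
        (u z - linearPotential a b z) + (u' z - linearPotential a' b' z) := by
      simp only [Pi.add_apply, linearPotential]
      ring
    rw [hsplit]
    linarith [abs_add_le (u z - linearPotential a b z) (u' z - linearPotential a' b' z), hC z hz,
      hC' z hz]
  flux := by
    have hfderiv : ∀ y : ℝ, fderiv ℝ (u + u') (y * I) 1 =
        fderiv ℝ u (y * I) 1 + fderiv ℝ u' (y * I) 1 := fun y => by
      have hy := ofReal_mul_I_mem_exterior hε hδ y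
      rw [fderiv_add (h.differentiableAt hy) (h'.differentiableAt hy), add_apply]
    simp only [hfderiv]
    rw [intervalIntegral.integral_add ((h.continuous_fderiv_one hε hδ).intervalIntegrable _ _)
      ((h'.continuous_fderiv_one hε hδ).intervalIntegrable _ _), h.flux, h'.flux, add_mul]

theorem const_smul (h : PeriodicSolution ε δ a b cL cR u) (hε : 0 < ε) (hδ : 0 < δ) (s : ℝ) :
    PeriodicSolution ε δ (s * a) (s * b) (s * cL) (s * cR) (s • u) where
  cont := h.cont.const_smul s
  harmonic := h.harmonic.const_smul
  periodic z hz := by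
    simp only [Pi.smul_apply, smul_eq_mul, h.periodic z hz]
    ring
  left z hz := by rw [Pi.smul_apply, h.left z hz, smul_eq_mul]
  right z hz := by rw [Pi.smul_apply, h.right z hz, smul_eq_mul]
  growth η hη := by
    obtain ⟨C, hC⟩ := h.growth (η / (|s| + 1)) (by positivity)
    refine ⟨|s| * C, fun z hz => ?_⟩
    have hsplit : (s • u) z - linearPotential (s * a) (s * b) z =
        s * (u z - linearPotential a b z) := by
      simp only [Pi.smul_apply, smul_eq_mul, linearPotential]
      ring
    have hs : |s| * (η / (|s| + 1)) ≤ η := by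
      rw [mul_div_assoc', div_le_iff₀ (by positivity)]
      nlinarith
    calc |(s • u) z - linearPotential (s * a) (s * b) z|
        = |s| * |u z - linearPotential a b z| := by rw [hsplit, abs_mul]
      _ ≤ |s| * (C + η / (|s| + 1) * |z.re|) := by gcongr; exact hC z hz
      _ = |s| * C + |s| * (η / (|s| + 1)) * |z.re| := by ring
      _ ≤ |s| * C + η * |z.re| := by gcongr
  flux := by
    have hfderiv : ∀ y : ℝ, fderiv ℝ (s • u) (y * I) 1 = s * fderiv ℝ u (y * I) 1 := fun y => by
      rw [fderiv_const_smul (h.differentiableAt (ofReal_mul_I_mem_exterior hε hδ y)),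
        smul_apply, smul_eq_mul]
    simp only [hfderiv]
    rw [intervalIntegral.integral_const_mul, h.flux, mul_assoc]

theorem fderiv_comp_conj_one (h : PeriodicSolution ε δ a b cL cR u) (hε : 0 < ε) (hδ : 0 < δ)
    (y : ℝ) : fderiv ℝ (fun z => u (conj z)) (y * I) 1 = fderiv ℝ u ((-y : ℝ) * I) 1 := by
  have hconj : conjCLE.toContinuousLinearMap (y * I) = (-y : ℝ) * I := by simp
  have hu := (h.differentiableAt (ofReal_mul_I_mem_exterior hε hδ (-y))).hasFDerivAt
  rw [← hconj] at hu
  have hcomp : HasFDerivAt (fun z => u (conj z)) _ (y * I : ℂ) :=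
    hu.comp (y * I : ℂ) conjCLE.toContinuousLinearMap.hasFDerivAt
  rw [hcomp.fderiv, ← hconj]
  simp

theorem reflect (h : PeriodicSolution ε δ a b cL cR u) (hε : 0 < ε) (hδ : 0 < δ) :
    PeriodicSolution ε δ a (-b) cL cR (fun z => u (conj z)) where
  cont := h.cont.comp continuous_conj.continuousOn fun _ hz => conj_mem_closedExterior hz
  harmonic z hz := harmonicAt_comp_conj (h.harmonic _ (conj_mem_exterior hδ hz))
  periodic z hz := by
    have hperiod := h.periodic _ (conj_mem_closedExterior (add_two_add_mem_closedExterior hz))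
    rw [show conj (z + (2 + δ : ℝ) * I) + (2 + δ : ℝ) * I = conj z by
      rw [map_add, map_mul, conj_ofReal, conj_I]; ring] at hperiod
    linarith
  left z hz := h.left _ (by
    rw [show centerL ε δ 0 = conj (centerL ε δ 0) by apply Complex.ext <;> simp [centerL],
      dist_conj_conj, hz])
  right z hz := h.right _ (by
    rw [show centerR ε δ 0 = conj (centerR ε δ 0) by apply Complex.ext <;> simp [centerR],
      dist_conj_conj, hz])
  growth η hη := by
    obtain ⟨C, hC⟩ := h.growth η hη
    refine ⟨C, fun z hz => ?_⟩
    simpa [linearPotential] using hC _ (conj_mem_closedExterior hz)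
  flux := by
    simp only [h.fderiv_comp_conj_one hε hδ]
    rw [intervalIntegral.integral_comp_neg (fun y : ℝ => fderiv ℝ u (y * I) 1), neg_neg, h.flux]

end PeriodicSolution


theorem le_of_sublinear_growth {v : ℂ → ℝ} {x₀ h m : ℝ} (hcont : ContinuousOn v {z | x₀ ≤ z.re})
    (hharm : HarmonicOnNhd v {z | x₀ < z.re})
    (hrep : ∀ z : ℂ, x₀ ≤ z.re → ∃ z' : ℂ, |z'.im| ≤ h ∧ z'.re = z.re ∧ v z' = v z)
    (hgrowth : ∀ η > 0, ∃ C : ℝ, ∀ z : ℂ, x₀ ≤ z.re → v z ≤ C + η * z.re)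
    (hm : ∀ z : ℂ, z.re = x₀ → v z ≤ m) {z : ℂ} (hz : x₀ ≤ z.re) : v z ≤ m := by
  -- For each `η > 0`, compare `v - η * re` with its values on the two sides of a wide strip.
  have key : ∀ η > 0, v z ≤ m + η * (z.re - x₀) := by
    intro η hη
    obtain ⟨C, hC⟩ := hgrowth (η / 2) (half_pos hη)
    set X : ℝ := max z.re (2 * (C - m + η * x₀) / η)
    have hX : C + η / 2 * X ≤ m + η * (X - x₀) := by
      have hle : 2 * (C - m + η * x₀) / η ≤ X := le_max_right _ _
      rw [div_le_iff₀ hη] at hle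
      linarith
    have hstrip := le_of_harmonicOnNhd_of_compact_representatives (P := re ⁻¹' Icc x₀ X)
      (U := re ⁻¹' Ioo x₀ X) (C₀ := Icc x₀ X ×ℂ Icc (-h) h) (w := v - linearPotential η 0)
      (m := m - η * x₀) (isOpen_Ioo.preimage continuous_re) (preimage_mono Ioo_subset_Icc_self)
      (isCompact_Icc.reProdIm isCompact_Icc) (fun y hy => hy.1)
      ((hcont.mono fun y hy => hy.1.1).sub fun y _ =>
        (hasFDerivAt_linearPotential _ _ y).continuousAt.continuousWithinAt)
      ((hharm.mono fun y hy => hy.1).sub fun y _ => harmonicAt_linearPotential _ _ y)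
      (fun y hy => by
        obtain ⟨y', him, hre, hv⟩ := hrep y hy.1
        refine ⟨y', ⟨by rw [mem_preimage, hre]; exact hy, abs_le.1 him⟩, hre, ?_⟩
        simp [linearPotential, hre, hv])
      (fun y hy hyU => by
        simp only [Pi.sub_apply, linearPotential, zero_mul, add_zero]
        rcases hy.1.eq_or_lt with hx₀ | hx₀
        · linarith [hm y hx₀.symm, congrArg (η * ·) hx₀]
        · have hyX : y.re = X := hy.2.antisymm (not_lt.1 fun hlt => hyU ⟨hx₀, hlt⟩)
          have hle := hC y hy.1
          rw [hyX] at hle ⊢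
          linarith)
      z ⟨hz, le_max_left _ _⟩
    simp only [Pi.sub_apply, linearPotential, zero_mul, add_zero] at hstrip
    linarith
  have hlim : Tendsto (fun η : ℝ => m + η * (z.re - x₀)) (𝓝[>] 0) (𝓝 m) :=
    (Continuous.tendsto' (by fun_prop) 0 m (by simp)).mono_left nhdsWithin_le_nhds
  exact ge_of_tendsto hlim (eventually_nhdsWithin_of_forall key)

theorem le_of_sublinear_growth_abs {v : ℂ → ℝ} {x₀ h m : ℝ} (hx₀ : 0 ≤ x₀)
    (hcont : ContinuousOn v {z | x₀ ≤ |z.re|}) (hharm : HarmonicOnNhd v {z | x₀ < |z.re|})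
    (hrep : ∀ z : ℂ, x₀ ≤ |z.re| → ∃ z' : ℂ, |z'.im| ≤ h ∧ z'.re = z.re ∧ v z' = v z)
    (hgrowth : ∀ η > 0, ∃ C : ℝ, ∀ z : ℂ, x₀ ≤ |z.re| → v z ≤ C + η * |z.re|)
    (hm : ∀ z : ℂ, |z.re| = x₀ → v z ≤ m) {z : ℂ} (hz : x₀ ≤ |z.re|) : v z ≤ m := by
  wlog hre : 0 ≤ z.re generalizing v z
  · have hneg := this (v := fun w => v (-w)) (z := -z)
      (hcont.comp continuousOn_neg fun w hw => by simpa using hw)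
      (fun w hw => harmonicAt_comp_analyticAt (hharm (-w) (by simpa using hw)) analyticAt_id.neg)
      (fun w hw => by
        obtain ⟨w', him, hre', hv⟩ := hrep (-w) (by simpa using hw)
        exact ⟨-w', by simpa using him, by simp [hre'], by simpa using hv⟩)
      (fun η hη => (hgrowth η hη).imp fun C hC w hw => by simpa using hC (-w) (by simpa using hw))
      (fun w hw => hm (-w) (by simpa using hw)) (by simpa using hz)
      (by rw [neg_re]; linarith)
    simpa using hneg
  · have habs : ∀ w : ℂ, x₀ ≤ w.re → |w.re| = w.re := fun w hw => abs_of_nonneg (hx₀.trans hw)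
    rw [abs_of_nonneg hre] at hz
    exact le_of_sublinear_growth (hcont.mono fun w (hw : x₀ ≤ w.re) => hw.trans (le_abs_self _))
      (hharm.mono fun w (hw : x₀ < w.re) => hw.trans_le (le_abs_self _))
      (fun w hw => hrep w (hw.trans (le_abs_self _)))
      (fun η hη => (hgrowth η hη).imp fun C hC w hw => by
        simpa only [habs w hw] using hC w (hw.trans (le_abs_self _)))
      (fun w hw => hm w (by rw [habs w hw.ge, hw])) hz

section

variable {ε δ m : ℝ} {v : ℂ → ℝ}

theorem exists_isMaxOn_closedExterior (hε : 0 < ε) (hε1 : ε < 1) (hδ : 0 < δ)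
    (hcont : ContinuousOn v (closedExterior ε δ)) (hharm : HarmonicOnNhd v (exterior ε δ))
    (hper : ∀ z ∈ closedExterior ε δ, ∀ n : ℤ, v (z + n * (2 + δ : ℝ) * I) = v z)
    (hgrowth : ∀ η > 0, ∃ C : ℝ, ∀ z ∈ closedExterior ε δ, v z ≤ C + η * |z.re|) :
    ∃ z₀ ∈ closedExterior ε δ, IsMaxOn v (closedExterior ε δ) z₀ := by
  have hE : ∀ z : ℂ, 3 ≤ |z.re| → z ∈ exterior ε δ := fun z hz =>
    mem_exterior_of_lt_abs_re hε hδ (by linarith)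
  have hK : ∀ z : ℂ, 3 ≤ |z.re| → z ∈ closedExterior ε δ := fun z hz =>
    exterior_subset_closedExterior hδ (hE z hz)
  have hrep : ∀ z ∈ closedExterior ε δ, ∃ z' ∈ closedExterior ε δ,
      |z'.im| ≤ 1 + δ / 2 ∧ z'.re = z.re ∧ v z' = v z := fun z hz => by
    obtain ⟨n, hn⟩ := exists_period_abs_im_le hδ z
    exact ⟨_, (add_period_mem_closedExterior n).2 hz, hn, by simp, hper z hz n⟩
  have hcomp : IsCompact (closedExterior ε δ ∩
      (Icc (-3) 3 ×ℂ Icc (-(1 + δ / 2)) (1 + δ / 2))) :=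
    (isCompact_Icc.reProdIm isCompact_Icc).inter_left (isClosed_closedExterior ε δ)
  have hzero : (0 : ℂ) ∈ Icc (-3) 3 ×ℂ Icc (-(1 + δ / 2)) (1 + δ / 2) := by
    simp only [mem_reProdIm, zero_re, zero_im, mem_Icc]
    refine ⟨⟨?_, ?_⟩, ?_, ?_⟩ <;> linarith
  obtain ⟨z₀, hz₀, hmax⟩ := hcomp.exists_isMaxOn
    ⟨0, exterior_subset_closedExterior hδ (mem_exterior_of_re_eq_zero hε hδ rfl), hzero⟩
    (hcont.mono inter_subset_left)
  have hnear : ∀ z ∈ closedExterior ε δ, |z.re| ≤ 3 → v z ≤ v z₀ := fun z hz hre => by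
    obtain ⟨z', hz', him, hre', hv⟩ := hrep z hz
    exact hv ▸ hmax ⟨hz', by rw [mem_preimage, hre']; exact abs_le.1 hre, abs_le.1 him⟩
  refine ⟨z₀, hz₀.1, fun z hz => ?_⟩
  rcases le_total |z.re| 3 with hle | hle
  · exact hnear z hz hle
  · exact le_of_sublinear_growth_abs zero_le_three (hcont.mono hK)
      (hharm.mono fun w hw => hE w (le_of_lt hw))
      (fun w hw => (hrep w (hK w hw)).imp fun _ hw' => hw'.2)
      (fun η hη => (hgrowth η hη).imp fun _ hC w hw => hC w (hK w hw))
      (fun w hw => hnear w (hK w hw.ge) hw.le) hle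

theorem le_of_le_on_circles (hε : 0 < ε) (hε1 : ε < 1) (hδ : 0 < δ)
    (hcont : ContinuousOn v (closedExterior ε δ)) (hharm : HarmonicOnNhd v (exterior ε δ))
    (hper : ∀ z ∈ closedExterior ε δ, ∀ n : ℤ, v (z + n * (2 + δ : ℝ) * I) = v z)
    (hgrowth : ∀ η > 0, ∃ C : ℝ, ∀ z ∈ closedExterior ε δ, v z ≤ C + η * |z.re|)
    (hbd : ∀ z ∈ closedExterior ε δ, z ∉ exterior ε δ → v z ≤ m) {z : ℂ}
    (hz : z ∈ closedExterior ε δ) : v z ≤ m := by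
  obtain ⟨z₀, hz₀, hmax⟩ := exists_isMaxOn_closedExterior hε hε1 hδ hcont hharm hper hgrowth
  refine (hmax hz).trans ?_
  by_cases hz₀E : z₀ ∈ exterior ε δ
  · have hconst : EqOn v (fun _ => v z₀) (closedExterior ε δ) :=
      EqOn.of_subset_closure (eqOn_of_isPreconnected_of_isMaxOn (isOpen_exterior ε δ)
          (isPreconnected_exterior hε hδ) hharm hz₀E
          (hmax.on_subset (exterior_subset_closedExterior hδ)))
        hcont continuousOn_const (exterior_subset_closedExterior hδ) (closure_exterior hε hδ).ge
    have hc : centerR ε δ 0 ∈ centers ε δ := Or.inr ⟨0, rfl⟩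
    have hp : dist (centerR ε δ 0 + 1) (centerR ε δ 0) = 1 := by simp
    have hpK := mem_closedExterior_of_dist_eq_one hε hδ hc hp
    exact (hconst hpK).ge.trans (hbd _ hpK fun hE => ((mem_exterior hδ).1 hE _ hc).ne' hp)
  · exact hbd _ hz₀ hz₀E

theorem abs_sub_le_of_abs_sub_le_on_circles {k : ℝ} (hε : 0 < ε) (hε1 : ε < 1) (hδ : 0 < δ)
    (hcont : ContinuousOn v (closedExterior ε δ)) (hharm : HarmonicOnNhd v (exterior ε δ))
    (hper : ∀ z ∈ closedExterior ε δ, ∀ n : ℤ, v (z + n * (2 + δ : ℝ) * I) = v z)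
    (hgrowth : ∀ η > 0, ∃ C : ℝ, ∀ z ∈ closedExterior ε δ, |v z| ≤ C + η * |z.re|)
    (hbd : ∀ z ∈ closedExterior ε δ, z ∉ exterior ε δ → |v z - k| ≤ m) {z : ℂ}
    (hz : z ∈ closedExterior ε δ) : |v z - k| ≤ m := by
  have hupper : v z ≤ k + m := le_of_le_on_circles hε hε1 hδ hcont hharm hper
    (fun η hη => (hgrowth η hη).imp fun _ hC w hw => (le_abs_self _).trans (hC w hw))
    (fun w hw hwE => by linarith [(abs_le.1 (hbd w hw hwE)).2]) hz
  have hlower : (-v) z ≤ m - k := le_of_le_on_circles hε hε1 hδ hcont.neg hharm.neg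
    (fun w hw n => congrArg Neg.neg (hper w hw n))
    (fun η hη => (hgrowth η hη).imp fun _ hC w hw => (neg_le_abs _).trans (hC w hw))
    (fun w hw hwE => by
      rw [Pi.neg_apply]
      linarith [(abs_le.1 (hbd w hw hwE)).1]) hz
  rw [Pi.neg_apply] at hlower
  exact abs_le.2 ⟨by linarith, by linarith⟩

end

namespace PeriodicSolution

variable {ε δ a b cL cR : ℝ} {u : ℂ → ℝ}

theorem periodic_int (h : PeriodicSolution ε δ a b cL cR u) {z : ℂ} (hz : z ∈ closedExterior ε δ)
    (n : ℤ) : u (z + n * (2 + δ : ℝ) * I) = u z + n * (b * (2 + δ)) := by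
  have hzsmul := map_add_zsmul_of_forall_map_add (φ := u) (T := ((2 + δ : ℝ) * I : ℂ))
    (β := b * (2 + δ)) (A := closedExterior ε δ)
    (fun z hz n => by simpa [mul_assoc] using (add_period_mem_closedExterior n).2 hz)
    h.periodic hz n
  simpa [mul_assoc] using hzsmul

theorem eq_of_dist_eq_one (h : PeriodicSolution ε δ a b cL cR u) (hε : 0 < ε) (hδ : 0 < δ)
    {c z : ℂ} {k : ℝ} (hc : c ∈ centers ε δ) (hk : ∀ w, dist w c = 1 → u w = k) {n : ℤ}
    (hz : dist z (c + n * (2 + δ : ℝ) * I) = 1) : u z = k + n * (b * (2 + δ)) := by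
  have hd : dist (z - n * (2 + δ : ℝ) * I) c = 1 := by
    rw [← hz, dist_eq, dist_eq, sub_sub, add_comm]
  have hper := h.periodic_int (mem_closedExterior_of_dist_eq_one hε hδ hc hd) n
  rwa [sub_add_cancel, hk _ hd] at hper

theorem eq_right (h : PeriodicSolution ε δ a b cL cR u) (hε : 0 < ε) (hδ : 0 < δ) {z : ℂ} {n : ℤ}
    (hz : dist z (centerR ε δ n) = 1) : u z = cR + n * (b * (2 + δ)) :=
  h.eq_of_dist_eq_one hε hδ (Or.inr ⟨0, rfl⟩) h.right (by
    rw [← hz]; congr 1; apply Complex.ext <;> simp [centerR])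

theorem eq_left (h : PeriodicSolution ε δ a b cL cR u) (hε : 0 < ε) (hδ : 0 < δ) {z : ℂ} {n : ℤ}
    (hz : dist z (centerL ε δ n) = 1) : u z = cL + n * (b * (2 + δ)) :=
  h.eq_of_dist_eq_one hε hδ (Or.inl ⟨0, rfl⟩) h.left (by
    rw [← hz]; congr 1; apply Complex.ext <;> simp [centerL])

theorem exists_eq_on_circle (h : PeriodicSolution ε δ a b cL cR u) (hε : 0 < ε) (hδ : 0 < δ)
    {c z : ℂ} (hc : c ∈ centers ε δ) (hz : dist z c = 1) :
    ∃ k : ℝ, |k - (cL + cR) / 2| = |cR - cL| / 2 ∧ u z = k + b * c.im := by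
  rcases hc with ⟨n, rfl⟩ | ⟨n, rfl⟩
  · refine ⟨cL, ?_, (h.eq_left hε hδ hz).trans (by simp [centerL]; ring)⟩
    rw [show cL - (cL + cR) / 2 = -((cR - cL) / 2) by ring, abs_neg, abs_div, abs_two]
  · refine ⟨cR, ?_, (h.eq_right hε hδ hz).trans (by simp [centerR]; ring)⟩
    rw [show cR - (cL + cR) / 2 = (cR - cL) / 2 by ring, abs_div, abs_two]

theorem abs_sub_linearPotential_le_of_dist_eq_one (h : PeriodicSolution ε δ a b cL cR u)
    (hε : 0 < ε) (hε1 : ε < 1) (hδ : 0 < δ) {c z : ℂ} (hc : c ∈ centers ε δ)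
    (hz : dist z c = 1) :
    |u z - linearPotential a b z - (cL + cR) / 2| ≤ |cR - cL| / 2 + 3 * (|a| + |b|) := by
  obtain ⟨k, hk, hu⟩ := h.exists_eq_on_circle hε hδ hc hz
  have hre : |z.re - c.re| ≤ 1 := by
    rw [← hz, dist_eq, ← sub_re]
    exact abs_re_le_norm _
  have him : |z.im - c.im| ≤ 1 := by
    rw [← hz, dist_eq, ← sub_im]
    exact abs_im_le_norm _
  have hre3 : |z.re| ≤ 3 := by
    linarith [abs_sub_abs_le_abs_sub z.re c.re, abs_re_of_mem_centers hε hc]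
  calc |u z - linearPotential a b z - (cL + cR) / 2|
      = |k - (cL + cR) / 2 - a * z.re - b * (z.im - c.im)| := by
        rw [hu, linearPotential]
        congr 1
        ring
    _ ≤ |k - (cL + cR) / 2| + |a| * |z.re| + |b| * |z.im - c.im| := by
        rw [← abs_mul, ← abs_mul]
        exact (abs_sub _ _).trans (by gcongr; exact abs_sub _ _)
    _ ≤ |cR - cL| / 2 + |a| * 3 + |b| * 1 := by rw [hk]; gcongr
    _ ≤ |cR - cL| / 2 + 3 * (|a| + |b|) := by linarith [abs_nonneg b]

theorem abs_sub_linearPotential_le (h : PeriodicSolution ε δ a b cL cR u) (hε : 0 < ε)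
    (hε1 : ε < 1) (hδ : 0 < δ) {z : ℂ} (hz : z ∈ closedExterior ε δ) :
    |u z - linearPotential a b z - (cL + cR) / 2| ≤ |cR - cL| / 2 + 3 * (|a| + |b|) := by
  refine abs_sub_le_of_abs_sub_le_on_circles (v := u - linearPotential a b) hε hε1 hδ
    (h.cont.sub fun w _ =>
      (hasFDerivAt_linearPotential a b w).continuousAt.continuousWithinAt)
    (h.harmonic.sub fun w _ => harmonicAt_linearPotential a b w) (fun w hw n => ?_) h.growth
    (fun w hw hwE => ?_) hz
  · simp only [Pi.sub_apply, h.periodic_int hw n, linearPotential]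
    simp
    ring
  · obtain ⟨c, hc, hd⟩ := exists_center_of_mem_diff hδ hw hwE
    exact h.abs_sub_linearPotential_le_of_dist_eq_one hε hε1 hδ hc hd

end PeriodicSolution

/-! ### The potential of two close disks -/

/-- Half the distance of the two poles of `gapFun`, the limiting points of the pencil of circles
spanned by the unit circles with centers `±(1 + ε / 2)`. -/
def pole (ε : ℝ) : ℝ := √(ε + ε ^ 2 / 4)

/-- The difference of the values on the two circles of `log ‖pole + ζ‖ - log ‖pole - ζ‖`. -/
def logGap (ε : ℝ) : ℝ := Real.log ((2 + ε + 2 * pole ε) / (2 + ε - 2 * pole ε))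

/-- The harmonic function outside the unit disks with centers `±(1 + ε / 2)` with the values
`±1 / 2` on the two circles. -/
def gapFun (ε : ℝ) (ζ : ℂ) : ℝ := (Real.log ‖pole ε + ζ‖ - Real.log ‖pole ε - ζ‖) / logGap ε

/-- The complex derivative of `gapFun`: the conjugate of its gradient. -/
def gapDeriv (ε : ℝ) (ζ : ℂ) : ℂ := (2 * pole ε / logGap ε : ℝ) / ((pole ε : ℂ) ^ 2 - ζ ^ 2)

theorem hasGradientAt_log_norm {F : ℂ → ℂ} {F' z : ℂ} (h : HasDerivAt F F' z) (hz : F z ≠ 0) :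
    HasGradientAt (fun w => Real.log ‖F w‖) (conj (F' / F z)) z := by
  -- `F / F z` stays in the slit plane near `z`, where `log` is holomorphic.
  have hlog : HasDerivAt (fun w => Complex.log (F w / F z)) (F' / F z) z := by
    have hclog := (h.div_const (F z)).clog (by rw [div_self hz]; exact one_mem_slitPlane)
    rwa [div_self hz, div_one] at hclog
  have hre := hasGradientAt_re (hlog.add_const ((Real.log ‖F z‖ : ℝ) : ℂ))
  refine hre.congr_of_eventuallyEq ?_
  filter_upwards [h.continuousAt.eventually_ne hz] with w hw
  rw [add_re, log_re, ofReal_re, norm_div, Real.log_div (norm_ne_zero_iff.2 hw)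
    (norm_ne_zero_iff.2 hz), sub_add_cancel]

theorem sq_norm_sub_ofReal (ζ : ℂ) (s : ℝ) : ‖ζ - s‖ ^ 2 = (ζ.re - s) ^ 2 + ζ.im ^ 2 := by
  rw [← normSq_eq_norm_sq, normSq_apply, sub_re, sub_im, ofReal_re, ofReal_im]
  ring

theorem sq_norm_add_ofReal (ζ : ℂ) (s : ℝ) : ‖ζ + s‖ ^ 2 = (ζ.re + s) ^ 2 + ζ.im ^ 2 := by
  simpa using sq_norm_sub_ofReal ζ (-s)

section

variable {ε : ℝ} {ζ : ℂ}

theorem pole_pos (hε : 0 < ε) : 0 < pole ε := Real.sqrt_pos.2 (by positivity)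

theorem pole_sq (hε : 0 < ε) : pole ε ^ 2 = ε + ε ^ 2 / 4 := Real.sq_sqrt (by positivity)

theorem two_mul_pole_lt (hε : 0 < ε) : 2 * pole ε < 2 + ε := by
  nlinarith [pole_pos hε, pole_sq hε]

theorem logGap_le (hε : 0 < ε) : logGap ε ≤ pole ε * (2 + ε) := by
  have hp := pole_pos hε
  have hlt := two_mul_pole_lt hε
  have hone : 1 ≤ (2 + ε + 2 * pole ε) / (2 + ε - 2 * pole ε) := by
    rw [one_le_div (by linarith)]
    linarith
  refine (Real.self_le_sinh_iff.2 (Real.log_nonneg hone)).trans (le_of_eq ?_)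
  rw [Real.sinh_log (by linarith), inv_div]
  have hsub : 2 + ε - 2 * pole ε ≠ 0 := by linarith
  have hadd : 2 + ε + 2 * pole ε ≠ 0 := by linarith
  have hmul : (2 + ε + 2 * pole ε) * (2 + ε - 2 * pole ε) = 4 := by
    linear_combination -4 * pole_sq hε
  field_simp
  linear_combination (-pole ε * (2 + ε) * 2) * hmul

theorem le_logGap (hε : 0 < ε) : 4 * pole ε / (2 + ε) ≤ logGap ε := by
  have hp := pole_pos hε
  have hlt := two_mul_pole_lt hε
  set t := 2 * pole ε / (2 + ε) with ht
  have ht0 : 0 < t := by positivity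
  have ht1 : t < 1 := by rwa [ht, div_lt_one (by linarith)]
  have hlog : logGap ε = Real.log (1 + t) - Real.log (1 - t) := by
    rw [← Real.log_div (by linarith) (by linarith), logGap, ht]
    congr 1
    have hsub : 2 + ε - 2 * pole ε ≠ 0 := by linarith
    field_simp
  have hfirst := le_hasSum (Real.hasSum_log_sub_log_of_abs_lt_one (by rwa [abs_of_pos ht0])) 0
    fun k _ => by positivity
  rw [hlog]
  refine le_trans (le_of_eq ?_) hfirst
  rw [ht]
  norm_num
  ring

theorem logGap_pos (hε : 0 < ε) : 0 < logGap ε :=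
  lt_of_lt_of_le (by have := pole_pos hε; positivity) (le_logGap hε)

theorem abs_two_mul_pole_div_logGap_sub_one_le (hε : 0 < ε) :
    |2 * pole ε / logGap ε - 1| ≤ ε / 2 := by
  have hp := pole_pos hε
  have hle := logGap_le hε
  have hge := le_logGap hε
  have hpos := logGap_pos hε
  rw [div_le_iff₀ (by linarith)] at hge
  rw [abs_le]
  constructor
  · rw [le_sub_iff_add_le, le_div_iff₀ hpos]
    nlinarith [mul_pos hε hp, mul_pos (mul_pos hε hp) hε]
  · rw [sub_le_iff_le_add, div_le_iff₀ hpos]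
    linarith

theorem gapFun_neg (ζ : ℂ) : gapFun ε (-ζ) = -gapFun ε ζ := by
  rw [gapFun, gapFun, sub_neg_eq_add, ← sub_eq_add_neg]
  ring

theorem pole_sub_ne_zero (hε : 0 < ε) (hR : 1 ≤ ‖ζ - (1 + ε / 2 : ℝ)‖) : (pole ε : ℂ) - ζ ≠ 0 := by
  rw [sub_ne_zero]
  rintro rfl
  rw [← ofReal_sub, norm_real, Real.norm_eq_abs,
    abs_of_neg (by linarith [two_mul_pole_lt hε])] at hR
  nlinarith [pole_sq hε, pole_pos hε]

theorem pole_add_ne_zero (hε : 0 < ε) (hL : 1 ≤ ‖ζ + (1 + ε / 2 : ℝ)‖) : (pole ε : ℂ) + ζ ≠ 0 := by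
  have hneg := pole_sub_ne_zero (ζ := -ζ) hε (by rwa [← neg_add', norm_neg])
  rwa [sub_neg_eq_add] at hneg

theorem gapFun_eq_log (hp : (pole ε : ℂ) + ζ ≠ 0) (hm : (pole ε : ℂ) - ζ ≠ 0) :
    gapFun ε ζ = Real.log (‖ζ + pole ε‖ ^ 2 / ‖ζ - pole ε‖ ^ 2) / (2 * logGap ε) := by
  have hp' : ‖(pole ε : ℂ) + ζ‖ ≠ 0 := norm_ne_zero_iff.2 hp
  have hm' : ‖(pole ε : ℂ) - ζ‖ ≠ 0 := norm_ne_zero_iff.2 hm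
  rw [add_comm ζ, norm_sub_rev ζ, Real.log_div (pow_ne_zero 2 hp') (pow_ne_zero 2 hm'),
    Real.log_pow, Real.log_pow, gapFun]
  push_cast
  rw [← mul_sub, mul_div_mul_left _ _ two_ne_zero]

/-- The circle `‖ζ - (1 + ε / 2)‖ = 1` is the level set of `‖ζ + pole‖ / ‖ζ - pole‖` at the level
`exp (logGap / 2)`. -/
theorem sq_norm_add_pole_mul_sub (hε : 0 < ε) (ζ : ℂ) :
    (2 + ε + 2 * pole ε) * ‖ζ - pole ε‖ ^ 2 - ‖ζ + pole ε‖ ^ 2 * (2 + ε - 2 * pole ε) =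
      4 * pole ε * (‖ζ - (1 + ε / 2 : ℝ)‖ ^ 2 - 1) := by
  rw [sq_norm_sub_ofReal, sq_norm_sub_ofReal, sq_norm_add_ofReal]
  linear_combination 4 * pole ε * pole_sq hε

theorem gapFun_le (hε : 0 < ε) (hR : 1 ≤ ‖ζ - (1 + ε / 2 : ℝ)‖)
    (hL : 1 ≤ ‖ζ + (1 + ε / 2 : ℝ)‖) : gapFun ε ζ ≤ 1 / 2 := by
  have hm := pole_sub_ne_zero hε hR
  have hp := pole_add_ne_zero hε hL
  have hp' : 0 < ‖ζ + pole ε‖ := norm_pos_iff.2 (by rwa [add_comm])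
  have hm' : 0 < ‖ζ - pole ε‖ := norm_pos_iff.2 (sub_ne_zero.2 (sub_ne_zero.1 hm).symm)
  have hlog := logGap_pos hε
  rw [gapFun_eq_log hp hm, div_le_div_iff₀ (by positivity) two_pos]
  suffices Real.log (‖ζ + pole ε‖ ^ 2 / ‖ζ - pole ε‖ ^ 2) ≤ logGap ε by linarith
  refine Real.log_le_log (by positivity) ?_
  rw [div_le_div_iff₀ (by positivity) (by linarith [two_mul_pole_lt hε]), ← sub_nonneg,
    sq_norm_add_pole_mul_sub hε]
  exact mul_nonneg (by linarith [pole_pos hε]) (sub_nonneg.2 (one_le_pow₀ hR))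

theorem gapFun_eq (hε : 0 < ε) (hR : ‖ζ - (1 + ε / 2 : ℝ)‖ = 1)
    (hL : 1 ≤ ‖ζ + (1 + ε / 2 : ℝ)‖) : gapFun ε ζ = 1 / 2 := by
  have hm := pole_sub_ne_zero hε hR.ge
  have hm' : 0 < ‖ζ - pole ε‖ := norm_pos_iff.2 (sub_ne_zero.2 (sub_ne_zero.1 hm).symm)
  have hlog := logGap_pos hε
  have hratio : ‖ζ + pole ε‖ ^ 2 / ‖ζ - pole ε‖ ^ 2 =
      (2 + ε + 2 * pole ε) / (2 + ε - 2 * pole ε) := by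
    have hcircle := sq_norm_add_pole_mul_sub hε ζ
    rw [hR] at hcircle
    rw [div_eq_div_iff (by positivity) (by linarith [two_mul_pole_lt hε])]
    linarith
  rw [gapFun_eq_log (pole_add_ne_zero hε hL) hm, hratio, ← logGap]
  field_simp

theorem gapFun_eq_neg (hε : 0 < ε) (hR : 1 ≤ ‖ζ - (1 + ε / 2 : ℝ)‖)
    (hL : ‖ζ + (1 + ε / 2 : ℝ)‖ = 1) : gapFun ε ζ = -(1 / 2) := by
  rw [← neg_neg ζ, gapFun_neg, gapFun_eq hε (by rwa [← neg_add', norm_neg])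
    (by rwa [neg_add_eq_sub, norm_sub_rev])]

theorem abs_gapFun_le (hε : 0 < ε) (hR : 1 ≤ ‖ζ - (1 + ε / 2 : ℝ)‖)
    (hL : 1 ≤ ‖ζ + (1 + ε / 2 : ℝ)‖) : |gapFun ε ζ| ≤ 1 / 2 := by
  refine abs_le'.2 ⟨gapFun_le hε hR hL, ?_⟩
  rw [← gapFun_neg]
  exact gapFun_le hε (by rwa [← neg_add', norm_neg]) (by rwa [neg_add_eq_sub, norm_sub_rev])

theorem harmonicAt_gapFun_comp {f : ℂ → ℂ} {z : ℂ} (hf : AnalyticAt ℂ f z)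
    (hp : (pole ε : ℂ) + f z ≠ 0) (hm : (pole ε : ℂ) - f z ≠ 0) :
    HarmonicAt (fun w => gapFun ε (f w)) z := by
  have hlogp := AnalyticAt.harmonicAt_log_norm (analyticAt_const.add hf) hp
  have hlogm := AnalyticAt.harmonicAt_log_norm (analyticAt_const.sub hf) hm
  convert (hlogp.sub hlogm).const_smul (c := (logGap ε)⁻¹) using 1
  ext w
  simp [gapFun, div_eq_inv_mul]

theorem hasGradientAt_gapFun_comp {f : ℂ → ℂ} {f' z : ℂ} (hf : HasDerivAt f f' z)
    (hp : (pole ε : ℂ) + f z ≠ 0) (hm : (pole ε : ℂ) - f z ≠ 0) :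
    HasGradientAt (fun w => gapFun ε (f w)) (conj (gapDeriv ε (f z) * f')) z := by
  have hlogp := (hasGradientAt_log_norm (hf.const_add (pole ε : ℂ)) hp).hasFDerivAt
  have hlogm := (hasGradientAt_log_norm (hf.const_sub (pole ε : ℂ)) hm).hasFDerivAt
  have hfderiv : HasFDerivAt (fun w => gapFun ε (f w)) _ z :=
    (hlogp.sub hlogm).mul_const (logGap ε)⁻¹
  have hpartial : gapDeriv ε (f z) * f' =
      ((logGap ε)⁻¹ : ℝ) * (f' / (pole ε + f z) - -f' / (pole ε - f z)) := by
    have hfactor : (pole ε : ℂ) ^ 2 - f z ^ 2 = (pole ε + f z) * (pole ε - f z) := by ring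
    rw [gapDeriv, hfactor]
    push_cast
    field_simp
    ring
  rw [hasGradientAt_iff_hasFDerivAt]
  refine hfderiv.congr_fderiv ?_
  rw [← map_sub, ← map_sub, hpartial]
  ext v
  simp
  ring

end

theorem sq_lt_of_abs_lt_sqrt_three_div_two {x : ℝ} (hx : |x| < √3 / 2) : x ^ 2 < 3 / 4 := by
  calc x ^ 2 = |x| ^ 2 := (sq_abs x).symm
    _ < (√3 / 2) ^ 2 := by gcongr
    _ = 3 / 4 := by rw [div_pow, Real.sq_sqrt zero_le_three]; norm_num

theorem abs_le_of_narrow {ε ξ η : ℝ} (hξ : |ξ| < 1 + ε / 2 - √(1 - η ^ 2)) (hη : |η| < √3 / 2) :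
    |ξ| ≤ ε / 2 + 2 / 3 * η ^ 2 := by
  have hlt := sq_lt_of_abs_lt_sqrt_three_div_two hη
  have hsq : √(1 - η ^ 2) ^ 2 = 1 - η ^ 2 := Real.sq_sqrt (by linarith)
  have hge : 1 / 2 ≤ √(1 - η ^ 2) := Real.le_sqrt_of_sq_le (by linarith)
  have hle : √(1 - η ^ 2) ≤ 1 := Real.sqrt_le_one.2 (by linarith [sq_nonneg η])
  nlinarith

theorem pole_sq_sub_sq {ε : ℝ} (hε : 0 < ε) (ζ : ℂ) : (pole ε : ℂ) ^ 2 - ζ ^ 2 =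
    (ε + ζ.im ^ 2 : ℝ) + ((ε ^ 2 / 4 - ζ.re ^ 2 : ℝ) - (2 * ζ.re * ζ.im : ℝ) * I) := by
  rw [← ofReal_pow, pole_sq hε]
  apply Complex.ext <;> simp [pow_two] <;> ring

theorem norm_one_div_add_sub_le {s p q : ℝ} (hs : 0 < s) (hs1 : s ≤ 1) (hp : |p| ≤ s ^ 2)
    (hq : q ^ 2 ≤ 4 * s ^ 3) (h : s / 2 ≤ ‖(s + (p - q * I) : ℂ)‖) :
    ‖1 / (s + (p - q * I)) - (1 / (s : ℂ) + q / (s : ℂ) ^ 2 * I)‖ ≤ 14 := by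
  have hsC : (s : ℂ) ≠ 0 := ofReal_ne_zero.2 hs.ne'
  have hne : (s + (p - q * I) : ℂ) ≠ 0 := norm_pos_iff.1 (lt_of_lt_of_le (by positivity) h)
  have hident : 1 / (s + (p - q * I)) - (1 / (s : ℂ) + q / (s : ℂ) ^ 2 * I) =
      (-(s * p) - q * p * I - q * q) / ((s : ℂ) ^ 2 * (s + (p - q * I))) := by
    field_simp
    linear_combination (q : ℂ) ^ 2 * I_sq
  have hqs : |q| ≤ 2 * s := abs_le_of_sq_le_sq (by nlinarith [pow_pos hs 2]) (by positivity)
  have hnum : ‖(-(s * p) - q * p * I - q * q : ℂ)‖ ≤ 7 * s ^ 3 := by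
    calc ‖(-(s * p) - q * p * I - q * q : ℂ)‖
        ≤ ‖(-(s * p) : ℂ)‖ + ‖(q * p * I : ℂ)‖ + ‖(q * q : ℂ)‖ :=
          (norm_sub_le _ _).trans (by gcongr; exact norm_sub_le _ _)
      _ = s * |p| + |q| * |p| + q ^ 2 := by
          simp only [norm_neg, norm_mul, norm_real, norm_I, Real.norm_eq_abs, abs_of_pos hs,
            mul_one, abs_mul_abs_self, pow_two]
      _ ≤ s * s ^ 2 + 2 * s * s ^ 2 + 4 * s ^ 3 := by gcongr
      _ = 7 * s ^ 3 := by ring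
  rw [hident, norm_div, div_le_iff₀ (norm_pos_iff.2 (mul_ne_zero (pow_ne_zero 2 hsC) hne)),
    norm_mul, norm_pow, norm_real, Real.norm_of_nonneg hs.le]
  calc _ ≤ 7 * s ^ 3 := hnum
    _ = 14 * (s ^ 2 * (s / 2)) := by ring
    _ ≤ 14 * (s ^ 2 * ‖(s + (p - q * I) : ℂ)‖) := by gcongr

theorem norm_gapDeriv_sub_le {ε : ℝ} (hε : 0 < ε) (hε4 : ε ≤ 1 / 4) {ζ : ℂ}
    (hξ : |ζ.re| < 1 + ε / 2 - √(1 - ζ.im ^ 2)) (hη : |ζ.im| < √3 / 2) :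
    ‖gapDeriv ε ζ - (1 / (ε + ζ.im ^ 2) + 2 * ζ.re * ζ.im / (ε + ζ.im ^ 2) ^ 2 * I)‖ ≤ 15 := by
  have hη2 := sq_lt_of_abs_lt_sqrt_three_div_two hη
  have hη0 := sq_nonneg ζ.im
  set s := ε + ζ.im ^ 2 with hs
  set p := ε ^ 2 / 4 - ζ.re ^ 2 with hp_def
  set q := 2 * ζ.re * ζ.im with hq_def
  have hξs := abs_le_of_narrow hξ hη
  have hre2 : ζ.re ^ 2 ≤ (ε / 2 + 2 / 3 * ζ.im ^ 2) ^ 2 := by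
    rw [← sq_abs]
    gcongr
  have hre2s : ζ.re ^ 2 ≤ s ^ 2 := hre2.trans (by gcongr; linarith)
  have hεs : ε ^ 2 ≤ s ^ 2 := by gcongr; linarith
  have hp : |p| ≤ s ^ 2 :=
    abs_le.2 ⟨by linarith [sq_nonneg ε], by linarith [sq_nonneg ζ.re, sq_nonneg ε]⟩
  have hq : q ^ 2 ≤ 4 * s ^ 3 :=
    calc q ^ 2 = 4 * (ζ.re ^ 2 * ζ.im ^ 2) := by ring
      _ ≤ 4 * (s ^ 2 * s) := by gcongr; linarith
      _ = 4 * s ^ 3 := by ring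
  have hdenom : (pole ε : ℂ) ^ 2 - ζ ^ 2 = s + (p - q * I) := pole_sq_sub_sq hε ζ
  have hhalf : s / 2 ≤ ‖(s + (p - q * I) : ℂ)‖ := by
    refine le_trans ?_ (re_le_norm _)
    simp only [add_re, sub_re, ofReal_re, re_ofReal_mul, I_re, mul_zero, sub_zero]
    nlinarith
  have hpos : 0 < ‖(s + (p - q * I) : ℂ)‖ := lt_of_lt_of_le (by positivity) hhalf
  have hcoeff : ‖((2 * pole ε / logGap ε - 1 : ℝ) : ℂ) / (s + (p - q * I))‖ ≤ 1 := by
    rw [norm_div, norm_real, Real.norm_eq_abs, div_le_one hpos]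
    linarith [abs_two_mul_pole_div_logGap_sub_one_le hε]
  have hsplit : gapDeriv ε ζ - (1 / (ε + ζ.im ^ 2) + 2 * ζ.re * ζ.im / (ε + ζ.im ^ 2) ^ 2 * I) =
      ((2 * pole ε / logGap ε - 1 : ℝ) : ℂ) / (s + (p - q * I)) +
        (1 / (s + (p - q * I)) - (1 / (s : ℂ) + q / (s : ℂ) ^ 2 * I)) := by
    rw [gapDeriv, hdenom, hs]
    simp only [hp_def, hq_def]
    push_cast
    ring
  rw [hsplit]
  exact (norm_add_le _ _).trans (by
    linarith [norm_one_div_add_sub_le (by positivity) (by linarith) hp hq hhalf])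

/-! ### The gradient near the gap between two disks -/

/-- The disks with centers `m ± e (1 + ε' / 2)`, where `e` is a unit vector, belong to the two rows;
they are separated by a gap of width `ε'` in the direction `e` with midpoint `m`. -/
structure IsGap (ε δ ε' : ℝ) (m e : ℂ) : Prop where
  norm_eq_one : ‖e‖ = 1
  sub_mem_centers : m - e * (1 + ε' / 2 : ℝ) ∈ centers ε δ
  add_mem_centers : m + e * (1 + ε' / 2 : ℝ) ∈ centers ε δ

/-- The coordinate in which the gap with midpoint `m` and direction `e` is centered at the origin
and directed along the real axis. -/
def gapCoord (m e y : ℂ) : ℂ := e⁻¹ * (y - m)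

theorem dist_eq_norm_gapCoord_sub {m e : ℂ} (he : ‖e‖ = 1) (y : ℂ) (s : ℝ) :
    dist y (m + e * s) = ‖gapCoord m e y - s‖ := by
  have he0 : e ≠ 0 := norm_pos_iff.1 (he.symm ▸ one_pos)
  have hmul : y - (m + e * s) = e * (gapCoord m e y - s) := by
    rw [gapCoord]
    field_simp
    ring
  rw [dist_eq, hmul, norm_mul, he, one_mul]

namespace IsGap

variable {ε δ ε' : ℝ} {m e y : ℂ}

theorem one_le_norm_sub (h : IsGap ε δ ε' m e) (hy : y ∈ closedExterior ε δ) :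
    1 ≤ ‖gapCoord m e y - (1 + ε' / 2 : ℝ)‖ := by
  rw [← dist_eq_norm_gapCoord_sub h.norm_eq_one]
  exact hy _ h.add_mem_centers

theorem dist_sub_eq (h : IsGap ε δ ε' m e) (y : ℂ) :
    dist y (m - e * (1 + ε' / 2 : ℝ)) = ‖gapCoord m e y + (1 + ε' / 2 : ℝ)‖ := by
  have hdist := dist_eq_norm_gapCoord_sub (m := m) h.norm_eq_one y (-(1 + ε' / 2))
  rwa [ofReal_neg, mul_neg, ← sub_eq_add_neg, sub_neg_eq_add] at hdist

theorem one_le_norm_add (h : IsGap ε δ ε' m e) (hy : y ∈ closedExterior ε δ) :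
    1 ≤ ‖gapCoord m e y + (1 + ε' / 2 : ℝ)‖ := by
  rw [← h.dist_sub_eq]
  exact hy _ h.sub_mem_centers

theorem harmonicAt_gapFun (h : IsGap ε δ ε' m e) (hε' : 0 < ε') (hy : y ∈ closedExterior ε δ) :
    HarmonicAt (fun w => gapFun ε' (gapCoord m e w)) y :=
  harmonicAt_gapFun_comp (by unfold gapCoord; fun_prop)
    (pole_add_ne_zero hε' (h.one_le_norm_add hy)) (pole_sub_ne_zero hε' (h.one_le_norm_sub hy))

theorem hasGradientAt_gapFun (h : IsGap ε δ ε' m e) (hε' : 0 < ε')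
    (hy : y ∈ closedExterior ε δ) : HasGradientAt (fun w => gapFun ε' (gapCoord m e w))
      (e * conj (gapDeriv ε' (gapCoord m e y))) y := by
  have hderiv : HasDerivAt (gapCoord m e) (e⁻¹ * 1) y :=
    ((hasDerivAt_id y).sub_const m).const_mul e⁻¹
  rw [mul_one] at hderiv
  have hgrad := hasGradientAt_gapFun_comp hderiv (pole_add_ne_zero hε' (h.one_le_norm_add hy))
    (pole_sub_ne_zero hε' (h.one_le_norm_sub hy))
  have hconj : conj e⁻¹ = e := by
    rw [map_inv₀, inv_eq_of_mul_eq_one_left]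
    rw [mul_conj, normSq_eq_norm_sq, h.norm_eq_one]
    simp
  rwa [map_mul, hconj, mul_comm] at hgrad

theorem hasGradientAt_sub_const_smul_gapFun (h : IsGap ε δ ε' m e) (hε' : 0 < ε') {u : ℂ → ℝ}
    (k V : ℝ) (hu : DifferentiableAt ℝ u y) (hy : y ∈ closedExterior ε δ) :
    HasGradientAt ((u - fun _ => k) - V • fun w => gapFun ε' (gapCoord m e w))
      (gradient u y - V * (e * conj (gapDeriv ε' (gapCoord m e y)))) y := by
  have hgap := (h.hasGradientAt_gapFun hε' hy).hasFDerivAt.const_smul V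
  rw [hasGradientAt_iff_hasFDerivAt, map_sub, toDual_gradient, ← real_smul, map_smulₛₗ]
  exact (hu.hasFDerivAt.sub_const k).sub hgap

theorem vanishesNear (h : IsGap ε δ ε' m e) (hδ : 0 < δ) (hε' : 0 < ε') {u : ℂ → ℝ} {k V M ρ : ℝ}
    {z : ℂ} (hcont : ContinuousOn u (closedExterior ε δ)) (hharm : HarmonicOnNhd u (exterior ε δ))
    (hL : ∀ y, dist y (m - e * (1 + ε' / 2 : ℝ)) = 1 → u y = k - V / 2)
    (hR : ∀ y, dist y (m + e * (1 + ε' / 2 : ℝ)) = 1 → u y = k + V / 2)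
    (hfar : ∀ c ∈ centers ε δ, c ≠ m - e * (1 + ε' / 2 : ℝ) → c ≠ m + e * (1 + ε' / 2 : ℝ) →
      1 + ρ < dist z c)
    (hM : ∀ y ∈ closedExterior ε δ, dist y z ≤ ρ → |u y - k| ≤ M) :
    VanishesNear ε δ ((u - fun _ => k) - V • fun y => gapFun ε' (gapCoord m e y)) z ρ
      (M + |V| / 2) where
  cont := ((hcont.sub continuousOn_const).sub (ContinuousOn.const_smul (fun _ hy =>
    (h.harmonicAt_gapFun hε' hy).1.continuousAt.continuousWithinAt) V)).mono inter_subset_left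
  harmonic := by
    have hconst : HarmonicOnNhd (fun _ : ℂ => k) (exterior ε δ) := fun y _ => by simp
    exact ((hharm.sub hconst).sub (HarmonicOnNhd.const_smul fun y hy =>
      h.harmonicAt_gapFun hε' (exterior_subset_closedExterior hδ hy))).mono inter_subset_left
  bound y hy := by
    have hgap := abs_gapFun_le hε' (h.one_le_norm_sub hy.1) (h.one_le_norm_add hy.1)
    calc |u y - k - V * gapFun ε' (gapCoord m e y)|
        ≤ |u y - k| + |V| * |gapFun ε' (gapCoord m e y)| := by rw [← abs_mul]; exact abs_sub _ _
      _ ≤ M + |V| * (1 / 2) := by gcongr; exact hM y hy.1 hy.2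
      _ = M + |V| / 2 := by ring
  zero y hy hyE := by
    obtain ⟨c, hc, hyc⟩ := exists_center_of_mem_diff hδ hy.1 hyE
    change u y - k - V * gapFun ε' (gapCoord m e y) = 0
    rcases eq_or_ne c (m - e * (1 + ε' / 2 : ℝ)) with rfl | hneL
    · rw [hL y hyc, gapFun_eq_neg hε' (h.one_le_norm_sub hy.1) (by rw [← h.dist_sub_eq, hyc])]
      ring
    rcases eq_or_ne c (m + e * (1 + ε' / 2 : ℝ)) with rfl | hneR
    · rw [hR y hyc, gapFun_eq hε' (by rw [← dist_eq_norm_gapCoord_sub h.norm_eq_one, hyc])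
        (h.one_le_norm_add hy.1)]
      ring
    · have hzy := mem_closedBall'.1 hy.2
      linarith [hfar c hc hneL hneR, dist_triangle z y c]

theorem norm_gradient_sub_le (h : IsGap ε δ ε' m e) (hδ : 0 < δ) (hε' : 0 < ε') {u : ℂ → ℝ}
    {k V M ρ : ℝ} {z : ℂ} (hρ : 0 < ρ) (hcont : ContinuousOn u (closedExterior ε δ))
    (hharm : HarmonicOnNhd u (exterior ε δ)) (hz : z ∈ exterior ε δ)
    (hL : ∀ y, dist y (m - e * (1 + ε' / 2 : ℝ)) = 1 → u y = k - V / 2)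
    (hR : ∀ y, dist y (m + e * (1 + ε' / 2 : ℝ)) = 1 → u y = k + V / 2)
    (hfar : ∀ c ∈ centers ε δ, c ≠ m - e * (1 + ε' / 2 : ℝ) → c ≠ m + e * (1 + ε' / 2 : ℝ) →
      1 + ρ < dist z c)
    (hM : ∀ y ∈ closedExterior ε δ, dist y z ≤ ρ → |u y - k| ≤ M) :
    ‖gradient u z - V * (e * conj (gapDeriv ε' (gapCoord m e z)))‖ ≤
      gradConst ρ * (M + |V| / 2) := by
  rw [← (h.hasGradientAt_sub_const_smul_gapFun hε' k V ((hharm z hz).1.differentiableAt two_ne_zero)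
    (exterior_subset_closedExterior hδ hz)).gradient]
  exact (h.vanishesNear hδ hε' hcont hharm hL hR hfar hM).norm_gradient_le hδ hρ hz

end IsGap

theorem sqrt_three_div_two_lt : √3 / 2 < 87 / 100 := by
  have h : √3 < 87 / 50 := (Real.sqrt_lt' (by norm_num)).2 (by norm_num)
  linarith

theorem one_sub_sq_lt_of_narrow {ε ξ η s : ℝ} (hξ : |ξ| < 1 + ε / 2 - √(1 - η ^ 2))
    (hs : |s| = 1 + ε / 2) : 1 - η ^ 2 < (ξ - s) ^ 2 := by
  have hlt : √(1 - η ^ 2) < |ξ - s| := by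
    have htri := abs_sub_abs_le_abs_sub s ξ
    rw [abs_sub_comm] at htri
    linarith
  rw [← sq_abs (ξ - s)]
  exact (Real.sqrt_lt' ((Real.sqrt_nonneg _).trans_lt hlt)).1 hlt

theorem lt_sq_add_sq_of_narrow {ε ξ η s t : ℝ} (hξ : |ξ| < 1 + ε / 2 - √(1 - η ^ 2))
    (hη : |η| < √3 / 2) (hs : |s| = 1 + ε / 2) (ht : 2 ≤ |t|) :
    (6 / 5) ^ 2 < (ξ - s) ^ 2 + (η - t) ^ 2 := by
  have hη' := hη.trans sqrt_three_div_two_lt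
  have hle : 2 - |η| ≤ |η - t| := by
    have htri := abs_sub_abs_le_abs_sub t η
    rw [abs_sub_comm] at htri
    linarith
  have hsq : (2 - |η|) ^ 2 ≤ |η - t| ^ 2 := by
    gcongr
    linarith
  rw [sq_abs] at hsq
  linarith [one_sub_sq_lt_of_narrow hξ hs, sq_abs η]

section

variable {ε δ : ℝ} {z : ℂ}

theorem exists_int_im_eq {c : ℂ} (hc : c ∈ centers ε δ) (hL : c ≠ centerL ε δ 0)
    (hR : c ≠ centerR ε δ 0) : ∃ n : ℤ, n ≠ 0 ∧ c.im = n * (2 + δ) := by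
  rcases hc with ⟨n, rfl⟩ | ⟨n, rfl⟩
  · exact ⟨n, fun h => hL (by rw [h]), rfl⟩
  · exact ⟨n, fun h => hR (by rw [h]), rfl⟩

theorem lt_dist_of_mem_narrowV (hε : 0 < ε) (hδ : 0 < δ) (hz : z ∈ narrowV ε) {c : ℂ}
    (hc : c ∈ centers ε δ) (hL : c ≠ centerL ε δ 0) (hR : c ≠ centerR ε δ 0) :
    6 / 5 < dist z c := by
  obtain ⟨n, hn, him⟩ := exists_int_im_eq hc hL hR
  refine (lt_dist_iff (by norm_num)).2
    (lt_sq_add_sq_of_narrow hz.1 hz.2 (abs_re_of_mem_centers hε hc) ?_)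
  rw [him]
  linarith [le_abs_intCast_mul (by linarith : 0 ≤ 2 + δ) hn]

theorem narrowV_subset_exterior (hε : 0 < ε) (hδ : 0 < δ) : narrowV ε ⊆ exterior ε δ := by
  intro z hz
  refine mem_exterior_of_abs_im_le hδ ?_ ?_ ?_
  · linarith [hz.2, sqrt_three_div_two_lt]
  · linarith [one_sub_sq_lt_of_narrow hz.1 (s := -1 - ε / 2)
      (by rw [abs_of_neg (by linarith)]; ring)]
  · linarith [one_sub_sq_lt_of_narrow hz.1 (s := 1 + ε / 2) (abs_of_pos (by linarith))]

theorem lt_dist_ofReal_mul_I (hε : 0 < ε) (hδ : 0 < δ) {y : ℝ} (hy : |y| ≤ 1 + δ / 2) {c : ℂ}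
    (hc : c ∈ centers ε δ) (hL : c ≠ centerL ε δ 0) (hR : c ≠ centerR ε δ 0) :
    6 / 5 < dist (y * I) c := by
  obtain ⟨n, hn, him⟩ := exists_int_im_eq hc hL hR
  have hdist := le_abs_sub_intCast_mul hδ hy hn
  rw [lt_dist_iff (by norm_num), re_ofReal_mul, im_ofReal_mul, I_re, I_im, mul_zero, mul_one,
    zero_sub, neg_sq, ← sq_abs c.re, abs_re_of_mem_centers hε hc, ← sq_abs (y - c.im), him]
  nlinarith

theorem abs_im_sub_le_of_mem_narrowH (hz : z ∈ narrowH ε δ) :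
    |z.im - 1 - δ / 2| ≤ δ / 2 + 1 / 2 := by
  linarith [abs_le_of_narrow hz.1 hz.2, sq_lt_of_abs_lt_sqrt_three_div_two hz.2]

theorem le_sq_of_mem_narrowH (hδ : 0 < δ) (hz : z ∈ narrowH ε δ) {n : ℤ} (h0 : n ≠ 0)
    (h1 : n ≠ 1) : 25 / 4 ≤ (z.im - n * (2 + δ)) ^ 2 := by
  have him := abs_le.1 (abs_im_sub_le_of_mem_narrowH hz)
  rcases lt_or_gt_of_ne h0 with hn | hn
  · have hn' : (n : ℝ) ≤ -1 := by exact_mod_cast (by lia : n ≤ -1)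
    nlinarith [mul_nonneg (by linarith : 0 ≤ -1 - (n : ℝ)) (by linarith : 0 ≤ 2 + δ)]
  · have hn' : (2 : ℝ) ≤ n := by exact_mod_cast (by lia : 2 ≤ n)
    nlinarith [mul_nonneg (by linarith : 0 ≤ (n : ℝ) - 2) (by linarith : 0 ≤ 2 + δ)]

theorem abs_intCast_mul_sub_of_zero_or_one (hδ : 0 < δ) {n : ℤ} (hn : n = 0 ∨ n = 1) :
    |n * (2 + δ) - 1 - δ / 2| = 1 + δ / 2 := by
  rcases hn with rfl | rfl
  · rw [Int.cast_zero, zero_mul, abs_of_neg (by linarith)]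
    ring
  · rw [Int.cast_one, abs_of_pos (by linarith)]
    ring

theorem lt_dist_centerL_of_mem_narrowH (hε : 0 < ε) (hδ : 0 < δ) (hz : z ∈ narrowH ε δ) (n : ℤ) :
    6 / 5 < dist z (centerL ε δ n) := by
  rw [lt_dist_iff (by norm_num)]
  simp only [centerL]
  by_cases hn : n = 0 ∨ n = 1
  · have hfar := lt_sq_add_sq_of_narrow hz.1 hz.2 (abs_intCast_mul_sub_of_zero_or_one hδ hn)
      (t := -(2 + ε)) (by rw [abs_neg, abs_of_pos (by linarith)]; linarith)
    linarith
  · push Not at hn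
    linarith [le_sq_of_mem_narrowH hδ hz hn.1 hn.2, sq_nonneg (z.re - (-1 - ε / 2))]

theorem lt_dist_of_mem_narrowH (hε : 0 < ε) (hδ : 0 < δ) (hz : z ∈ narrowH ε δ) {c : ℂ}
    (hc : c ∈ centers ε δ) (h0 : c ≠ centerR ε δ 0) (h1 : c ≠ centerR ε δ 1) :
    6 / 5 < dist z c := by
  rcases hc with ⟨n, rfl⟩ | ⟨n, rfl⟩
  · exact lt_dist_centerL_of_mem_narrowH hε hδ hz n
  · have hfar := le_sq_of_mem_narrowH hδ hz (n := n) (fun h => h0 (by rw [h]))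
      (fun h => h1 (by rw [h]))
    rw [lt_dist_iff (by norm_num)]
    simp only [centerR]
    linarith [sq_nonneg (z.re - (1 + ε / 2))]

theorem narrowH_subset_exterior (hε : 0 < ε) (hδ : 0 < δ) : narrowH ε δ ⊆ exterior ε δ := by
  intro z hz
  rw [mem_exterior hδ]
  rintro c (⟨n, rfl⟩ | ⟨n, rfl⟩)
  · linarith [lt_dist_centerL_of_mem_narrowH hε hδ hz n]
  rw [one_lt_dist_iff]
  simp only [centerR]
  by_cases hn : n = 0 ∨ n = 1
  · linarith [one_sub_sq_lt_of_narrow hz.1 (abs_intCast_mul_sub_of_zero_or_one hδ hn)]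
  · push Not at hn
    linarith [le_sq_of_mem_narrowH hδ hz hn.1 hn.2, sq_nonneg (z.re - (1 + ε / 2))]

theorem abs_re_le_add_of_dist_le {y : ℂ} {r : ℝ} (h : dist y z ≤ r) : |y.re| ≤ |z.re| + r := by
  have hre := (abs_re_le_norm (y - z)).trans ((dist_eq y z).symm.trans_le h)
  rw [sub_re] at hre
  linarith [abs_sub_abs_le_abs_sub y.re z.re]

theorem abs_im_le_add_of_dist_le {y : ℂ} {r : ℝ} (h : dist y z ≤ r) : |y.im| ≤ |z.im| + r := by
  have him := (abs_im_le_norm (y - z)).trans ((dist_eq y z).symm.trans_le h)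
  rw [sub_im] at him
  linarith [abs_sub_abs_le_abs_sub y.im z.im]

theorem sub_one_mul_eq_centerL (ε δ : ℝ) : (0 - 1 * (1 + ε / 2 : ℝ) : ℂ) = centerL ε δ 0 := by
  apply Complex.ext <;> simp [centerL]
  ring

theorem add_one_mul_eq_centerR (ε δ : ℝ) : (0 + 1 * (1 + ε / 2 : ℝ) : ℂ) = centerR ε δ 0 := by
  apply Complex.ext <;> simp [centerR]

theorem isGap_narrowV (ε δ : ℝ) : IsGap ε δ ε 0 1 where
  norm_eq_one := norm_one
  sub_mem_centers := Or.inl ⟨0, (sub_one_mul_eq_centerL ε δ).symm⟩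
  add_mem_centers := Or.inr ⟨0, (add_one_mul_eq_centerR ε δ).symm⟩

/-- The midpoint of the gap between the disks `diskR ε δ 0` and `diskR ε δ 1`. -/
def midH (ε δ : ℝ) : ℂ := ⟨1 + ε / 2, 1 + δ / 2⟩

theorem midH_sub_I_mul : midH ε δ - I * (1 + δ / 2 : ℝ) = centerR ε δ 0 := by
  apply Complex.ext <;> simp [centerR, midH]

theorem midH_add_I_mul : midH ε δ + I * (1 + δ / 2 : ℝ) = centerR ε δ 1 := by
  apply Complex.ext <;> simp [centerR, midH]
  ring

theorem isGap_narrowH (ε δ : ℝ) : IsGap ε δ δ (midH ε δ) I where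
  norm_eq_one := norm_I
  sub_mem_centers := Or.inr ⟨0, midH_sub_I_mul.symm⟩
  add_mem_centers := Or.inr ⟨1, midH_add_I_mul.symm⟩

end

namespace PeriodicSolution

variable {ε δ a b cL cR : ℝ} {u : ℂ → ℝ}

theorem norm_gradient_sub_le_of_far (h : PeriodicSolution ε δ a b cL cR u) (hε : 0 < ε)
    (hδ : 0 < δ) {z : ℂ} (hz : z ∈ exterior ε δ)
    (hfar : ∀ c ∈ centers ε δ, c ≠ centerL ε δ 0 → c ≠ centerR ε δ 0 → 6 / 5 < dist z c) {M : ℝ}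
    (hM : ∀ y ∈ closedExterior ε δ, dist y z ≤ 1 / 5 → |u y - (cL + cR) / 2| ≤ M) :
    ‖gradient u z - (cR - cL : ℝ) * conj (gapDeriv ε z)‖ ≤
      gradConst (1 / 5) * (M + |cR - cL| / 2) := by
  have hgap := (isGap_narrowV ε δ).norm_gradient_sub_le (ρ := 1 / 5) (k := (cL + cR) / 2)
    (V := cR - cL) hδ hε
    (by norm_num) h.cont h.harmonic hz
    (fun y hy => by rw [h.left y (by rwa [← sub_one_mul_eq_centerL ε δ])]; ring)
    (fun y hy => by rw [h.right y (by rwa [← add_one_mul_eq_centerR ε δ])]; ring)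
    (fun c hc hL hR => by
      rw [sub_one_mul_eq_centerL ε δ] at hL
      rw [add_one_mul_eq_centerR ε δ] at hR
      linarith [hfar c hc hL hR]) hM
  rwa [gapCoord, inv_one, one_mul, one_mul, sub_zero] at hgap

theorem abs_sub_le_of_abs_le (h : PeriodicSolution ε δ a b cL cR u) (hε : 0 < ε) (hε1 : ε < 1)
    (hδ : 0 < δ) {y : ℂ} (hy : y ∈ closedExterior ε δ) {t : ℝ} (hre : |y.re| ≤ t)
    (him : |y.im| ≤ t) : |u y - (cL + cR) / 2| ≤ |cR - cL| / 2 + (3 + t) * (|a| + |b|) := by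
  have hH : |linearPotential a b y| ≤ |a| * t + |b| * t := by
    refine (abs_add_le _ _).trans ?_
    rw [abs_mul, abs_mul]
    gcongr
  calc |u y - (cL + cR) / 2|
      = |u y - linearPotential a b y - (cL + cR) / 2 + linearPotential a b y| := by congr 1; ring
    _ ≤ |u y - linearPotential a b y - (cL + cR) / 2| + |linearPotential a b y| := abs_add_le _ _
    _ ≤ |cR - cL| / 2 + (3 + t) * (|a| + |b|) := by
      linarith [h.abs_sub_linearPotential_le hε hε1 hδ hy]

theorem norm_gradient_sub_le (h : PeriodicSolution ε δ a b cL cR u) (hε : 0 < ε) (hε1 : ε < 1)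
    (hδ : 0 < δ) {z : ℂ} (hz : z ∈ exterior ε δ)
    (hfar : ∀ c ∈ centers ε δ, c ≠ centerL ε δ 0 → c ≠ centerR ε δ 0 → 6 / 5 < dist z c)
    (hre : |z.re| ≤ 9 / 5) (him : |z.im| ≤ 9 / 5) :
    ‖gradient u z - (cR - cL : ℝ) * conj (gapDeriv ε z)‖ ≤
      gradConst (1 / 5) * (|cR - cL| + 5 * (|a| + |b|)) := by
  refine (h.norm_gradient_sub_le_of_far hε hδ hz hfar
    (M := |cR - cL| / 2 + 5 * (|a| + |b|)) fun y hy hd => ?_).trans (le_of_eq (by ring))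
  refine (h.abs_sub_le_of_abs_le hε hε1 hδ hy (t := 2) ?_ ?_).trans (le_of_eq (by ring))
  · linarith [abs_re_le_add_of_dist_le hd]
  · linarith [abs_im_le_add_of_dist_le hd]

theorem abs_sub_right_le_of_abs_le (h : PeriodicSolution ε δ a b cL cR u) (hε : 0 < ε)
    (hε1 : ε < 1) (hδ : 0 < δ) (hδ1 : δ < 1) {y : ℂ} (hy : y ∈ closedExterior ε δ)
    (hre : |y.re| ≤ 3) (him : |y.im| ≤ 3) :
    |u y - (cR + b * (2 + δ) / 2)| ≤ |cR - cL| + 8 * (|a| + |b|) := by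
  have hb : |b * (2 + δ) / 2| ≤ 2 * |b| := by
    rw [abs_div, abs_mul, abs_two, abs_of_pos (by linarith : 0 < 2 + δ)]
    nlinarith [abs_nonneg b]
  calc |u y - (cR + b * (2 + δ) / 2)|
      = |u y - (cL + cR) / 2 - (cR - cL) / 2 - b * (2 + δ) / 2| := by congr 1; ring
    _ ≤ |u y - (cL + cR) / 2| + |(cR - cL) / 2| + |b * (2 + δ) / 2| :=
      (abs_sub _ _).trans (by gcongr; exact abs_sub _ _)
    _ ≤ |cR - cL| / 2 + (3 + 3) * (|a| + |b|) + |cR - cL| / 2 + 2 * |b| := by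
      rw [abs_div _ 2, abs_two]
      gcongr
      exact h.abs_sub_le_of_abs_le hε hε1 hδ hy hre him
    _ ≤ |cR - cL| + 8 * (|a| + |b|) := by linarith [abs_nonneg a]

theorem norm_gradient_sub_le_of_mem_narrowH (h : PeriodicSolution ε δ a b cL cR u) (hε : 0 < ε)
    (hε1 : ε < 1) (hδ : 0 < δ) (hδ1 : δ < 1) {z : ℂ} (hz : z ∈ narrowH ε δ) :
    ‖gradient u z - (b * (2 + δ) : ℝ) * (I * conj (gapDeriv δ (gapCoord (midH ε δ) I z)))‖ ≤
      gradConst (1 / 5) * (|cR - cL| + 10 * (|a| + |b|)) := by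
  have hre : |z.re| ≤ 14 / 5 := by
    have hlt := abs_lt.1 (hz.2.trans sqrt_three_div_two_lt)
    exact abs_le.2 ⟨by linarith, by linarith⟩
  have him : |z.im| ≤ 14 / 5 := by
    have hle := abs_le.1 (abs_im_sub_le_of_mem_narrowH hz)
    exact abs_le.2 ⟨by linarith, by linarith⟩
  have hgap := (isGap_narrowH ε δ).norm_gradient_sub_le (ρ := 1 / 5) (k := cR + b * (2 + δ) / 2)
    (V := b * (2 + δ)) (M := |cR - cL| + 8 * (|a| + |b|)) hδ hδ (by norm_num) h.cont h.harmonic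
    (narrowH_subset_exterior hε hδ hz)
    (fun y hy => by rw [h.right y (by rwa [← midH_sub_I_mul])]; ring)
    (fun y hy => by
      rw [h.eq_right hε hδ (by rwa [← midH_add_I_mul]), Int.cast_one]
      ring)
    (fun c hc h0 h1 => by
      rw [midH_sub_I_mul] at h0
      rw [midH_add_I_mul] at h1
      linarith [lt_dist_of_mem_narrowH hε hδ hz hc h0 h1])
    (fun y hy hd => h.abs_sub_right_le_of_abs_le hε hε1 hδ hδ1 hy
      (by linarith [abs_re_le_add_of_dist_le hd]) (by linarith [abs_im_le_add_of_dist_le hd]))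
  refine hgap.trans (mul_le_mul_of_nonneg_left ?_ (gradConst_pos (by norm_num)).le)
  rw [abs_mul, abs_of_pos (by linarith : 0 < 2 + δ)]
  nlinarith [abs_nonneg a, abs_nonneg b]

end PeriodicSolution

/-! ### The potential difference of the two rows -/

/-- The flux of `gapFun ε` through the segment from `-t * I` to `t * I`. -/
def gapFlux (ε t : ℝ) : ℝ := 4 / logGap ε * Real.arctan (t / pole ε)

section

variable {ε : ℝ}

theorem gapDeriv_ofReal_mul_I (ε y : ℝ) :
    gapDeriv ε (y * I) = (2 * pole ε / logGap ε / (pole ε ^ 2 + y ^ 2) : ℝ) := by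
  rw [gapDeriv, mul_pow, I_sq]
  push_cast
  congr 1
  ring

theorem continuous_re_gapDeriv_ofReal_mul_I (hε : 0 < ε) :
    Continuous fun y : ℝ => 2 * pole ε / logGap ε / (pole ε ^ 2 + y ^ 2) :=
  have hp := pole_pos hε
  continuous_const.div (by fun_prop) fun y => by positivity

theorem integral_re_gapDeriv_ofReal_mul_I (hε : 0 < ε) (t : ℝ) :
    ∫ y in (-t)..t, 2 * pole ε / logGap ε / (pole ε ^ 2 + y ^ 2) = gapFlux ε t := by
  have hp := pole_pos hε
  have hlog := logGap_pos hε
  have hderiv : ∀ y : ℝ, HasDerivAt (fun y => 2 / logGap ε * Real.arctan (y / pole ε))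
      (2 * pole ε / logGap ε / (pole ε ^ 2 + y ^ 2)) y := fun y => by
    refine (((hasDerivAt_id y).div_const (pole ε)).arctan.const_mul (2 / logGap ε)).congr_deriv ?_
    simp only [id]
    field_simp
  rw [intervalIntegral.integral_eq_sub_of_hasDerivAt (fun y _ => hderiv y)
    ((continuous_re_gapDeriv_ofReal_mul_I hε).intervalIntegrable _ _), neg_div, Real.arctan_neg,
    gapFlux]
  ring

theorem sqrt_le_pole (ε : ℝ) : √ε ≤ pole ε := Real.sqrt_le_sqrt (by linarith [sq_nonneg ε])

theorem pole_le (hε : 0 < ε) (hε1 : ε < 1) : pole ε ≤ 2 * √ε := by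
  rw [pole, Real.sqrt_le_left (by positivity), mul_pow, Real.sq_sqrt hε.le]
  nlinarith

theorem le_gapFlux {t : ℝ} (hε : 0 < ε) (hε1 : ε < 1 / 2) (ht : 1 ≤ t) :
    1 / (2 * √ε) ≤ gapFlux ε t := by
  have hp := pole_pos hε
  have hlog := logGap_pos hε
  have hp1 : pole ε ≤ 1 := by nlinarith [pole_sq hε]
  have harctan : Real.pi / 4 ≤ Real.arctan (t / pole ε) := by
    rw [← Real.arctan_one]
    exact Real.arctan_strictMono.monotone (by rw [one_le_div hp]; linarith)
  calc 1 / (2 * √ε) ≤ 1 / pole ε := by gcongr; exact pole_le hε (by linarith)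
    _ = 4 / (3 * pole ε) * (3 / 4) := by field_simp
    _ ≤ 4 / logGap ε * Real.arctan (t / pole ε) := by
      gcongr
      · nlinarith [logGap_le hε]
      · linarith [Real.pi_gt_three]

theorem gapFlux_le (hε : 0 < ε) (hε1 : ε < 1) (t : ℝ) : gapFlux ε t ≤ 8 / √ε := by
  have hp := pole_pos hε
  have hlog := logGap_pos hε
  have harctan := Real.arctan_lt_pi_div_two (t / pole ε)
  calc 4 / logGap ε * Real.arctan (t / pole ε) ≤ 4 / logGap ε * 2 := by
        gcongr
        linarith [Real.pi_le_four]
    _ ≤ 4 / (4 * pole ε / 4) * 2 := by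
        gcongr
        exact le_trans (by gcongr; linarith) (le_logGap hε)
    _ = 8 / pole ε := by field_simp; norm_num
    _ ≤ 8 / √ε := by gcongr; exact sqrt_le_pole ε

end

/-- The constant in the bound of the potential difference of the two rows by
`√ε * (|a| + |b|)`. -/
def gapConst : ℝ := 4 * (3 + 15 * gradConst (1 / 5))

theorem twelve_lt_gapConst : 12 < gapConst := by
  have hG := gradConst_pos (ρ := 1 / 5) (by norm_num)
  rw [gapConst]
  linarith

namespace PeriodicSolution

variable {ε δ a b cL cR : ℝ} {u : ℂ → ℝ}

theorem abs_flux_sub_le (h : PeriodicSolution ε δ a b cL cR u) (hε : 0 < ε)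
    (hδ : 0 < δ) {M : ℝ}
    (hM : ∀ y ∈ closedExterior ε δ, |y.re| ≤ 1 / 5 → |y.im| ≤ 6 / 5 + δ / 2 →
      |u y - (cL + cR) / 2| ≤ M) :
    |a * (2 + δ) - (cR - cL) * gapFlux ε (1 + δ / 2)| ≤
      gradConst (1 / 5) * (M + |cR - cL| / 2) * (2 + δ) := by
  rw [← h.flux, ← integral_re_gapDeriv_ofReal_mul_I hε, ← intervalIntegral.integral_const_mul,
    ← intervalIntegral.integral_sub ((h.continuous_fderiv_one hε hδ).intervalIntegrable _ _)
      (((continuous_re_gapDeriv_ofReal_mul_I hε).const_mul _).intervalIntegrable _ _),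
    ← Real.norm_eq_abs]
  refine (intervalIntegral.norm_integral_le_of_norm_le_const
    (C := gradConst (1 / 5) * (M + |cR - cL| / 2)) fun y hy => ?_).trans_eq ?_
  · rw [uIoc_of_le (by linarith)] at hy
    have hy' : |y| ≤ 1 + δ / 2 := abs_le.2 ⟨hy.1.le, hy.2⟩
    have hgrad := h.norm_gradient_sub_le_of_far hε hδ (ofReal_mul_I_mem_exterior hε hδ y)
      (fun c hc => lt_dist_ofReal_mul_I hε hδ hy' hc) (M := M) fun w hw hd => by
        have hre := abs_re_le_add_of_dist_le hd
        have him := abs_im_le_add_of_dist_le hd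
        rw [re_ofReal_mul, I_re, mul_zero, abs_zero] at hre
        rw [im_ofReal_mul, I_im, mul_one] at him
        exact hM w hw (by linarith) (by linarith)
    refine le_trans (le_of_eq ?_) ((abs_re_le_norm _).trans hgrad)
    rw [gapDeriv_ofReal_mul_I, conj_ofReal, ← ofReal_mul, sub_re, ofReal_re, gradient_eq_fderiv]
    simp
  · have hlen : 1 + δ / 2 - -(1 + δ / 2) = 2 + δ := by ring
    rw [hlen, abs_of_pos (by linarith : 0 < 2 + δ)]

theorem abs_sub_le_gapConst_mul (h : PeriodicSolution ε δ a b cL cR u) (hε : 0 < ε)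
    (hε1 : ε < 1 / 2) (hδ : 0 < δ) (hδ1 : δ < 1) (hG : 12 * gradConst (1 / 5) * √ε ≤ 1) :
    |cR - cL| ≤ gapConst * √ε * (|a| + |b|) := by
  rw [gapConst]
  have hG0 := gradConst_pos (ρ := 1 / 5) (by norm_num)
  set G := gradConst (1 / 5)
  set V := |cR - cL|
  have hs : 0 < √ε := Real.sqrt_pos.2 hε
  have hgap := le_gapFlux (t := 1 + δ / 2) hε hε1 (by linarith)
  have hgap0 : 0 < gapFlux ε (1 + δ / 2) := lt_of_lt_of_le (by positivity) hgap
  have hflux := h.abs_flux_sub_le hε hδ (M := V / 2 + 5 * (|a| + |b|)) fun y hy hr hi =>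
    (h.abs_sub_le_of_abs_le hε (by linarith) hδ hy (t := 2) (by linarith) (by linarith)).trans_eq
      (by ring)
  have hmul : V * gapFlux ε (1 + δ / 2) ≤ (|a| + G * (V + 5 * (|a| + |b|))) * 3 :=
    calc V * gapFlux ε (1 + δ / 2) = |(cR - cL) * gapFlux ε (1 + δ / 2)| := by
          rw [abs_mul, abs_of_pos hgap0]
      _ ≤ |a * (2 + δ)| + |a * (2 + δ) - (cR - cL) * gapFlux ε (1 + δ / 2)| := by
          rw [abs_sub_comm (a * _)]
          linarith [abs_sub_abs_le_abs_sub ((cR - cL) * gapFlux ε (1 + δ / 2)) (a * (2 + δ))]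
      _ ≤ |a| * (2 + δ) + G * (V / 2 + 5 * (|a| + |b|) + V / 2) * (2 + δ) := by
          rw [abs_mul, abs_of_pos (by linarith : 0 < 2 + δ)]
          gcongr
      _ = (|a| + G * (V + 5 * (|a| + |b|))) * (2 + δ) := by ring
      _ ≤ (|a| + G * (V + 5 * (|a| + |b|))) * 3 := by gcongr; linarith
  have hV' : V * (1 / (2 * √ε)) ≤ (|a| + G * (V + 5 * (|a| + |b|))) * 3 :=
    (mul_le_mul_of_nonneg_left hgap (abs_nonneg _)).trans hmul
  rw [mul_one_div, div_le_iff₀ (by positivity)] at hV'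
  have habsorb : V * (12 * G * √ε) ≤ V * 1 := by gcongr
  nlinarith [mul_nonneg (abs_nonneg b) hs.le]

theorem sqrt_div_eight_le_sub (h : PeriodicSolution ε δ 1 0 cL cR u) (hε : 0 < ε)
    (hε1 : ε < 1 / 2) (hδ : 0 < δ) {η : ℝ} (hη : gradConst (1 / 5) * (|cR - cL| + η) ≤ 1 / 2)
    (hM : ∀ y ∈ closedExterior ε δ, |y.re| ≤ 1 / 5 → |u y - (cL + cR) / 2| ≤ |cR - cL| / 2 + η) :
    √ε / 8 ≤ cR - cL := by
  have hs : 0 < √ε := Real.sqrt_pos.2 hε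
  have hgap0 : 0 < gapFlux ε (1 + δ / 2) :=
    lt_of_lt_of_le (by positivity) (le_gapFlux hε hε1 (by linarith))
  have hone : 1 ≤ (cR - cL) * gapFlux ε (1 + δ / 2) := by
    have hflux := (abs_le.1 (h.abs_flux_sub_le hε hδ (M := |cR - cL| / 2 + η)
      fun y hy hr _ => hM y hy hr)).2
    have hsum : |cR - cL| / 2 + η + |cR - cL| / 2 = |cR - cL| + η := by ring
    rw [hsum] at hflux
    linarith [mul_le_mul_of_nonneg_right hη (by linarith : 0 ≤ 2 + δ)]
  have hV : 0 < cR - cL := pos_of_mul_pos_left (by linarith) hgap0.le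
  have hle : 1 ≤ (cR - cL) * (8 / √ε) :=
    hone.trans (by gcongr; exact gapFlux_le hε (by linarith) _)
  rw [mul_div_assoc', le_div_iff₀ hs] at hle
  linarith

end PeriodicSolution

/-! ### Screening by a row of disks -/

theorem cosh_re_eq (ζ : ℂ) : (cosh ζ).re = Real.cosh ζ.re * Real.cos ζ.im := by
  conv_lhs => rw [← re_add_im ζ]
  rw [cosh_add, cosh_mul_I, sinh_mul_I, ← ofReal_cosh, ← ofReal_sinh, ← ofReal_cos, ← ofReal_sin]
  simp only [add_re, ← ofReal_mul, ← mul_assoc, ofReal_re, re_ofReal_mul, I_re, mul_zero, add_zero]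

theorem half_le_cos {x : ℝ} (hx : |x| ≤ 1) : 1 / 2 ≤ Real.cos x := by
  linarith [Real.one_sub_sq_div_two_le_cos (x := x), (sq_le_one_iff_abs_le_one x).2 hx]

theorem sq_div_four_le_cosh {x : ℝ} (hx : 0 ≤ x) : x ^ 2 / 4 ≤ Real.cosh x := by
  rw [Real.cosh_eq]
  linarith [Real.quadratic_le_exp_of_nonneg hx, Real.exp_pos (-x)]

theorem isCompact_abs_re_sub_le_abs_im_sub_le (m : ℂ) (s t : ℝ) :
    IsCompact {y : ℂ | |y.re - m.re| ≤ s ∧ |y.im - m.im| ≤ t} := by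
  convert (isCompact_closedBall m.re s).reProdIm (isCompact_closedBall m.im t) using 1
  ext y
  simp only [mem_ofPred_eq, mem_reProdIm, mem_closedBall, Real.dist_eq]

theorem isOpen_abs_re_sub_lt_abs_im_sub_lt (m : ℂ) (s t : ℝ) :
    IsOpen {y : ℂ | |y.re - m.re| < s ∧ |y.im - m.im| < t} :=
  (isOpen_lt (f := fun y : ℂ => |y.re - m.re|) (by fun_prop) continuous_const).and
    (isOpen_lt (f := fun y : ℂ => |y.im - m.im|) (by fun_prop) continuous_const)

/-- The harmonic barrier `cosh (κ x) * cos (κ y)`, where `x + i y` is the position relative to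
`m`. -/
def coshBarrier (κ : ℝ) (m z : ℂ) : ℝ := (cosh (κ * (z - m))).re

theorem coshBarrier_eq (κ : ℝ) (m z : ℂ) :
    coshBarrier κ m z = Real.cosh (κ * (z.re - m.re)) * Real.cos (κ * (z.im - m.im)) := by
  rw [coshBarrier, cosh_re_eq, re_ofReal_mul, im_ofReal_mul, sub_re, sub_im]

theorem harmonicAt_coshBarrier (κ : ℝ) (m z : ℂ) : HarmonicAt (coshBarrier κ m) z :=
  AnalyticAt.harmonicAt_re (f := fun z => cosh (κ * (z - m))) (by fun_prop)

section

variable {ε δ s M : ℝ} {m z : ℂ} {w : ℂ → ℝ}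

theorem abs_im_sub_le_of_gap (h₁ : m - (1 + δ / 2 : ℝ) * I ∈ centers ε δ)
    (h₂ : m + (1 + δ / 2 : ℝ) * I ∈ centers ε δ) (hz : z ∈ closedExterior ε δ)
    (hre : |z.re - m.re| ≤ s) (him : |z.im - m.im| ≤ 1 + δ / 2) :
    |z.im - m.im| ≤ δ / 2 + s ^ 2 := by
  have hdist₁ := one_le_dist_iff.1 (hz _ h₁)
  have hdist₂ := one_le_dist_iff.1 (hz _ h₂)
  simp only [sub_re, add_re, sub_im, add_im, re_ofReal_mul, im_ofReal_mul, I_re, I_im,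
    mul_zero, mul_one, sub_zero, add_zero] at hdist₁ hdist₂
  have hx : (z.re - m.re) ^ 2 ≤ s ^ 2 := by rw [← sq_abs]; gcongr
  have hdist : 1 ≤ s ^ 2 + (1 + δ / 2 - |z.im - m.im|) ^ 2 := by
    rcases abs_cases (z.im - m.im) with ⟨h, -⟩ | ⟨h, -⟩ <;> rw [h] <;> nlinarith
  by_contra! hlt
  have hsq : (1 + δ / 2 - |z.im - m.im|) ^ 2 < (1 - s ^ 2) ^ 2 := by
    apply sq_lt_sq' <;> linarith
  nlinarith

theorem half_le_cos_of_gap (hs : 0 < s) (hδs : δ ≤ 2 * s ^ 2)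
    (h₁ : m - (1 + δ / 2 : ℝ) * I ∈ centers ε δ) (h₂ : m + (1 + δ / 2 : ℝ) * I ∈ centers ε δ)
    (hz : z ∈ closedExterior ε δ) (hre : |z.re - m.re| ≤ s) (him : |z.im - m.im| ≤ 1 + δ / 2) :
    1 / 2 ≤ Real.cos (1 / (2 * s ^ 2) * (z.im - m.im)) := by
  apply half_le_cos
  rw [abs_mul, abs_of_pos (by positivity), one_div_mul_eq_div, div_le_one (by positivity)]
  linarith [abs_im_sub_le_of_gap h₁ h₂ hz hre him]

theorem le_coshBarrier_of_gap (hδ : 0 < δ) (hs : 0 < s) (hs1 : s < 1) (hδs : δ ≤ 2 * s ^ 2)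
    (hM0 : 0 ≤ M) (h₁ : m - (1 + δ / 2 : ℝ) * I ∈ centers ε δ)
    (h₂ : m + (1 + δ / 2 : ℝ) * I ∈ centers ε δ) (hcont : ContinuousOn w (closedExterior ε δ))
    (hharm : HarmonicOnNhd w (exterior ε δ))
    (hzero : ∀ z ∈ closedExterior ε δ, z ∉ exterior ε δ → |z.re - m.re| ≤ s → w z = 0)
    (hM : ∀ z ∈ closedExterior ε δ, |z.re - m.re| ≤ s → |z.im - m.im| ≤ 1 + δ / 2 → w z ≤ M)
    (hz : z ∈ closedExterior ε δ) (hre : |z.re - m.re| ≤ s) (him : |z.im - m.im| ≤ 1 + δ / 2) :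
    w z ≤ 2 * M / Real.cosh (1 / (2 * s ^ 2) * s) * coshBarrier (1 / (2 * s ^ 2)) m z := by
  set κ : ℝ := 1 / (2 * s ^ 2)
  set A : ℝ := 2 * M / Real.cosh (κ * s) with hA
  have hκ : 0 < κ := by positivity
  set B : Set ℂ := {y | |y.re - m.re| ≤ s ∧ |y.im - m.im| ≤ 1 + δ / 2}
  set U : Set ℂ := exterior ε δ ∩ {y | |y.re - m.re| < s ∧ |y.im - m.im| < 1 + δ / 2}
  have hbd : ∀ y ∈ closedExterior ε δ ∩ B, y ∉ U → w y ≤ A * coshBarrier κ m y := by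
    rintro y ⟨hyK, hyr, hyi⟩ hyU
    have hcos : 1 / 2 ≤ Real.cos (κ * (y.im - m.im)) :=
      half_le_cos_of_gap hs hδs h₁ h₂ hyK hyr hyi
    rw [coshBarrier_eq]
    by_cases hyE : y ∈ exterior ε δ
    · have hys : |y.re - m.re| = s := by
        refine le_antisymm hyr (not_lt.1 fun hlt => hyU ⟨hyE, hlt, ?_⟩)
        nlinarith [abs_im_sub_le_of_gap h₁ h₂ hyK hyr hyi]
      calc w y ≤ 2 * M * Real.cos (κ * (y.im - m.im)) := by nlinarith [hM y hyK hyr hyi]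
        _ = A * (Real.cosh (κ * |y.re - m.re|) * Real.cos (κ * (y.im - m.im))) := by
          rw [hys, hA]; field_simp
        _ = A * (Real.cosh (κ * (y.re - m.re)) * Real.cos (κ * (y.im - m.im))) := by
          rw [← Real.cosh_abs (κ * (y.re - m.re)), abs_mul, abs_of_pos hκ]
    · rw [hzero y hyK hyE hyr]
      positivity
  have hmax := le_of_harmonicOnNhd_of_compact_representatives (P := closedExterior ε δ ∩ B)
    (U := U) (C₀ := closedExterior ε δ ∩ B) (w := w - A • coshBarrier κ m) (m := 0)
    ((isOpen_exterior ε δ).inter (isOpen_abs_re_sub_lt_abs_im_sub_lt m s (1 + δ / 2)))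
    (fun y hy => ⟨exterior_subset_closedExterior hδ hy.1, hy.2.1.le, hy.2.2.le⟩)
    ((isCompact_abs_re_sub_le_abs_im_sub_le m s _).inter_left (isClosed_closedExterior ε δ))
    subset_rfl
    ((hcont.mono inter_subset_left).sub (ContinuousOn.const_smul (fun y _ =>
      (harmonicAt_coshBarrier κ m y).1.continuousAt.continuousWithinAt) A))
    ((hharm.mono inter_subset_left).sub
      (HarmonicOnNhd.const_smul fun y _ => harmonicAt_coshBarrier κ m y))
    (fun y hy => ⟨y, hy, rfl, rfl⟩) (fun y hy hyU => sub_nonpos.2 (hbd y hy hyU))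
  exact sub_nonpos.1 (hmax z ⟨hz, hre, him⟩)

/-- A harmonic function that vanishes on the disks decays exponentially from the mouth of a gap,
whose width is comparable to `s ^ 2`, to its waist, at distance `s` from the mouth. -/
theorem le_of_gap (hδ : 0 < δ) (hs : 0 < s) (hs1 : s < 1) (hδs : δ ≤ 2 * s ^ 2)
    (hM0 : 0 ≤ M) (h₁ : m - (1 + δ / 2 : ℝ) * I ∈ centers ε δ)
    (h₂ : m + (1 + δ / 2 : ℝ) * I ∈ centers ε δ) (hcont : ContinuousOn w (closedExterior ε δ))
    (hharm : HarmonicOnNhd w (exterior ε δ))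
    (hzero : ∀ z ∈ closedExterior ε δ, z ∉ exterior ε δ → |z.re - m.re| ≤ s → w z = 0)
    (hM : ∀ z ∈ closedExterior ε δ, |z.re - m.re| ≤ s → |z.im - m.im| ≤ 1 + δ / 2 → w z ≤ M)
    (hz : z ∈ closedExterior ε δ) (hre : z.re = m.re) (him : |z.im - m.im| ≤ 1 + δ / 2) :
    w z ≤ 32 * M * s ^ 2 := by
  set κ : ℝ := 1 / (2 * s ^ 2) with hκ
  have hch : 0 < Real.cosh (κ * s) := Real.cosh_pos _
  have hcosh : 1 ≤ Real.cosh (κ * s) * (16 * s ^ 2) :=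
    calc 1 = (κ * s) ^ 2 / 4 * (16 * s ^ 2) := by rw [hκ]; field_simp; norm_num
      _ ≤ Real.cosh (κ * s) * (16 * s ^ 2) := by
        gcongr
        exact sq_div_four_le_cosh (by positivity)
  calc w z ≤ 2 * M / Real.cosh (κ * s) * coshBarrier κ m z :=
        le_coshBarrier_of_gap hδ hs hs1 hδs hM0 h₁ h₂ hcont hharm hzero hM hz
          (by rw [hre, sub_self, abs_zero]; exact hs.le) him
    _ ≤ 2 * M / Real.cosh (κ * s) * 1 := by
        gcongr
        rw [coshBarrier_eq, hre, sub_self, mul_zero, Real.cosh_zero, one_mul]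
        exact Real.cos_le_one _
    _ ≤ 32 * M * s ^ 2 := by
        rw [mul_one, div_le_iff₀ hch]
        nlinarith

theorem abs_le_of_gap (hδ : 0 < δ) (hs : 0 < s) (hs1 : s < 1) (hδs : δ ≤ 2 * s ^ 2)
    (hM0 : 0 ≤ M) (h₁ : m - (1 + δ / 2 : ℝ) * I ∈ centers ε δ)
    (h₂ : m + (1 + δ / 2 : ℝ) * I ∈ centers ε δ) (hcont : ContinuousOn w (closedExterior ε δ))
    (hharm : HarmonicOnNhd w (exterior ε δ))
    (hzero : ∀ z ∈ closedExterior ε δ, z ∉ exterior ε δ → |z.re - m.re| ≤ s → w z = 0)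
    (hM : ∀ z ∈ closedExterior ε δ, |z.re - m.re| ≤ s → |w z| ≤ M)
    (hz : z ∈ closedExterior ε δ) (hre : z.re = m.re) (him : |z.im - m.im| ≤ 1 + δ / 2) :
    |w z| ≤ 32 * M * s ^ 2 := by
  refine abs_le'.2 ⟨?_, ?_⟩
  · exact le_of_gap hδ hs hs1 hδs hM0 h₁ h₂ hcont hharm hzero
      (fun y hy hr _ => (abs_le'.1 (hM y hy hr)).1) hz hre him
  · exact le_of_gap (w := -w) hδ hs hs1 hδs hM0 h₁ h₂ hcont.neg hharm.neg
      (fun y hy hyE hr => by rw [Pi.neg_apply, hzero y hy hyE hr, neg_zero])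
      (fun y hy hr _ => (abs_le'.1 (hM y hy hr)).2) hz hre him

theorem exists_gap_center (hδ : 0 < δ) (y : ℝ) :
    ∃ n : ℤ, |y - (2 * n + 1) * (1 + δ / 2)| ≤ 1 + δ / 2 := by
  obtain ⟨n, hn⟩ := exists_period_abs_im_le hδ ⟨0, y - (1 + δ / 2)⟩
  refine ⟨-n, ?_⟩
  convert hn using 2
  simp
  ring

theorem abs_le_of_row {x : ℝ} (hδ : 0 < δ) (hs : 0 < s) (hs1 : s < 1) (hδs : δ ≤ 2 * s ^ 2)
    (hM0 : 0 ≤ M) (hrow : ∀ n : ℤ, (⟨x, n * (2 + δ)⟩ : ℂ) ∈ centers ε δ)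
    (hcont : ContinuousOn w (closedExterior ε δ)) (hharm : HarmonicOnNhd w (exterior ε δ))
    (hzero : ∀ z ∈ closedExterior ε δ, z ∉ exterior ε δ → |z.re - x| ≤ s → w z = 0)
    (hM : ∀ z ∈ closedExterior ε δ, |z.re - x| ≤ s → |w z| ≤ M)
    (hz : z ∈ closedExterior ε δ) (hre : z.re = x) : |w z| ≤ 32 * M * s ^ 2 := by
  obtain ⟨n, hn⟩ := exists_gap_center hδ z.im
  refine abs_le_of_gap (m := ⟨x, (2 * n + 1) * (1 + δ / 2)⟩) hδ hs hs1 hδs hM0 ?_ ?_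
    hcont hharm hzero hM hz hre hn
  · convert hrow n using 1
    apply Complex.ext <;> simp
    ring
  · convert hrow (n + 1) using 1
    apply Complex.ext <;> simp
    ring

end

namespace PeriodicSolution

variable {ε δ a cL cR s : ℝ} {u : ℂ → ℝ} {z : ℂ}

theorem abs_sub_le_of_abs_re_le_three (h : PeriodicSolution ε δ a 0 cL cR u) (hε : 0 < ε)
    (hε1 : ε < 1) (hδ : 0 < δ) (hz : z ∈ closedExterior ε δ) (hre : |z.re| ≤ 3) :
    |u z - (cL + cR) / 2| ≤ |cR - cL| / 2 + 6 * |a| := by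
  have hH : |linearPotential a 0 z| ≤ |a| * 3 := by
    rw [linearPotential, zero_mul, add_zero, abs_mul]
    gcongr
  have hsub := h.abs_sub_linearPotential_le hε hε1 hδ hz
  rw [abs_zero, add_zero] at hsub
  calc |u z - (cL + cR) / 2|
      = |u z - linearPotential a 0 z - (cL + cR) / 2 + linearPotential a 0 z| := by congr 1; ring
    _ ≤ |u z - linearPotential a 0 z - (cL + cR) / 2| + |linearPotential a 0 z| := abs_add_le _ _
    _ ≤ |cR - cL| / 2 + 6 * |a| := by linarith

theorem abs_sub_le_of_row (h : PeriodicSolution ε δ a 0 cL cR u) (hε : 0 < ε) (hε1 : ε < 1)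
    (hδ : 0 < δ) (hs : 0 < s) (hs1 : s < 1) (hδs : δ ≤ 2 * s ^ 2) {x k : ℝ}
    (hx : |x| = 1 + ε / 2) (hrow : ∀ n : ℤ, (⟨x, n * (2 + δ)⟩ : ℂ) ∈ centers ε δ)
    (hk : ∀ y ∈ closedExterior ε δ, y ∉ exterior ε δ → |y.re - x| ≤ s → u y = k)
    (hkV : |k - (cL + cR) / 2| = |cR - cL| / 2) (hz : z ∈ closedExterior ε δ) (hre : z.re = x) :
    |u z - (cL + cR) / 2| ≤ |cR - cL| / 2 + 32 * (|cR - cL| + 6 * |a|) * s ^ 2 := by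
  have hM : ∀ y ∈ closedExterior ε δ, |y.re - x| ≤ s → |u y - k| ≤ |cR - cL| + 6 * |a| := by
    intro y hy hr
    have hle := h.abs_sub_le_of_abs_re_le_three hε hε1 hδ hy
      (by linarith [abs_sub_abs_le_abs_sub y.re x])
    have hsub := abs_sub (u y - (cL + cR) / 2) (k - (cL + cR) / 2)
    rw [sub_sub_sub_cancel_right] at hsub
    linarith
  have hscreen : |u z - k| ≤ 32 * (|cR - cL| + 6 * |a|) * s ^ 2 :=
    abs_le_of_row (w := u - fun _ => k) hδ hs hs1 hδs (by positivity) hrow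
      (h.cont.sub continuousOn_const) (h.harmonic.sub fun y _ => by simp)
      (fun y hy hyE hr => sub_eq_zero.2 (hk y hy hyE hr)) hM hz hre
  have hadd := abs_add_le (u z - k) (k - (cL + cR) / 2)
  rw [sub_add_sub_cancel] at hadd
  linarith

theorem abs_sub_le_of_abs_re_eq (h : PeriodicSolution ε δ a 0 cL cR u) (hε : 0 < ε) (hε1 : ε < 1)
    (hδ : 0 < δ) (hs : 0 < s) (hs1 : s < 1) (hδs : δ ≤ 2 * s ^ 2)
    (hz : z ∈ closedExterior ε δ) (hre : |z.re| = 1 + ε / 2) :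
    |u z - (cL + cR) / 2| ≤ |cR - cL| / 2 + 32 * (|cR - cL| + 6 * |a|) * s ^ 2 := by
  have hside : ∀ y c : ℂ, dist y c = 1 → |y.re - c.re| ≤ 1 := fun y c hd => by
    rw [← hd, dist_eq, ← sub_re]
    exact abs_re_le_norm _
  rcases eq_or_eq_neg_of_abs_eq hre with hre' | hre'
  · refine h.abs_sub_le_of_row hε hε1 hδ hs hs1 hδs (k := cR) (abs_of_pos (by linarith))
      (fun n => Or.inr ⟨n, rfl⟩) (fun y hy hyE hr => ?_) ?_ hz hre'
    · obtain ⟨c, ⟨n, rfl⟩ | ⟨n, rfl⟩, hd⟩ := exists_center_of_mem_diff hδ hy hyE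
      · have hleft := abs_le.1 (hside _ _ hd)
        simp only [centerL] at hleft
        linarith [(abs_le.1 hr).1]
      · rw [h.eq_right hε hδ hd]
        ring
    · rw [show cR - (cL + cR) / 2 = (cR - cL) / 2 by ring, abs_div, abs_two]
  · refine h.abs_sub_le_of_row hε hε1 hδ hs hs1 hδs (k := cL)
      (by rw [abs_neg, abs_of_pos (by linarith)])
      (fun n => Or.inl ⟨n, by rw [centerL, neg_add']⟩) (fun y hy hyE hr => ?_) ?_ hz hre'
    · obtain ⟨c, ⟨n, rfl⟩ | ⟨n, rfl⟩, hd⟩ := exists_center_of_mem_diff hδ hy hyE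
      · rw [h.eq_left hε hδ hd]
        ring
      · have hright := abs_le.1 (hside _ _ hd)
        simp only [centerR] at hright
        linarith [(abs_le.1 hr).2]
    · rw [show cL - (cL + cR) / 2 = -((cR - cL) / 2) by ring, abs_neg, abs_div, abs_two]

theorem abs_sub_le_of_abs_re_le (h : PeriodicSolution ε δ a 0 cL cR u) (hε : 0 < ε) (hε1 : ε < 1)
    (hδ : 0 < δ) (hs : 0 < s) (hs1 : s < 1) (hδs : δ ≤ 2 * s ^ 2)
    (hz : z ∈ closedExterior ε δ) (hre : |z.re| ≤ 1 + ε / 2) :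
    |u z - (cL + cR) / 2| ≤ |cR - cL| / 2 + 32 * (|cR - cL| + 6 * |a|) * s ^ 2 := by
  set T : ℝ := |cR - cL| / 2 + 32 * (|cR - cL| + 6 * |a|) * s ^ 2
  set P : Set ℂ := closedExterior ε δ ∩ {y | |y.re| ≤ 1 + ε / 2}
  set U : Set ℂ := exterior ε δ ∩ {y | |y.re| < 1 + ε / 2}
  set C₀ : Set ℂ := closedExterior ε δ ∩ {y | |y.re| ≤ 1 + ε / 2 ∧ |y.im| ≤ 1 + δ / 2}
  have hC₀ : IsCompact C₀ := by
    have hbox := isCompact_abs_re_sub_le_abs_im_sub_le 0 (1 + ε / 2) (1 + δ / 2)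
    simp only [zero_re, zero_im, sub_zero] at hbox
    exact hbox.inter_left (isClosed_closedExterior ε δ)
  have hU : IsOpen U := (isOpen_exterior ε δ).inter (isOpen_lt (by fun_prop) continuous_const)
  have hUP : U ⊆ P := inter_subset_inter (exterior_subset_closedExterior hδ)
    fun y (hy : |y.re| < 1 + ε / 2) => hy.le
  have hC₀P : C₀ ⊆ P := fun y hy => ⟨hy.1, hy.2.1⟩
  have hrep : ∀ y ∈ P, ∃ y' ∈ C₀, y'.re = y.re ∧ u y' = u y := by
    rintro y ⟨hyK, hyr⟩
    obtain ⟨n, hn⟩ := exists_period_abs_im_le hδ y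
    have hr : (y + n * (2 + δ : ℝ) * I).re = y.re := by simp
    exact ⟨_, ⟨(add_period_mem_closedExterior n).2 hyK, hr.symm ▸ hyr, hn⟩, hr, by
      rw [h.periodic_int hyK]; ring⟩
  have hbd : ∀ y ∈ P, y ∉ U → |u y - (cL + cR) / 2| ≤ T := by
    rintro y ⟨hyK, hyr⟩ hyU
    by_cases hyE : y ∈ exterior ε δ
    · exact h.abs_sub_le_of_abs_re_eq hε hε1 hδ hs hs1 hδs hyK
        (le_antisymm hyr (not_lt.1 fun hlt => hyU ⟨hyE, hlt⟩))
    · obtain ⟨c, hc, hd⟩ := exists_center_of_mem_diff hδ hyK hyE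
      obtain ⟨k, hk, hu⟩ := h.exists_eq_on_circle hε hδ hc hd
      rw [hu, zero_mul, add_zero, hk]
      exact le_add_of_nonneg_right (by positivity)
  exact abs_sub_le_of_harmonicOnNhd_of_compact_representatives hU hUP hC₀ hC₀P
    (h.cont.mono inter_subset_left) (h.harmonic.mono inter_subset_left) hrep hbd z ⟨hz, hre⟩

end PeriodicSolution

/-! ### Asymptotics of the gradient -/

/-- The smallness of the two gaps under which the asymptotics hold. -/
structure IsThin (ε δ : ℝ) : Prop where
  eps_pos : 0 < ε
  delta_pos : 0 < δ
  sqrt_eps_le : 4 * gapConst * (gradConst (1 / 5) + 1) * √ε ≤ 1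
  delta_le : 500 * (gradConst (1 / 5) + 1) * δ ≤ 1

/-- A bound on `ε` and `δ` which ensures `IsThin ε δ`. -/
def thinRadius : ℝ := (1 / (4 * gapConst * (gradConst (1 / 5) + 1))) ^ 2

theorem gapConst_pos : 0 < gapConst := by linarith [twelve_lt_gapConst]

theorem gradConst_fifth_pos : 0 < gradConst (1 / 5) := gradConst_pos (by norm_num)

theorem thinRadius_pos : 0 < thinRadius := by
  have hK := gapConst_pos
  have hG := gradConst_fifth_pos
  unfold thinRadius
  positivity

theorem isThin_of_lt_thinRadius {ε δ : ℝ} (hε : 0 < ε) (hεr : ε < thinRadius) (hδ : 0 < δ)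
    (hδr : δ < thinRadius) : IsThin ε δ := by
  have hK := twelve_lt_gapConst
  have hG := gradConst_fifth_pos
  rw [thinRadius] at hεr hδr
  set Q : ℝ := 4 * gapConst * (gradConst (1 / 5) + 1) with hQ
  have hQG : 48 * (gradConst (1 / 5) + 1) ≤ Q := by
    rw [hQ]
    gcongr
    linarith
  have hQ0 : 0 < Q := by linarith
  refine ⟨hε, hδ, ?_, ?_⟩
  · calc Q * √ε ≤ Q * (1 / Q) := by
          gcongr
          exact (Real.sqrt_le_left (by positivity)).2 hεr.le
      _ = 1 := mul_one_div_cancel hQ0.ne'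
  · calc 500 * (gradConst (1 / 5) + 1) * δ ≤ Q ^ 2 * (1 / Q) ^ 2 := by
          gcongr
          nlinarith
      _ = 1 := by rw [← mul_pow, mul_one_div_cancel hQ0.ne', one_pow]

namespace IsThin

variable {ε δ : ℝ}

theorem gradConst_mul_gapConst_mul_sqrt_le (h : IsThin ε δ) :
    gradConst (1 / 5) * (gapConst * √ε) ≤ 1 / 4 := by
  have hK := mul_nonneg gapConst_pos.le (Real.sqrt_nonneg ε)
  linarith [h.sqrt_eps_le]

theorem gapConst_mul_sqrt_le (h : IsThin ε δ) : gapConst * √ε ≤ 1 / 4 := by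
  have hG := gradConst_fifth_pos
  have hK := mul_nonneg hG.le (mul_nonneg gapConst_pos.le (Real.sqrt_nonneg ε))
  linarith [h.sqrt_eps_le]

theorem sqrt_eps_le_one_div (h : IsThin ε δ) : √ε ≤ 1 / 48 := by
  have hK : 12 * √ε ≤ gapConst * √ε := by
    gcongr
    exact twelve_lt_gapConst.le
  linarith [h.gapConst_mul_sqrt_le]

theorem eps_lt (h : IsThin ε δ) : ε < 1 / 4 := by
  rw [← Real.sq_sqrt h.eps_pos.le]
  nlinarith [h.sqrt_eps_le_one_div, Real.sqrt_nonneg ε]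

theorem delta_lt (h : IsThin ε δ) : δ < 1 / 4 := by
  have hG := mul_pos gradConst_fifth_pos h.delta_pos
  linarith [h.delta_le]

theorem gradConst_mul_sqrt_le (h : IsThin ε δ) : 12 * gradConst (1 / 5) * √ε ≤ 1 := by
  have hK : gradConst (1 / 5) * (12 * √ε) ≤ gradConst (1 / 5) * (gapConst * √ε) := by
    have := gradConst_fifth_pos
    gcongr
    exact twelve_lt_gapConst.le
  linarith [h.gradConst_mul_gapConst_mul_sqrt_le]

end IsThin

namespace PeriodicSolution

variable {ε δ a b cL cR cL' cR' : ℝ} {u u' : ℂ → ℝ}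

theorem abs_sub_le (h : PeriodicSolution ε δ a b cL cR u) (ht : IsThin ε δ) :
    |cR - cL| ≤ gapConst * √ε * (|a| + |b|) :=
  h.abs_sub_le_gapConst_mul ht.eps_pos (by linarith [ht.eps_lt]) ht.delta_pos
    (by linarith [ht.delta_lt]) ht.gradConst_mul_sqrt_le

theorem symmetrize (h : PeriodicSolution ε δ a b cL cR u) (hε : 0 < ε) (hδ : 0 < δ) :
    PeriodicSolution ε δ a 0 cL cR ((1 / 2 : ℝ) • (u + fun z => u (conj z))) := by
  convert (h.add (h.reflect hε hδ) hε hδ).const_smul hε hδ (1 / 2) using 1 <;> ring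

/-- The reflection in the real axis removes `b`; the potential difference is linear in `a`, since it
vanishes when `a = b = 0`. -/
theorem sub_eq_mul_sub (h : PeriodicSolution ε δ a b cL cR u)
    (h' : PeriodicSolution ε δ 1 0 cL' cR' u') (ht : IsThin ε δ) :
    cR - cL = a * (cR' - cL') := by
  have hε := ht.eps_pos
  have hδ := ht.delta_pos
  have hdiff := ((h.symmetrize hε hδ).add (h'.const_smul hε hδ (-a)) hε hδ).abs_sub_le ht
  rw [mul_one, add_neg_cancel, mul_zero, add_zero, abs_zero, add_zero, mul_zero] at hdiff
  linarith [abs_nonpos_iff.1 hdiff]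

theorem sqrt_div_eight_le_sub_of_isThin (h : PeriodicSolution ε δ 1 0 cL cR u)
    (ht : IsThin ε δ) : √ε / 8 ≤ cR - cL := by
  have hG := gradConst_fifth_pos
  have hV := h.abs_sub_le ht
  have hGV := ht.gradConst_mul_gapConst_mul_sqrt_le
  have hV4 := ht.gapConst_mul_sqrt_le
  rw [abs_one, abs_zero, add_zero, mul_one] at hV
  have hε := ht.eps_lt
  have hδs := ht.delta_le
  set G := gradConst (1 / 5)
  set s : ℝ := √(1 / (1000 * (G + 1)))
  have hs : 0 < s := Real.sqrt_pos.2 (by positivity)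
  have hs2 : 1000 * (G + 1) * s ^ 2 = 1 := by
    rw [Real.sq_sqrt (by positivity), mul_one_div_cancel (by positivity)]
  have hGs : 0 < G * s ^ 2 := by positivity
  have hs1 : s < 1 := (sq_lt_one_iff₀ hs.le).1 (by linarith)
  have hδ2 : δ ≤ 2 * s ^ 2 := by
    refine le_of_mul_le_mul_left ?_ (by positivity : 0 < 500 * (G + 1))
    linarith
  refine h.sqrt_div_eight_le_sub ht.eps_pos (by linarith) ht.delta_pos
    (η := 32 * (|cR - cL| + 6 * |1|) * s ^ 2) ?_ fun y hy hr =>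
      h.abs_sub_le_of_abs_re_le ht.eps_pos (by linarith) ht.delta_pos hs hs1 hδ2 hy
        (by linarith [ht.eps_pos])
  calc G * (|cR - cL| + 32 * (|cR - cL| + 6 * |1|) * s ^ 2)
      ≤ G * (gapConst * √ε + 32 * (1 + 6) * s ^ 2) := by
        rw [abs_one, mul_one]
        gcongr
        linarith
    _ = G * (gapConst * √ε) + 224 * (G * s ^ 2) := by ring
    _ ≤ 1 / 2 := by nlinarith

end PeriodicSolution

theorem IsThin.exists_potential_difference {ε δ : ℝ} (ht : IsThin ε δ) :
    ∃ μ : ℝ, 1 / 8 ≤ μ ∧ μ ≤ gapConst ∧ ∀ (a b cL cR : ℝ) (u : ℂ → ℝ),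
      PeriodicSolution ε δ a b cL cR u → cR - cL = a * μ * √ε := by
  have hs : 0 < √ε := Real.sqrt_pos.2 ht.eps_pos
  by_cases hex : ∃ (cL cR : ℝ) (u : ℂ → ℝ), PeriodicSolution ε δ 1 0 cL cR u
  · obtain ⟨cL, cR, u, h⟩ := hex
    refine ⟨(cR - cL) / √ε, ?_, ?_, fun a b cL' cR' u' h' => ?_⟩
    · rw [le_div_iff₀ hs]
      linarith [h.sqrt_div_eight_le_sub_of_isThin ht]
    · rw [div_le_iff₀ hs]
      simpa only [abs_one, abs_zero, add_zero, mul_one] using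
        (le_abs_self _).trans (h.abs_sub_le ht)
    · rw [h'.sub_eq_mul_sub h ht, mul_assoc, div_mul_cancel₀ _ hs.ne']
  · refine ⟨1, by norm_num, by linarith [twelve_lt_gapConst], fun a b cL cR u h => ?_⟩
    have hv := h.symmetrize ht.eps_pos ht.delta_pos
    obtain rfl : a = 0 := by
      by_contra ha
      have hv1 := hv.const_smul ht.eps_pos ht.delta_pos a⁻¹
      rw [inv_mul_cancel₀ ha, mul_zero] at hv1
      exact hex ⟨_, _, _, hv1⟩
    have hzero := hv.abs_sub_le ht
    rw [abs_zero, add_zero, mul_zero] at hzero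
    rw [abs_nonpos_iff.1 hzero, zero_mul, zero_mul]

section Asymptotes

variable {ε δ : ℝ} {z : ℂ}

theorem abs_two_mul_mul_div_sq_le_of_narrow {ξ η : ℝ} (hε : 0 < ε)
    (hξ : |ξ| < 1 + ε / 2 - √(1 - η ^ 2)) (hη : |η| < √3 / 2) :
    |2 * ξ * η / (ε + η ^ 2) ^ 2| ≤ 1 / √ε := by
  have hs : 0 < √ε := Real.sqrt_pos.2 hε
  have hξ' : |ξ| ≤ ε + η ^ 2 := by linarith [abs_le_of_narrow hξ hη, sq_nonneg η]
  have hη' : 2 * √ε * |η| ≤ ε + η ^ 2 := by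
    simpa only [Real.sq_sqrt hε.le, sq_abs] using two_mul_le_add_sq (√ε) |η|
  rw [abs_div, abs_mul, abs_mul, abs_two, abs_of_pos (by positivity : 0 < (ε + η ^ 2) ^ 2),
    div_le_div_iff₀ (by positivity) hs]
  calc 2 * |ξ| * |η| * √ε = |ξ| * (2 * √ε * |η|) := by ring
    _ ≤ (ε + η ^ 2) * (ε + η ^ 2) := by gcongr
    _ = 1 * (ε + η ^ 2) ^ 2 := by ring

theorem one_div_sqrt_mul_S (hδ : 0 < δ) (z : ℂ) : 1 / √δ * S ε δ z =
    2 * (z.im - 1 - δ / 2) * -(z.re - 1 - ε / 2) / (δ + (-(z.re - 1 - ε / 2)) ^ 2) ^ 2 := by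
  have hs : √δ ≠ 0 := (Real.sqrt_pos.2 hδ).ne'
  rw [S]
  field_simp
  ring

theorem conj_one_div_add_div_mul_I (ε ξ η : ℝ) :
    conj (1 / (ε + η ^ 2) + 2 * ξ * η / (ε + η ^ 2) ^ 2 * I : ℂ) =
      (1 / (ε + η ^ 2) : ℝ) - (2 * ξ * η / (ε + η ^ 2) ^ 2 : ℝ) * I := by
  simp [map_ofNat, sub_eq_add_neg]

theorem gapCoord_midH (z : ℂ) :
    gapCoord (midH ε δ) I z = ⟨z.im - 1 - δ / 2, -(z.re - 1 - ε / 2)⟩ := by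
  apply Complex.ext <;> simp [gapCoord, midH] <;> ring

theorem norm_asympH_le (hδ : 0 < δ) (hδ1 : δ ≤ 1) (hz : z ∈ narrowH ε δ) :
    ‖asympH ε δ z‖ ≤ 2 / δ := by
  have hvert : ‖(1 / (δ + (z.re - 1 - ε / 2) ^ 2)) • I‖ ≤ 1 / δ := by
    rw [norm_smul, norm_I, mul_one, Real.norm_of_nonneg (by positivity)]
    gcongr
    exact le_add_of_nonneg_right (sq_nonneg _)
  have hhor : ‖(1 / √δ * S ε δ z) • (1 : ℂ)‖ ≤ 1 / δ := by
    rw [norm_smul, norm_one, mul_one, Real.norm_eq_abs, one_div_sqrt_mul_S hδ]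
    refine (abs_two_mul_mul_div_sq_le_of_narrow hδ ?_ ?_).trans ?_
    · rw [neg_sq]
      exact hz.1
    · rw [abs_neg]
      exact hz.2
    · gcongr
      exact Real.le_sqrt_of_sq_le (pow_le_of_le_one hδ.le hδ1 two_ne_zero)
  calc ‖asympH ε δ z‖ ≤ 1 / δ + 1 / δ := norm_add_le_of_le hvert hhor
    _ = 2 / δ := by ring

theorem norm_asympV (hε : 0 < ε) (z : ℂ) : ‖asympV ε z‖ = √ε / (ε + z.im ^ 2) := by
  rw [asympV, norm_smul, norm_one, mul_one, Real.norm_of_nonneg (by positivity)]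

theorem norm_asympV_le (hε : 0 < ε) (z : ℂ) : ‖asympV ε z‖ ≤ 1 / √ε := by
  rw [norm_asympV hε, ← Real.sqrt_div_self']
  gcongr
  exact le_add_of_nonneg_right (sq_nonneg _)

theorem norm_I_mul_conj_gapDeriv_sub_asympH_le (hδ : 0 < δ) (hδ4 : δ ≤ 1 / 4)
    (hz : z ∈ narrowH ε δ) :
    ‖I * conj (gapDeriv δ (gapCoord (midH ε δ) I z)) - asympH ε δ z‖ ≤ 15 := by
  rw [gapCoord_midH]
  set ζ : ℂ := ⟨z.im - 1 - δ / 2, -(z.re - 1 - ε / 2)⟩ with hζ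
  have hderiv := norm_gapDeriv_sub_le hδ hδ4 (ζ := ζ) (by simpa only [hζ, neg_sq] using hz.1)
    (by simpa only [hζ, abs_neg] using hz.2)
  have hasymp : asympH ε δ z =
      I * conj (1 / (δ + ζ.im ^ 2) + 2 * ζ.re * ζ.im / (δ + ζ.im ^ 2) ^ 2 * I) := by
    rw [conj_one_div_add_div_mul_I, asympH, one_div_sqrt_mul_S hδ, ← neg_sq (z.re - 1 - ε / 2),
      real_smul, real_smul]
    linear_combination ((2 * ζ.re * ζ.im / (δ + ζ.im ^ 2) ^ 2 : ℝ) : ℂ) * I_sq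
  rwa [hasymp, ← mul_sub, ← map_sub, norm_mul, norm_I, one_mul, norm_conj]

theorem norm_sqrt_smul_conj_gapDeriv_sub_asympV_le (hε : 0 < ε) (hε4 : ε ≤ 1 / 4)
    (hz : z ∈ narrowV ε) : ‖√ε • conj (gapDeriv ε z) - asympV ε z‖ ≤ 16 := by
  have hs : 0 < √ε := Real.sqrt_pos.2 hε
  have hs1 : √ε ≤ 1 := Real.sqrt_le_one.2 (by linarith)
  set q : ℝ := 2 * z.re * z.im / (ε + z.im ^ 2) ^ 2 with hq
  have hderiv := norm_gapDeriv_sub_le hε hε4 hz.1 hz.2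
  have hshear : √ε * |q| ≤ 1 := by
    rw [← le_div_iff₀' hs]
    exact abs_two_mul_mul_div_sq_le_of_narrow hε hz.1 hz.2
  have hsplit : √ε • conj (gapDeriv ε z) - asympV ε z =
      √ε • conj (gapDeriv ε z - (1 / (ε + z.im ^ 2) + 2 * z.re * z.im / (ε + z.im ^ 2) ^ 2 * I)) -
        (√ε * q) • I := by
    rw [map_sub, conj_one_div_add_div_mul_I, asympV]
    simp only [real_smul, hq]
    push_cast
    ring
  rw [hsplit]
  calc _ ≤ √ε * 15 + √ε * |q| := by
        refine norm_sub_le_of_le ?_ ?_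
        · rw [norm_smul, norm_conj, Real.norm_of_nonneg hs.le]
          gcongr
        · rw [norm_smul, norm_I, mul_one, Real.norm_eq_abs, abs_mul, abs_of_pos hs]
    _ ≤ 16 := by linarith

end Asymptotes

namespace PeriodicSolution

variable {ε δ a b cL cR : ℝ} {u : ℂ → ℝ} {z : ℂ}

theorem norm_gradient_sub_asympH_le (h : PeriodicSolution ε δ a b cL cR u) (hε : 0 < ε)
    (hε1 : ε < 1) (hδ : 0 < δ) (hδ4 : δ ≤ 1 / 4) (hV : |cR - cL| ≤ |a| + |b|)
    (hz : z ∈ narrowH ε δ) :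
    ‖gradient u z - (2 * b) • asympH ε δ z‖ ≤ (11 * gradConst (1 / 5) + 47) * (|a| + |b|) := by
  have hG := gradConst_fifth_pos
  have hgap := h.norm_gradient_sub_le_of_mem_narrowH hε hε1 hδ (by linarith) hz
  have hderiv := norm_I_mul_conj_gapDeriv_sub_asympH_le hδ hδ4 hz
  have hasymp := norm_asympH_le hδ (by linarith) hz
  set G := gradConst (1 / 5)
  set D : ℂ := I * conj (gapDeriv δ (gapCoord (midH ε δ) I z))
  have hsplit : gradient u z - (2 * b) • asympH ε δ z =
      (gradient u z - (b * (2 + δ) : ℝ) * D) + (b * (2 + δ)) • (D - asympH ε δ z) +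
        (b * δ) • asympH ε δ z := by
    simp only [real_smul]
    push_cast
    ring
  have hmain : ‖(b * (2 + δ)) • (D - asympH ε δ z)‖ ≤ |b| * 3 * 15 := by
    rw [norm_smul, Real.norm_eq_abs, abs_mul, abs_of_pos (by linarith : 0 < 2 + δ)]
    gcongr
    linarith
  have hperiod : ‖(b * δ) • asympH ε δ z‖ ≤ |b| * 2 := by
    rw [norm_smul, Real.norm_eq_abs, abs_mul, abs_of_pos hδ]
    calc |b| * δ * ‖asympH ε δ z‖ ≤ |b| * δ * (2 / δ) := by gcongr
      _ = |b| * 2 := by field_simp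
  rw [hsplit]
  calc _ ≤ G * (|cR - cL| + 10 * (|a| + |b|)) + |b| * 3 * 15 + |b| * 2 :=
        norm_add_le_of_le (norm_add_le_of_le hgap hmain) hperiod
    _ ≤ G * ((|a| + |b|) + 10 * (|a| + |b|)) + 47 * (|a| + |b|) := by
        have hle : G * (|cR - cL| + 10 * (|a| + |b|)) ≤
          G * ((|a| + |b|) + 10 * (|a| + |b|)) := by gcongr
        linarith [abs_nonneg a]
    _ = _ := by ring

theorem norm_gradient_sub_asympV_le (h : PeriodicSolution ε δ a b cL cR u)
    (hε : 0 < ε) (hε4 : ε ≤ 1 / 4) (hδ : 0 < δ) {μ : ℝ} (hV : cR - cL = a * μ * √ε)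
    (hV1 : |cR - cL| ≤ |a| + |b|) (hz : z ∈ narrowV ε) :
    ‖gradient u z - (a * μ) • asympV ε z‖ ≤ (6 * gradConst (1 / 5) + 16 * |μ|) * (|a| + |b|) := by
  have hG := gradConst_fifth_pos
  have him : |z.im| ≤ 9 / 5 := by linarith [hz.2, sqrt_three_div_two_lt]
  have hre : |z.re| ≤ 9 / 5 := by
    linarith [abs_le_of_narrow hz.1 hz.2, sq_lt_of_abs_lt_sqrt_three_div_two hz.2]
  have hgap := h.norm_gradient_sub_le hε (by linarith) hδ (narrowV_subset_exterior hε hδ hz)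
    (fun c hc => lt_dist_of_mem_narrowV hε hδ hz hc) hre him
  have hderiv := norm_sqrt_smul_conj_gapDeriv_sub_asympV_le hε hε4 hz
  have hsplit : gradient u z - (a * μ) • asympV ε z =
      (gradient u z - (cR - cL : ℝ) * conj (gapDeriv ε z)) +
        (a * μ) • (√ε • conj (gapDeriv ε z) - asympV ε z) := by
    rw [hV]
    simp only [real_smul]
    push_cast
    ring
  have hmain : ‖(a * μ) • (√ε • conj (gapDeriv ε z) - asympV ε z)‖ ≤ |a| * |μ| * 16 := by
    rw [norm_smul, Real.norm_eq_abs, abs_mul]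
    gcongr
  rw [hsplit]
  calc _ ≤ gradConst (1 / 5) * (|cR - cL| + 5 * (|a| + |b|)) + |a| * |μ| * 16 :=
        norm_add_le_of_le hgap hmain
    _ ≤ gradConst (1 / 5) * ((|a| + |b|) + 5 * (|a| + |b|)) + (|a| + |b|) * |μ| * 16 := by
        gcongr
        exact le_add_of_nonneg_right (abs_nonneg b)
    _ = _ := by ring

end PeriodicSolution

/-- The constant in the bounds of the remainders. -/
def remainderConst : ℝ := 11 * gradConst (1 / 5) + 47 + 16 * gapConst

theorem gapConst_le_remainderConst : gapConst ≤ remainderConst := by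
  rw [remainderConst]
  linarith [gradConst_fifth_pos, gapConst_pos]

theorem one_le_remainderConst : 1 ≤ remainderConst := by
  linarith [gapConst_le_remainderConst, twelve_lt_gapConst]

theorem IsThin.exists_asymptotics {ε δ : ℝ} (ht : IsThin ε δ) :
    ∃ μ : ℝ, 1 / 8 ≤ μ ∧ μ ≤ remainderConst ∧ ∀ (a b : ℝ) (u : ℂ → ℝ),
      IsSolution ε δ (linearPotential a b) u →
        (∀ z ∈ narrowH ε δ,
          ‖gradient u z - (2 * b) • asympH ε δ z‖ ≤ remainderConst * (|a| + |b|)) ∧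
        ∀ z ∈ narrowV ε, ‖gradient u z - (a * μ) • asympV ε z‖ ≤ remainderConst * (|a| + |b|) := by
  obtain ⟨μ, hμ8, hμK, hμ⟩ := ht.exists_potential_difference
  refine ⟨μ, hμ8, hμK.trans gapConst_le_remainderConst, fun a b u hu => ?_⟩
  have hε4 := ht.eps_lt
  obtain ⟨cL, cR, h⟩ := hu.exists_periodicSolution ht.eps_pos (by linarith) ht.delta_pos
  have hV : |cR - cL| ≤ |a| + |b| := (h.abs_sub_le ht).trans
    (mul_le_of_le_one_left (by positivity) (by linarith [ht.gapConst_mul_sqrt_le]))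
  refine ⟨fun z hz => ?_, fun z hz => ?_⟩
  · refine (h.norm_gradient_sub_asympH_le ht.eps_pos (by linarith) ht.delta_pos ht.delta_lt.le hV
      hz).trans ?_
    gcongr
    rw [remainderConst]
    linarith [gapConst_pos]
  · refine (h.norm_gradient_sub_asympV_le ht.eps_pos hε4.le ht.delta_pos (hμ a b cL cR u h) hV
      hz).trans ?_
    gcongr
    rw [abs_of_pos (by linarith), remainderConst]
    linarith [gradConst_fifth_pos]

section BlowUp

variable {ε δ a b D N μ : ℝ} {v z : ℂ}

theorem norm_le_of_norm_sub_asympH_le (hδ : 0 < δ) (hδ1 : δ ≤ 1) (hD : 1 ≤ D) (hb : |b| ≤ N)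
    (hz : z ∈ narrowH ε δ) (hv : ‖v - (2 * b) • asympH ε δ z‖ ≤ D * N) :
    ‖v‖ ≤ 16 * D * N / δ := by
  have hN : 0 ≤ N := (abs_nonneg b).trans hb
  have hasymp : ‖(2 * b) • asympH ε δ z‖ ≤ 2 * N * (2 / δ) := by
    rw [norm_smul, Real.norm_eq_abs, abs_mul, abs_two]
    gcongr
    exact norm_asympH_le hδ hδ1 hz
  calc ‖v‖ ≤ ‖v - (2 * b) • asympH ε δ z‖ + ‖(2 * b) • asympH ε δ z‖ := norm_le_norm_sub_add _ _
    _ ≤ D * N / δ + 4 * (1 * N) / δ := by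
        refine add_le_add (hv.trans (le_div_self (by positivity) hδ hδ1)) (hasymp.trans_eq ?_)
        ring
    _ ≤ D * N / δ + 4 * (D * N) / δ := by gcongr
    _ = 5 * (D * N) / δ := by ring
    _ ≤ 16 * (D * N) / δ := by
        gcongr
        norm_num
    _ = 16 * D * N / δ := by ring

theorem norm_le_of_norm_sub_asympV_le (hε : 0 < ε) (hε1 : ε ≤ 1) (hμ : 0 < μ) (hμD : μ ≤ D)
    (ha : |a| ≤ N) (hv : ‖v - (a * μ) • asympV ε z‖ ≤ D * N) : ‖v‖ ≤ 16 * D * N / √ε := by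
  have hN : 0 ≤ N := (abs_nonneg a).trans ha
  have hD : 0 ≤ D := hμ.le.trans hμD
  have hs : 0 < √ε := Real.sqrt_pos.2 hε
  have hasymp : ‖(a * μ) • asympV ε z‖ ≤ N * D * (1 / √ε) := by
    rw [norm_smul, Real.norm_eq_abs, abs_mul, abs_of_pos hμ]
    gcongr
    exact norm_asympV_le hε z
  calc ‖v‖ ≤ ‖v - (a * μ) • asympV ε z‖ + ‖(a * μ) • asympV ε z‖ := norm_le_norm_sub_add _ _
    _ ≤ D * N / √ε + N * D * (1 / √ε) :=
        add_le_add (hv.trans (le_div_self (by positivity) hs (Real.sqrt_le_one.2 hε1))) hasymp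
    _ = 2 * (D * N) / √ε := by ring
    _ ≤ 16 * (D * N) / √ε := by
        gcongr
        norm_num
    _ = 16 * D * N / √ε := by ring

theorem midH_mem_narrowH (ε : ℝ) (hδ : 0 < δ) : midH ε δ ∈ narrowH ε δ := by
  simp [narrowH, midH, hδ]

theorem zero_mem_narrowV (hε : 0 < ε) : 0 ∈ narrowV ε := by
  simp [narrowV, hε]

theorem asympH_midH (ε δ : ℝ) : asympH ε δ (midH ε δ) = (1 / δ) • I := by
  simp [asympH, S, midH]

theorem le_norm_of_norm_sub_asympH_midH_le (hδ : 0 < δ) (hD : 1 ≤ D)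
    (hv : ‖v - (2 * b) • asympH ε δ (midH ε δ)‖ ≤ D * N) (hb : 16 * D * δ * N ≤ |b|) :
    |b| / (16 * D * δ) ≤ ‖v‖ := by
  have hasymp : ‖(2 * b) • asympH ε δ (midH ε δ)‖ = 2 * |b| / δ := by
    rw [asympH_midH, norm_smul, norm_smul, norm_I, Real.norm_eq_abs, abs_mul, abs_two,
      Real.norm_of_nonneg (by positivity)]
    ring
  have hrem : D * N ≤ |b| / (16 * δ) := by
    rw [le_div_iff₀ (by positivity)]
    linarith
  calc |b| / (16 * D * δ) ≤ |b| / (1 * 1 * δ) := by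
        gcongr
        norm_num
    _ = 2 * |b| / δ - |b| / δ := by ring
    _ ≤ 2 * |b| / δ - |b| / (16 * δ) := by
        gcongr
        linarith
    _ ≤ ‖(2 * b) • asympH ε δ (midH ε δ)‖ - ‖v - (2 * b) • asympH ε δ (midH ε δ)‖ := by
        rw [hasymp]
        gcongr
        exact hv.trans hrem
    _ ≤ ‖v‖ := by linarith [norm_sub_norm_le ((2 * b) • asympH ε δ (midH ε δ)) v,
        norm_sub_rev v ((2 * b) • asympH ε δ (midH ε δ))]

theorem le_norm_of_norm_sub_asympV_zero_le (hε : 0 < ε) (hD : 1 ≤ D) (hμ : 1 / 8 ≤ μ)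
    (hv : ‖v - (a * μ) • asympV ε 0‖ ≤ D * N) (ha : 16 * D * √ε * N ≤ |a|) :
    |a| / (16 * D * √ε) ≤ ‖v‖ := by
  have hasymp : ‖(a * μ) • asympV ε 0‖ = |a| * μ / √ε := by
    rw [norm_smul, norm_asympV hε, zero_im, zero_pow two_ne_zero, add_zero, Real.sqrt_div_self',
      Real.norm_eq_abs, abs_mul, abs_of_nonneg (by linarith : 0 ≤ μ)]
    ring
  have hrem : D * N ≤ |a| / (16 * √ε) := by
    rw [le_div_iff₀ (by positivity)]
    linarith
  calc |a| / (16 * D * √ε) ≤ |a| / (16 * 1 * √ε) := by gcongr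
    _ = |a| * (1 / 8) / √ε - |a| / (16 * √ε) := by ring
    _ ≤ ‖(a * μ) • asympV ε 0‖ - ‖v - (a * μ) • asympV ε 0‖ := by
        rw [hasymp]
        gcongr
        exact hv.trans hrem
    _ ≤ ‖v‖ := by linarith [norm_sub_norm_le ((a * μ) • asympV ε 0) v,
        norm_sub_rev v ((a * μ) • asympV ε 0)]

end BlowUp

end TwoRows

end

theorem theorem1p3 :
    ∃ C > (0 : ℝ), ∃ r > (0 : ℝ), ∀ ε δ : ℝ, 0 < ε → ε < r → 0 < δ → δ < r →
      ∃ μ₀ : ℝ, 1 / C < μ₀ ∧ μ₀ < C ∧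
        ∀ (a b : ℝ) (u : ℂ → ℝ), TwoRows.IsSolution ε δ (TwoRows.linearPotential a b) u →
          -- the two asymptotes, with uniformly bounded remainders
          (∃ R₁ R₂ : ℂ → ℂ,
            (∀ z ∈ TwoRows.narrowH ε δ,
              gradient u z = (2 * b) • TwoRows.asympH ε δ z + R₁ z) ∧
            (∀ z ∈ TwoRows.narrowV ε,
              gradient u z = (a * μ₀) • TwoRows.asympV ε z + R₂ z) ∧
            (∀ z ∈ TwoRows.narrowH ε δ, ∀ w ∈ TwoRows.narrowV ε,
              ‖R₁ z‖ + ‖R₂ w‖ ≤ C * (|a| + |b|))) ∧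
          -- the blow-up rate `1 / δ` in the horizontal region, and its optimality
          (∀ z ∈ TwoRows.narrowH ε δ, ‖gradient u z‖ ≤ C * (|a| + |b|) / δ) ∧
          (C * δ * (|a| + |b|) ≤ |b| →
            ∃ z ∈ TwoRows.narrowH ε δ, |b| / (C * δ) ≤ ‖gradient u z‖) ∧
          -- the blow-up rate `1 / √ε` in the vertical region, and its optimality
          (∀ z ∈ TwoRows.narrowV ε, ‖gradient u z‖ ≤ C * (|a| + |b|) / √ε) ∧
          (C * √ε * (|a| + |b|) ≤ |a| →
            ∃ z ∈ TwoRows.narrowV ε, |a| / (C * √ε) ≤ ‖gradient u z‖) := by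
  have hD := TwoRows.one_le_remainderConst
  refine ⟨16 * TwoRows.remainderConst, by positivity, TwoRows.thinRadius, TwoRows.thinRadius_pos,
    fun ε δ hε hεr hδ hδr => ?_⟩
  have ht := TwoRows.isThin_of_lt_thinRadius hε hεr hδ hδr
  obtain ⟨μ, hμ8, hμD, hμ⟩ := ht.exists_asymptotics
  refine ⟨μ, ?_, by linarith, fun a b u hu => ?_⟩
  · calc 1 / (16 * TwoRows.remainderConst) ≤ 1 / (16 * 1) := by gcongr
      _ < 1 / 8 := by norm_num
      _ ≤ μ := hμ8
  obtain ⟨hH, hV⟩ := hμ a b u hu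
  refine ⟨⟨fun z => gradient u z - (2 * b) • TwoRows.asympH ε δ z,
      fun z => gradient u z - (a * μ) • TwoRows.asympV ε z, fun z _ => (add_sub_cancel _ _).symm,
      fun z _ => (add_sub_cancel _ _).symm, fun z hz w hw => ?_⟩,
    fun z hz => TwoRows.norm_le_of_norm_sub_asympH_le hδ (by linarith [ht.delta_lt]) hD
      (le_add_of_nonneg_left (abs_nonneg a)) hz (hH z hz),
    fun hb => ⟨_, TwoRows.midH_mem_narrowH ε hδ,
      TwoRows.le_norm_of_norm_sub_asympH_midH_le hδ hD (hH _ (TwoRows.midH_mem_narrowH ε hδ)) hb⟩,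
    fun z hz => TwoRows.norm_le_of_norm_sub_asympV_le hε (by linarith [ht.eps_lt]) (by linarith) hμD
      (le_add_of_nonneg_right (abs_nonneg b)) (hV z hz),
    fun ha => ⟨0, TwoRows.zero_mem_narrowV hε,
      TwoRows.le_norm_of_norm_sub_asympV_zero_le hε hD hμ8 (hV 0 (TwoRows.zero_mem_narrowV hε)) ha⟩⟩
  have hN : 0 ≤ TwoRows.remainderConst * (|a| + |b|) := by positivity
  linarith [hH z hz, hV w hw]
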